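/- Let $N\ge 2$ be an even integer, $\kappa_N=(-1)^{1+N/2}$, and let $p(t;x)$ be the elementary solution of $\partial_t u=\kappa_N\,\partial_x^N u$, characterized by $\int_{\mathbb R}e^{i\mu x}p(t;x)\,dx=e^{\kappa_N t(-i\mu)^N}$. Let $X$ be the pseudo-process started at $0$ driven by the signed kernel $p$. For $n\ge 0$, the pseudo-expectation of a bounded Borel function of $X(1/2^n),\dots,X(k/2^n)$ is its integral against $\prod_{j=1}^k p(2^{-n};x_{j-1}-x_j)\,dx_1\cdots dx_k$ with $x_0=0$. Put $X_n(t)=X(j/2^n)$ for $t\in[j/2^n,(j+1)/2^n)$ and $T_n(t)=\int_0^t \mathbf 1_{[0,\infty)}(X_n(u))\,du$. For $\lambda,\nu>0$ and $\mu\in\mathbb R$ let $$E_n(\lambda,\mu,\nu)=\sum_{k\ge 0}\mathbb E\Big[\int_{k/2^n}^{(k+1)/2^n}e^{-\lambda t+i\mu X_n(t)-\nu T_n(t)}\,dt\Big]$$ (an absolutely convergent series of pseudo-expectations) and $E(\lambda,\mu,\nu)=\lim_{n\to\infty}E_n(\lambda,\mu,\nu)$. With $T(t)=\int_0^t\mathbf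 1_{[0,\infty)}(X(u))\,du$ the sojourn time, a joint density of $(T(t),X(t))$, written $f(t,s,x)=\mathbb P\{T(t)\in ds,X(t)\in dx\}/(ds\,dx)$, is a real function on $t>0,\ s>0,\ x\in\mathbb R$ such that, for all $\lambda,\nu>0$ and $\mu\in\mathbb R$, $E(\lambda,\mu,\nu)$ exists and $$\int_0^\infty\!\!\int_0^\infty\!\!\int_{\mathbb R} e^{-\lambda t+i\mu x-\nu s}f(t,s,x)\,dx\,ds\,dt=E(\lambda,\mu,\nu),$$ the integral being absolutely convergent. Let $\theta_i$, $1\le i\le N$, be the $N$-th roots of $\kappa_N$, $J=\{i:\Re\theta_i>0\}$, $K=\{i:\Re\theta_i<0\}$, $A_j=\prod_{i\in J\setminus\{j\}}\frac{\theta_i}{\theta_i-\theta_j}$ for $j\in J$, $B_k=\prod_{i\in K\setminus\{k\}}\frac{\theta_i}{\theta_i-\theta_k}$ for $k\in K$, $\alpha_m=\sum_{j\in J}A_j\theta_j^m$ for $m\in\mathbb Z$, and $E_{a,b}(z)=\sum_{r\ge 0}z^r/\Gamma(ar+b)$ (the Mittag-Leffler function). Theorem. The couple $(T(t),X(t))$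 has a joint density $f$ which vanishes for $s\ge t$, is continuous on $\{0<s<t,\ x\le 0\}$, and satisfies, for all $\lambda>0$, $s>0$ and $x\le 0$, with an absolutely convergent integral, $$\int_0^\infty e^{-\lambda t}f(t,s,x)\,dt=-\,e^{-\lambda s}\,\lambda^{-\frac{\#K-1}{N}}\,s^{-\frac{\#K}{N}}\sum_{m=0}^{\#K}\alpha_{-m}\,(\lambda s)^{\frac mN}\,E_{1,\frac{m+\#J}{N}}(\lambda s)\sum_{k\in K}B_k\,\theta_k^{m+1}\,e^{-\theta_k\lambda^{1/N}x}.$$ Moreover, for every joint density $f$ of $(T(t),X(t))$ and every $\lambda>0$, this holds for almost every $(s,x)\in(0,\infty)\times(-\infty,0]$. -/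

import Mathlib

open MeasureTheory Filter Topology Set

noncomputable section

namespace PseudoProcess

/-! ### The heat kernel of order `N` -/

/-- The constant `κ_N = (-1)^{1+N/2}` (for even `N`). -/
def kappa (N : ℕ) : ℂ := (-1) ^ (1 + N / 2)

/-- The elementary solution `p(t;x)` of `∂u/∂t = κ_N ∂^N u/∂x^N`, i.e. the real function whose
Fourier transform `∫ e^{iμx} p(t;x) dx` is `exp (κ_N t (-iμ)^N)`, written by Fourier inversion. -/
def kernel (N : ℕ) (t x : ℝ) : ℝ :=
  ((2 * Real.pi : ℂ)⁻¹ * ∫ μ : ℝ, Complex.exp (-(Complex.I * μ * x)) *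
    Complex.exp (kappa N * t * (-(Complex.I * μ)) ^ N)).re

/-! ### The pseudo-process started at `0`, observed at the times `j / 2^n` -/

/-- The sequence `X(0), X(1/2^n), …, X(k/2^n)` with `X(0) = 0` and `X(j/2^n)` the `j`-th entry of
`y` for `1 ≤ j ≤ k` (the entries with `j > k` play no role and are set to `0`). -/
def observations {k : ℕ} (y : Fin k → ℝ) (j : ℕ) : ℝ :=
  if h : 1 ≤ j ∧ j ≤ k then y ⟨j - 1, by omega⟩ else 0

/-- The pseudo-expectation of the tame function `F (X(0), X(1/2^n), …, X(k/2^n))`: the integral of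
`F` against `∏ p(1/2^n; x_{j-1} - x_j) dx_1 ⋯ dx_k`, with `x_0 = 0`. -/
def tameExpectation (N n k : ℕ) (F : (ℕ → ℝ) → ℂ) : ℂ :=
  ∫ y : Fin k → ℝ, F (observations y) *
    ((∏ j ∈ Finset.range k,
      kernel N (1 / 2 ^ n) (observations y j - observations y (j + 1)) : ℝ) : ℂ)

/-- The step path `X_n(t) = X(j/2^n)` for `t ∈ [j/2^n, (j+1)/2^n)`. -/
def stepPath (n : ℕ) (ω : ℕ → ℝ) (t : ℝ) : ℝ := ω ⌊2 ^ n * t⌋₊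

/-- The sojourn time `T_n(t) = ∫_0^t 1_{[0,∞)}(X_n(u)) du`. -/
def stepSojourn (n : ℕ) (ω : ℕ → ℝ) (t : ℝ) : ℝ :=
  ∫ u in (0 : ℝ)..t, (Ici (0 : ℝ)).indicator (fun _ => (1 : ℝ)) (stepPath n ω u)

/-- The part of `∫_0^∞ e^{-λt + iμX_n(t) - νT_n(t)} dt` over `[k/2^n, (k+1)/2^n)`; it depends on
`X(0), …, X(k/2^n)` only. -/
def functionalTerm (lam μ ν : ℝ) (n k : ℕ) (ω : ℕ → ℝ) : ℂ :=
  ∫ t in ((k : ℝ) / 2 ^ n)..(((k : ℝ) + 1) / 2 ^ n),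
    Complex.exp (-(lam * t : ℝ) + Complex.I * (μ * stepPath n ω t : ℝ) - (ν * stepSojourn n ω t : ℝ))

/-- The pseudo-expectation of `functionalTerm`. -/
def termExpectation (N : ℕ) (lam μ ν : ℝ) (n k : ℕ) : ℂ :=
  tameExpectation N n k (functionalTerm lam μ ν n k)

/-- `E(λ,μ,ν) = e`, that is: `∫_0^∞ e^{-λt + iμX(t) - νT(t)} dt` is an admissible functional of the
pseudo-process with pseudo-expectation `e`. For each `n` the step-process functional is a series of
tame functions with absolutely convergent series of expectations, whose sum is `E_n(λ,μ,ν)`, and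
`E_n(λ,μ,ν) → e`. -/
def HasTransform (N : ℕ) (lam μ ν : ℝ) (e : ℂ) : Prop :=
  (∀ n : ℕ, Summable fun k : ℕ => ‖termExpectation N lam μ ν n k‖) ∧
    Tendsto (fun n : ℕ => ∑' k : ℕ, termExpectation N lam μ ν n k) atTop (𝓝 e)

/-- `f t s x` is a joint density `P{T(t) ∈ ds, X(t) ∈ dx} / (ds dx)` of sojourn time and position:
its Laplace–Fourier transform `∫∫∫ e^{-λt + iμx - νs} f(t,s,x) dt ds dx` over
`t > 0, s > 0, x ∈ ℝ` converges absolutely and is the transform `E(λ,μ,ν)` of `(T(t), X(t))`. -/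
def IsJointDensity (N : ℕ) (f : ℝ → ℝ → ℝ → ℝ) : Prop :=
  ∀ lam ν μ : ℝ, 0 < lam → 0 < ν →
    IntegrableOn (fun q : ℝ × ℝ × ℝ => Real.exp (-lam * q.1 - ν * q.2.1) * f q.1 q.2.1 q.2.2)
      (Ioi 0 ×ˢ Ioi 0 ×ˢ univ) ∧
    HasTransform N lam μ ν
      (∫ q in (Ioi (0 : ℝ) ×ˢ Ioi (0 : ℝ) ×ˢ (univ : Set ℝ)),
        Complex.exp (-(lam * q.1 : ℝ) + Complex.I * (μ * q.2.2 : ℝ) - (ν * q.2.1 : ℝ)) *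
          (f q.1 q.2.1 q.2.2 : ℂ))

/-! ### The algebraic quantities -/

/-- The `N`-th roots `θ_j`, `j ∈ J`, of `κ_N` with positive real part. -/
def rootsJ (N : ℕ) : Finset ℂ :=
  (Polynomial.nthRootsFinset N (kappa N)).filter fun θ => 0 < θ.re

/-- The `N`-th roots `θ_k`, `k ∈ K`, of `κ_N` with negative real part. -/
def rootsK (N : ℕ) : Finset ℂ :=
  (Polynomial.nthRootsFinset N (kappa N)).filter fun θ => θ.re < 0

/-- `∏_{i ∈ S ∖ {θ}} i / (i - θ)`; this is `A_j` for `S = J`, `θ = θ_j`, and `B_k` for `S = K`,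
`θ = θ_k`. -/
def vandermondeCoeff (S : Finset ℂ) (θ : ℂ) : ℂ := ∏ i ∈ S.erase θ, i / (i - θ)

/-- `α_m = ∑_{j ∈ J} A_j θ_j^m` for `m ∈ ℤ`. -/
def alpha (N : ℕ) (m : ℤ) : ℂ := ∑ θ ∈ rootsJ N, vandermondeCoeff (rootsJ N) θ * θ ^ m

/-- The Mittag-Leffler function `E_{a,b}(z) = ∑_{r ≥ 0} z^r / Γ(ar+b)`. -/
def mittagLeffler (a b : ℝ) (z : ℂ) : ℂ := ∑' r : ℕ, z ^ r / (Real.Gamma (a * r + b) : ℂ)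

/-- The claimed value, at `(s,x)` with `x ≤ 0`, of the Laplace transform in `t` of the density. -/
def laplaceFormula (N : ℕ) (lam s x : ℝ) : ℂ :=
  -((Real.exp (-lam * s) * lam ^ (-(((rootsK N).card : ℝ) - 1) / N) *
      s ^ (-((rootsK N).card : ℝ) / N) : ℝ) : ℂ) *
    ∑ m ∈ Finset.range ((rootsK N).card + 1),
      alpha N (-(m : ℤ)) * (((lam * s) ^ ((m : ℝ) / N) : ℝ) : ℂ) *
        mittagLeffler 1 (((m : ℝ) + (rootsJ N).card) / N) ((lam * s : ℝ) : ℂ) *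
        ∑ θ ∈ rootsK N, vandermondeCoeff (rootsK N) θ * θ ^ (m + 1) *
          Complex.exp (-θ * ((lam ^ (1 / (N : ℝ)) : ℝ) : ℂ) * (x : ℂ))

end PseudoProcess

end

namespace PseudoProcess

/-! ### Integrable functions annihilated by a separating family of functions -/

/-! Sampled at the times `j/2^n`, `X` is a random walk whose steps have the signed law `p(h;·)`, `h
= 2^{-n}`. On each cell the path is constant, so the step functional turns into a power series in `z
= e^{-λh}` whose coefficients are integrals over paths, with a weight `w = e^{-νh}` for every
position in `[0,∞)`. Let `H_k^±` be the Fourier transforms of the two half-line parts of the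
weighted densities and `f` the symbol `e^{-hμ^N}` of one step. The series `U = 1 - (1-w)∑ H_k^+
z^{k+1}` and `V = 1 + (1-w)∑ H_k^- z^{k+1}` are `(1 - fz)G` and `(1 - wfz)G` for one and the same
`G`. A transform of integrable functions carried by both half lines vanishes, and this forces the
logarithmic derivatives of `U` and `V` to be the half-line parts of an explicit series
(`spitzer_identity`). Positivity plays no role: self-similarity makes the total variation of
`p(t;·)` independent of `t`, which gives all convergence (`summable_and_tsum_eq_exp`).

As `n → ∞` these logarithms are Riemann sums of Frullani integrals `∫ (e^{-λt} - e^{-σt}) t⁻¹ ψ(t)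
dt`, `σ = λ+ν`, where `ψ` is a half-line Fourier transform of the kernel. Their derivative in `σ` is
the Laplace transform of `ψ`, namely the part belonging to `J` (for `[0,∞)`) or to `K` (for
`(-∞,0)`) of the partial fractions of `1/(σ+μ^N)`, see `laplacePartialFourier_eq`. Integrating in
`σ` yields `hasTransform`: `E(λ,μ,ν)⁻¹ = ∏_J ((λ+ν)^{1/N} - iμθ) ∏_K (λ^{1/N} - iμθ)`.

Each of the two factors is inverted separately. The roots in `J` leave the sector `|arg y| ≤ π/N`
free of poles of `∏_J (y+pc)⁻¹`; Cauchy's formula there, collapsed onto the two boundary rays where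
`y^N = -ρ^N`, writes `∏_J (σ^{1/N}+pc)⁻¹` as a double Laplace transform of an explicit function
`h(s,x)`, the `halfDensity`. Since `e^{-λt-νs+iμx}` splits as `e^{-(λ+ν)s+iμy} e^{-λ(t-s)-iμ(y-x)}`,
the function `∫ h(s,y) h(t-s,y-x) dy` has the transform `E` and is a joint density.

For `x ≤ 0` every `y > 0` has `y - x > 0`, so the Laplace transform in `t` replaces `h(t-s,y-x)` by
a sum of exponentials `e^{-cλ^{1/N}(y-x)}`, `c ∈ J` (`laplace_halfDensity`). There remain the
integrals `∫ e^{-cλ^{1/N}y} h(s,y) dy`. Their Laplace transform in `s` is `∏_J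
(σ^{1/N}+cλ^{1/N}θ)⁻¹`, which equals a polynomial in `σ^{1/N}` with coefficients built from
`α_{-m}`, divided by `σ - λ`; termwise inversion produces the Mittag-Leffler functions
(`integral_exp_mul_halfDensity`). Injectivity of the Laplace–Laplace–Fourier transform carries the
formula over to any other version of the density. -/

open BoundedContinuousFunction in
theorem ae_eq_zero_of_starSubalgebra {E : Type*} [TopologicalSpace E] [PolishSpace E]
    [MeasurableSpace E] [BorelSpace E] {m : Measure E} {g : E → ℝ} (hg : Integrable g m)
    (A : StarSubalgebra ℂ (E →ᵇ ℂ)) (hA : (A.map (toContinuousMapStarₐ ℂ)).SeparatesPoints)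
    (h : ∀ φ ∈ A, ∫ x, φ x * g x ∂m = 0) : g =ᵐ[m] 0 := by
  have hfin : ∀ {u : E → ℝ}, Integrable u m → ∫⁻ x, ENNReal.ofReal (u x) ∂m ≠ ⊤ := fun hu =>
    hu.lintegral_lt_top.ne
  have hm1 : AEMeasurable (fun x => ENNReal.ofReal (g x)) m := hg.aemeasurable.ennreal_ofReal
  have hm2 : AEMeasurable (fun x => ENNReal.ofReal (-g x)) m :=
    hg.neg.aemeasurable.ennreal_ofReal
  have : IsFiniteMeasure (m.withDensity fun x => ENNReal.ofReal (g x)) :=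
    isFiniteMeasure_withDensity (hfin hg)
  have : IsFiniteMeasure (m.withDensity fun x => ENNReal.ofReal (-g x)) :=
    isFiniteMeasure_withDensity (hfin hg.neg)
  -- The positive and negative parts of `g` are densities of finite measures, and a point-separating
  -- star subalgebra of bounded continuous functions determines a finite Borel measure on a Polish
  -- space.
  have key : (m.withDensity fun x => ENNReal.ofReal (g x)) =
      m.withDensity fun x => ENNReal.ofReal (-g x) := by
    refine ext_of_forall_mem_subalgebra_integral_eq_of_polish hA fun φ hφ => ?_
    rw [integral_withDensity_eq_integral_toReal_smul₀ hm1 (by simp),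
      integral_withDensity_eq_integral_toReal_smul₀ hm2 (by simp), ← sub_eq_zero,
      ← integral_sub]
    · rw [← h φ hφ]
      refine integral_congr_ae (Eventually.of_forall fun x => ?_)
      simp only [ENNReal.toReal_ofReal', Complex.real_smul]
      rw [← sub_mul, ← Complex.ofReal_sub, mul_comm]
      congr 2
      rcases le_total 0 (g x) with h0 | h0
      · rw [max_eq_left h0, max_eq_right (by linarith), sub_zero]
      · rw [max_eq_right h0, max_eq_left (by linarith)]; ring
    · simp only [ENNReal.toReal_ofReal']
      refine (hg.pos_part.ofReal.mul_bdd (c := ‖φ‖) φ.continuous.aestronglyMeasurable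
        (Eventually.of_forall φ.norm_coe_le_norm)).congr (Eventually.of_forall fun x => ?_)
      simp
    · simp only [ENNReal.toReal_ofReal']
      refine (hg.neg.pos_part.ofReal.mul_bdd (c := ‖φ‖) φ.continuous.aestronglyMeasurable
        (Eventually.of_forall φ.norm_coe_le_norm)).congr (Eventually.of_forall fun x => ?_)
      simp
  filter_upwards [(withDensity_eq_iff hm1 hm2 (hfin hg)).1 key] with x hx
  have := congrArg ENNReal.toReal hx
  simp only [ENNReal.toReal_ofReal'] at this
  rcases le_total 0 (g x) with h0 | h0
  · rw [max_eq_left h0, max_eq_right (by linarith)] at this; simpa using this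
  · rw [max_eq_right h0, max_eq_left (by linarith)] at this
    have : g x = 0 := by linarith
    simpa using this

/-- A family of bounded continuous functions that contains `1`, is closed under products and
conjugation and separates points. -/
structure IsSeparatingFamily {E ι : Type*} [TopologicalSpace E] (e : ι → E → ℂ) : Prop where
  continuous : ∀ i, Continuous (e i)
  norm_le : ∀ i x, ‖e i x‖ ≤ 1
  one : ∃ i, ∀ x, e i x = 1
  mul : ∀ i j, ∃ k, ∀ x, e k x = e i x * e j x
  star : ∀ i, ∃ k, ∀ x, e k x = starRingEnd ℂ (e i x)
  separates : ∀ x y, x ≠ y → ∃ i, e i x ≠ e i y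

open BoundedContinuousFunction in
theorem IsSeparatingFamily.ae_eq_zero_real {E ι : Type*} [TopologicalSpace E] [PolishSpace E]
    [MeasurableSpace E] [BorelSpace E] {m : Measure E} {e : ι → E → ℂ}
    (he : IsSeparatingFamily e) {g : E → ℝ} (hg : Integrable g m)
    (h : ∀ i, ∫ x, e i x * g x ∂m = 0) : g =ᵐ[m] 0 := by
  let M : Submonoid (E →ᵇ ℂ) :=
    { carrier := {φ | ∃ i, ∀ x, φ x = e i x}
      one_mem' := by
        obtain ⟨i, hi⟩ := he.one
        exact ⟨i, fun x => by simp [hi]⟩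
      mul_mem' := by
        rintro φ ψ ⟨i, hi⟩ ⟨j, hj⟩
        obtain ⟨k, hk⟩ := he.mul i j
        exact ⟨k, fun x => by simp [hi, hj, hk]⟩ }
  have hint : ∀ φ : E →ᵇ ℂ, Integrable (fun x => φ x * (g x : ℂ)) m := fun φ =>
    hg.ofReal.bdd_mul (c := ‖φ‖) φ.continuous.aestronglyMeasurable
      (Eventually.of_forall φ.norm_coe_le_norm)
  let A : StarSubalgebra ℂ (E →ᵇ ℂ) :=
    { Algebra.adjoin ℂ (M : Set (E →ᵇ ℂ)) with
      star_mem' := by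
        intro φ hφ
        change Star.star φ ∈ Algebra.adjoin ℂ (M : Set (E →ᵇ ℂ))
        change φ ∈ Algebra.adjoin ℂ (M : Set (E →ᵇ ℂ)) at hφ
        induction hφ using Algebra.adjoin_induction with
        | mem φ hφ =>
          obtain ⟨i, hi⟩ := hφ
          obtain ⟨k, hk⟩ := he.star i
          exact Algebra.subset_adjoin ⟨k, fun x => by simp [hi, hk]⟩
        | algebraMap r =>
          rw [← algebraMap_star_comm]
          exact Subalgebra.algebraMap_mem _ _
        | add a b _ _ ha hb => rw [star_add]; exact add_mem ha hb
        | mul a b _ _ ha hb => rw [star_mul]; exact mul_mem hb ha }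
  refine ae_eq_zero_of_starSubalgebra hg A ?_ ?_
  · intro x y hxy
    obtain ⟨i, hi⟩ := he.separates x y hxy
    let φ : E →ᵇ ℂ := BoundedContinuousFunction.ofNormedAddCommGroup (e i) (he.continuous i) 1
      (he.norm_le i)
    have hφ : φ ∈ A := Algebra.subset_adjoin (show φ ∈ M from ⟨i, fun x => rfl⟩)
    exact ⟨φ, ⟨toContinuousMapStarₐ ℂ φ, ⟨φ, hφ, rfl⟩, rfl⟩, hi⟩
  · intro φ hφ
    change φ ∈ Algebra.adjoin ℂ (M : Set (E →ᵇ ℂ)) at hφ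
    -- The family is closed under products, so the algebra it generates is merely its linear span
    -- and vanishing of the integral needs checking only on the family.
    rw [← Subalgebra.mem_toSubmodule, Algebra.adjoin_eq_span, Submonoid.closure_eq] at hφ
    induction hφ using Submodule.span_induction with
    | mem φ hφ =>
      obtain ⟨i, hi⟩ := hφ
      simpa only [hi] using h i
    | zero => simp
    | add a b _ _ ha hb =>
      simp only [BoundedContinuousFunction.coe_add, Pi.add_apply, add_mul]
      rw [integral_add (hint a) (hint b), ha, hb, add_zero]
    | smul c a _ ha =>
      simp only [BoundedContinuousFunction.coe_smul, smul_mul_assoc]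
      rw [integral_smul, ha, smul_zero]

/-- Closure under conjugation makes the conjugate of `g` annihilated too, hence also the real and
imaginary parts. -/
theorem IsSeparatingFamily.ae_eq_zero {E ι : Type*} [TopologicalSpace E] [PolishSpace E]
    [MeasurableSpace E] [BorelSpace E] {m : Measure E} {e : ι → E → ℂ}
    (he : IsSeparatingFamily e) {g : E → ℂ} (hg : Integrable g m)
    (h : ∀ i, ∫ x, e i x * g x ∂m = 0) : g =ᵐ[m] 0 := by
  have hi : ∀ i, Integrable (fun x => e i x * g x) m := fun i =>
    hg.bdd_mul (c := 1) (he.continuous i).aestronglyMeasurable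
      (Eventually.of_forall (he.norm_le i))
  have hc : ∀ i, ∫ x, e i x * starRingEnd ℂ (g x) ∂m = 0 := fun i => by
    obtain ⟨k, hk⟩ := he.star i
    have := congrArg (starRingEnd ℂ) (h k)
    rw [← integral_conj] at this
    simpa [hk] using this
  have hic : ∀ i, Integrable (fun x => e i x * starRingEnd ℂ (g x)) m := fun i => by
    refine Integrable.bdd_mul (c := 1) ?_ (he.continuous i).aestronglyMeasurable
      (Eventually.of_forall (he.norm_le i))
    exact Complex.conjCLE.toContinuousLinearMap.integrable_comp hg
  have h1 := he.ae_eq_zero_real hg.re fun i => by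
    have : ∀ x, e i x * ((RCLike.re (g x) : ℝ) : ℂ)
        = (1 / 2 : ℂ) * (e i x * g x + e i x * starRingEnd ℂ (g x)) := fun x => by
      rw [← mul_add, Complex.add_conj]; simp; ring
    simp only [this]
    rw [integral_const_mul, integral_add (hi i) (hic i), h, hc]; simp
  have h2 := he.ae_eq_zero_real hg.im fun i => by
    have : ∀ x, e i x * ((RCLike.im (g x) : ℝ) : ℂ)
        = (1 / (2 * Complex.I) : ℂ) * (e i x * g x - e i x * starRingEnd ℂ (g x)) := fun x => by
      rw [← mul_sub, Complex.sub_conj]; simp; field_simp; simp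
    simp only [this]
    rw [integral_const_mul, integral_sub (hi i) (hic i), h, hc]; simp
  filter_upwards [h1, h2] with x hx1 hx2
  exact Complex.ext hx1 hx2

theorem isSeparatingFamily_fourier :
    IsSeparatingFamily fun (μ : ℝ) (x : ℝ) => Complex.exp (Complex.I * (μ * x : ℝ)) where
  continuous μ := by fun_prop
  norm_le μ x := by rw [mul_comm, Complex.norm_exp_ofReal_mul_I]
  one := ⟨0, fun x => by simp⟩
  mul a b := ⟨a + b, fun x => by rw [← Complex.exp_add]; push_cast; ring_nf⟩
  star a := ⟨-a, fun x => by rw [← Complex.exp_conj]; simp⟩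
  separates x y hxy := by
    -- At this frequency the two values differ by the factor `e^{iπ} = -1`.
    refine ⟨Real.pi / (x - y), fun h => ?_⟩
    have hxy' : (x - y : ℂ) ≠ 0 := by exact_mod_cast sub_ne_zero.2 hxy
    have : Complex.exp (Complex.I * ((Real.pi / (x - y) * x : ℝ) : ℂ)) =
        Complex.exp (Complex.I * ((Real.pi / (x - y) * y : ℝ) : ℂ)) * Complex.exp (Real.pi * Complex.I) := by
      rw [← Complex.exp_add]
      congr 1
      push_cast
      field_simp
      ring
    rw [this, Complex.exp_pi_mul_I] at h
    have h0 := Complex.exp_ne_zero (Complex.I * ((Real.pi / (x - y) * y : ℝ) : ℂ))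
    apply h0
    linear_combination (-1 / 2 : ℂ) * h

/-- The exponentials `e^{-n x}` on the half line, extended by characters to the negative axis. -/
noncomputable def halfLineExp (i : ℕ × ℝ) (x : ℝ) : ℂ :=
  Complex.exp (-(i.1 * max x 0 : ℝ)) * Complex.exp (Complex.I * (i.2 * min x 0 : ℝ))

theorem halfLineExp_of_pos {i : ℕ × ℝ} {x : ℝ} (hx : 0 < x) :
    halfLineExp i x = Complex.exp (-(i.1 * x : ℝ)) := by
  simp [halfLineExp, max_eq_left hx.le, min_eq_right hx.le]

/-- Working on all of `ℝ` keeps the space Polish. The characters in `min x 0` serve only to separate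
points of the negative axis, which is null for the measures considered later. -/
theorem isSeparatingFamily_halfLineExp : IsSeparatingFamily halfLineExp where
  continuous i := by unfold halfLineExp; fun_prop
  norm_le i x := by
    rw [halfLineExp, norm_mul, mul_comm Complex.I, Complex.norm_exp_ofReal_mul_I, mul_one,
      ← Complex.ofReal_neg, Complex.norm_exp_ofReal, Real.exp_le_one_iff]
    have : 0 ≤ (i.1 : ℝ) * max x 0 := by positivity
    linarith
  one := ⟨(0, 0), fun x => by simp [halfLineExp]⟩
  mul a b := ⟨(a.1 + b.1, a.2 + b.2), fun x => by
    simp only [halfLineExp, ← Complex.exp_add]; push_cast; ring_nf⟩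
  star a := ⟨(a.1, -a.2), fun x => by
    simp only [halfLineExp, map_mul, ← Complex.exp_conj]; simp⟩
  separates x y hxy := by
    by_cases hmax : max x 0 = max y 0
    · have hmin : min x 0 ≠ min y 0 := fun h => hxy (by
        have h1 := max_add_min x 0
        have h2 := max_add_min y 0
        rw [hmax, h] at h1; linarith)
      obtain ⟨μ, hμ⟩ := isSeparatingFamily_fourier.separates _ _ hmin
      exact ⟨(0, μ), by simpa [halfLineExp] using hμ⟩
    · refine ⟨(1, 0), fun h => hmax ?_⟩
      simp only [halfLineExp] at h
      simp only [zero_mul, Complex.ofReal_zero, mul_zero, Complex.exp_zero, mul_one,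
        ← Complex.ofReal_neg, ← Complex.ofReal_exp, Complex.ofReal_inj, Real.exp_eq_exp] at h
      simpa using h

theorem IsSeparatingFamily.prod {E F ι κ : Type*} [TopologicalSpace E] [TopologicalSpace F]
    {e : ι → E → ℂ} {f : κ → F → ℂ} (he : IsSeparatingFamily e) (hf : IsSeparatingFamily f) :
    IsSeparatingFamily fun (i : ι × κ) (x : E × F) => e i.1 x.1 * f i.2 x.2 where
  continuous i := ((he.continuous _).comp continuous_fst).mul
    ((hf.continuous _).comp continuous_snd)
  norm_le i x := by
    rw [norm_mul]; exact mul_le_one₀ (he.norm_le _ _) (norm_nonneg _) (hf.norm_le _ _)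
  one := by
    obtain ⟨i, hi⟩ := he.one
    obtain ⟨j, hj⟩ := hf.one
    exact ⟨(i, j), fun x => by simp [hi, hj]⟩
  mul a b := by
    obtain ⟨i, hi⟩ := he.mul a.1 b.1
    obtain ⟨j, hj⟩ := hf.mul a.2 b.2
    exact ⟨(i, j), fun x => by simp only [hi, hj]; ring⟩
  star a := by
    obtain ⟨i, hi⟩ := he.star a.1
    obtain ⟨j, hj⟩ := hf.star a.2
    exact ⟨(i, j), fun x => by simp [hi, hj]⟩
  separates x y hxy := by
    obtain ⟨i₀, hi₀⟩ := he.one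
    obtain ⟨j₀, hj₀⟩ := hf.one
    by_cases h : x.1 = y.1
    · have h2 : x.2 ≠ y.2 := fun h2 => hxy (Prod.ext h h2)
      obtain ⟨j, hj⟩ := hf.separates _ _ h2
      exact ⟨(i₀, j), by simpa [hi₀] using hj⟩
    · obtain ⟨i, hi⟩ := he.separates _ _ h
      exact ⟨(i, j₀), by simpa [hj₀] using hi⟩

/-- Injectivity of the Fourier transform on `L¹(ℝ)`. -/
theorem ae_eq_zero_of_fourier {g : ℝ → ℂ} (hg : Integrable g)
    (h : ∀ μ : ℝ, ∫ x, Complex.exp (Complex.I * (μ * x : ℝ)) * g x = 0) : g =ᵐ[volume] 0 :=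
  isSeparatingFamily_fourier.ae_eq_zero hg h

/-- Injectivity of the Laplace transform on the half line. -/
theorem ae_eq_zero_of_laplace {g : ℝ → ℂ} {σ : ℝ}
    (hg : IntegrableOn (fun x => Complex.exp (-(σ * x : ℝ)) * g x) (Ioi 0))
    (h : ∀ p : ℝ, σ ≤ p → ∫ x in Ioi (0 : ℝ), Complex.exp (-(p * x : ℝ)) * g x = 0) :
    ∀ᵐ x ∂(volume.restrict (Ioi (0 : ℝ))), g x = 0 := by
  -- With `e^{-σx}` absorbed into the integrable function, only the exponents `p = σ + n`, `n ∈ ℕ`,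
  -- are needed.
  have := isSeparatingFamily_halfLineExp.ae_eq_zero hg fun i => by
    rw [← h (σ + i.1) (by linarith [Nat.cast_nonneg (α := ℝ) i.1])]
    refine setIntegral_congr_fun measurableSet_Ioi fun x hx => ?_
    simp only [halfLineExp_of_pos (mem_Ioi.1 hx), ← mul_assoc, ← Complex.exp_add]
    push_cast
    ring_nf
  filter_upwards [this] with x hx
  simpa [Complex.exp_ne_zero] using hx

/-- Injectivity of the Laplace–Laplace–Fourier transform. -/
theorem ae_eq_zero_of_laplace_laplace_fourier {g : ℝ × ℝ × ℝ → ℝ}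
    (hg : IntegrableOn (fun q : ℝ × ℝ × ℝ => Real.exp (-q.1 - q.2.1) * g q)
      (Ioi 0 ×ˢ Ioi 0 ×ˢ univ))
    (h : ∀ lam ν μ : ℝ, 0 < lam → 0 < ν → ∫ q in (Ioi (0 : ℝ) ×ˢ Ioi (0 : ℝ) ×ˢ (univ : Set ℝ)),
        Complex.exp (-(lam * q.1 : ℝ) + Complex.I * (μ * q.2.2 : ℝ) - (ν * q.2.1 : ℝ)) *
          (g q : ℂ) = 0) :
    ∀ᵐ q ∂(volume.restrict (Ioi (0 : ℝ) ×ˢ Ioi (0 : ℝ) ×ˢ (univ : Set ℝ))), g q = 0 := by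
  have := (isSeparatingFamily_halfLineExp.prod
    (isSeparatingFamily_halfLineExp.prod isSeparatingFamily_fourier)).ae_eq_zero_real hg fun i => by
    rw [← h (1 + i.1.1) (1 + i.2.1.1) i.2.2 (by positivity) (by positivity)]
    refine setIntegral_congr_fun
      (measurableSet_Ioi.prod (measurableSet_Ioi.prod MeasurableSet.univ)) fun q hq => ?_
    simp only [halfLineExp_of_pos (mem_Ioi.1 hq.1), halfLineExp_of_pos (mem_Ioi.1 hq.2.1)]
    push_cast
    simp only [← mul_assoc, ← Complex.exp_add]
    ring_nf
  filter_upwards [this] with q hq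
  simpa [Real.exp_ne_zero] using hq

/-! ### The roots of `κ_N` -/

theorem kappa_eq_or (N : ℕ) : kappa N = 1 ∨ kappa N = -1 := neg_one_pow_eq_or ℂ _

theorem kappa_ne_zero (N : ℕ) : kappa N ≠ 0 := by
  rcases kappa_eq_or N with h | h <;> simp [h]

theorem norm_kappa (N : ℕ) : ‖kappa N‖ = 1 := by
  rcases kappa_eq_or N with h | h <;> simp [h]

theorem kappa_mul_self (N : ℕ) : kappa N * kappa N = 1 := by
  rcases kappa_eq_or N with h | h <;> simp [h]

theorem conj_kappa (N : ℕ) : starRingEnd ℂ (kappa N) = kappa N := by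
  rcases kappa_eq_or N with h | h <;> simp [h]

/-- `i^N = (-1)^{N/2}` and `κ = (-1)^{1+N/2}` multiply to `-1`. This is the sign that makes the
symbol `e^{-tμ^N}` decay. -/
theorem kappa_mul_I_mul_pow {N : ℕ} (hE : Even N) (z : ℂ) :
    kappa N * (Complex.I * z) ^ N = -z ^ N := by
  obtain ⟨M, rfl⟩ := hE
  have : (M + M) / 2 = M := by omega
  rw [kappa, this, mul_pow, ← two_mul, pow_mul Complex.I, Complex.I_sq, pow_add, pow_one,
    ← mul_assoc, mul_assoc (-1 : ℂ), ← mul_pow]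
  simp

theorem kappa_mul_neg_I_mul_pow {N : ℕ} (hE : Even N) (z : ℂ) :
    kappa N * (-(Complex.I * z)) ^ N = -z ^ N := by
  rw [hE.neg_pow, kappa_mul_I_mul_pow hE]

/-- A purely imaginary root `ia` would give `1 = -a^N`, impossible for even `N`; hence `J` and `K`
exhaust the roots. -/
theorem re_ne_zero_of_pow_eq_kappa {N : ℕ} (hE : Even N) {θ : ℂ} (h : θ ^ N = kappa N) :
    θ.re ≠ 0 := fun h0 => by
  have h1 : θ = Complex.I * (θ.im : ℂ) := by apply Complex.ext <;> simp [h0]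
  have h2 := kappa_mul_I_mul_pow hE (θ.im : ℂ)
  rw [← h1, h, kappa_mul_self] at h2
  have h3 : (1 : ℝ) = -θ.im ^ N := by exact_mod_cast h2
  have := hE.pow_nonneg θ.im
  linarith

theorem norm_eq_one_of_pow_eq_kappa {N : ℕ} (hN : N ≠ 0) {θ : ℂ} (h : θ ^ N = kappa N) :
    ‖θ‖ = 1 := by
  have := congrArg norm h
  rw [norm_pow, norm_kappa] at this
  exact (pow_eq_one_iff_of_nonneg (norm_nonneg _) hN).1 this

theorem mem_rootsJ {N : ℕ} (hN : 0 < N) {θ : ℂ} :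
    θ ∈ rootsJ N ↔ θ ^ N = kappa N ∧ 0 < θ.re := by
  rw [rootsJ, Finset.mem_filter, Polynomial.mem_nthRootsFinset hN]

theorem mem_rootsK {N : ℕ} (hN : 0 < N) {θ : ℂ} :
    θ ∈ rootsK N ↔ θ ^ N = kappa N ∧ θ.re < 0 := by
  rw [rootsK, Finset.mem_filter, Polynomial.mem_nthRootsFinset hN]

/-- Negation exchanges `J` and `K` because `N` is even. Everything indexed by `K` can therefore be
rewritten over `J`. -/
theorem neg_mem_rootsJ {N : ℕ} (hN : 0 < N) (hE : Even N) {θ : ℂ} :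
    -θ ∈ rootsJ N ↔ θ ∈ rootsK N := by
  rw [mem_rootsJ hN, mem_rootsK hN, hE.neg_pow, Complex.neg_re, neg_pos]

theorem rootsK_eq_map {N : ℕ} (hN : 0 < N) (hE : Even N) :
    rootsK N = (rootsJ N).map (Equiv.neg ℂ).toEmbedding := by
  ext θ
  simp only [Finset.mem_map_equiv, Equiv.neg_symm, Equiv.neg_apply, neg_mem_rootsJ hN hE]

theorem card_rootsK {N : ℕ} (hN : 0 < N) (hE : Even N) : (rootsK N).card = (rootsJ N).card := by
  rw [rootsK_eq_map hN hE, Finset.card_map]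

theorem prod_rootsK {N : ℕ} (hN : 0 < N) (hE : Even N) (g : ℂ → ℂ) :
    ∏ θ ∈ rootsK N, g θ = ∏ c ∈ rootsJ N, g (-c) := by
  rw [rootsK_eq_map hN hE, Finset.prod_map]; rfl

theorem sum_rootsK {N : ℕ} (hN : 0 < N) (hE : Even N) (g : ℂ → ℂ) :
    ∑ θ ∈ rootsK N, g θ = ∑ c ∈ rootsJ N, g (-c) := by
  rw [rootsK_eq_map hN hE, Finset.sum_map]; rfl

theorem vandermondeCoeff_rootsK {N : ℕ} (hN : 0 < N) (hE : Even N) (c : ℂ) :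
    vandermondeCoeff (rootsK N) (-c) = vandermondeCoeff (rootsJ N) c := by
  have : (rootsK N).erase (-c) = ((rootsJ N).erase c).map (Equiv.neg ℂ).toEmbedding := by
    rw [rootsK_eq_map hN hE, Finset.map_erase]; rfl
  rw [vandermondeCoeff, this, Finset.prod_map, vandermondeCoeff]
  refine Finset.prod_congr rfl fun i _ => ?_
  change -i / (-i - -c) = _
  rw [← neg_div_neg_eq]
  congr 1 <;> ring

theorem ne_zero_of_mem_rootsJ {N : ℕ} (hN : 0 < N) {c : ℂ} (hc : c ∈ rootsJ N) : c ≠ 0 := by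
  rintro rfl
  simpa using ((mem_rootsJ hN).1 hc).2

theorem norm_of_mem_rootsJ {N : ℕ} (hN : 0 < N) {c : ℂ} (hc : c ∈ rootsJ N) : ‖c‖ = 1 :=
  norm_eq_one_of_pow_eq_kappa hN.ne' ((mem_rootsJ hN).1 hc).1

theorem inv_eq_conj_of_mem_rootsJ {N : ℕ} (hN : 0 < N) {c : ℂ} (hc : c ∈ rootsJ N) :
    c⁻¹ = starRingEnd ℂ c := by
  rw [Complex.inv_def, Complex.normSq_eq_norm_sq, norm_of_mem_rootsJ hN hc]; simp

theorem conj_mem_rootsJ {N : ℕ} (hN : 0 < N) {c : ℂ} (hc : c ∈ rootsJ N) :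
    starRingEnd ℂ c ∈ rootsJ N := by
  rw [mem_rootsJ hN] at hc ⊢
  rw [← map_pow, hc.1, conj_kappa]
  exact ⟨rfl, by simpa using hc.2⟩

theorem prod_rootsJ_conj {M : Type*} [CommMonoid M] {N : ℕ} (hN : 0 < N) (g : ℂ → M) :
    ∏ c ∈ rootsJ N, g (starRingEnd ℂ c) = ∏ c ∈ rootsJ N, g c :=
  Finset.prod_bij' (fun c _ => starRingEnd ℂ c) (fun c _ => starRingEnd ℂ c)
    (fun _ h => conj_mem_rootsJ hN h) (fun _ h => conj_mem_rootsJ hN h)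
    (by simp) (by simp) (by simp)

/-- On roots of modulus one inversion is conjugation, which permutes `J` since `κ` is real. -/
theorem prod_rootsJ_inv {M : Type*} [CommMonoid M] {N : ℕ} (hN : 0 < N) (g : ℂ → M) :
    ∏ c ∈ rootsJ N, g c⁻¹ = ∏ c ∈ rootsJ N, g c := by
  rw [← prod_rootsJ_conj hN g]
  exact Finset.prod_congr rfl fun c hc => by rw [inv_eq_conj_of_mem_rootsJ hN hc]

theorem disjoint_rootsJ_rootsK (N : ℕ) : Disjoint (rootsJ N) (rootsK N) :=
  Finset.disjoint_filter.2 fun _ _ h h' => lt_asymm h h'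

theorem rootsJ_union_rootsK {N : ℕ} (hN : 0 < N) (hE : Even N) :
    rootsJ N ∪ rootsK N = Polynomial.nthRootsFinset N (kappa N) := by
  ext θ
  rw [Finset.mem_union, mem_rootsJ hN, mem_rootsK hN, Polynomial.mem_nthRootsFinset hN, ← and_or_left]
  refine ⟨fun h => h.1, fun h => ⟨h, ?_⟩⟩
  rcases lt_or_gt_of_ne (re_ne_zero_of_pow_eq_kappa hE h) with h | h
  · exact Or.inr h
  · exact Or.inl h

open Polynomial in
theorem prod_X_sub_C_roots {N : ℕ} (hN : 0 < N) (hE : Even N) :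
    (∏ θ ∈ rootsJ N, (X - C θ)) * ∏ θ ∈ rootsK N, (X - C θ) = X ^ N - C (kappa N) := by
  rw [← Finset.prod_union (disjoint_rootsJ_rootsK N), rootsJ_union_rootsK hN hE,
    (IsAlgClosed.splits (X ^ N - C (kappa N))).eq_prod_roots_of_monic
      (monic_X_pow_sub_C _ hN.ne'), nthRootsFinset_def, Finset.prod_eq_multiset_prod,
    Multiset.toFinset_val]
  have : (nthRoots N (kappa N)).Nodup :=
    nodup_roots (separable_X_pow_sub_C _ (by exact_mod_cast hN.ne') (kappa_ne_zero N))
  rw [this.dedup]; rfl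

theorem card_rootsJ {N : ℕ} (hN : 0 < N) (hE : Even N) : (rootsJ N).card = N / 2 := by
  have h := congrArg Polynomial.natDegree (prod_X_sub_C_roots hN hE)
  rw [Polynomial.natDegree_X_pow_sub_C, Polynomial.Monic.natDegree_mul
    (Polynomial.monic_prod_X_sub_C _ _) (Polynomial.monic_prod_X_sub_C _ _),
    Polynomial.natDegree_finsetProd_X_sub_C_eq_card,
    Polynomial.natDegree_finsetProd_X_sub_C_eq_card, card_rootsK hN hE] at h
  omega

theorem prod_sub_mul_roots {N : ℕ} (hN : 0 < N) (hE : Even N) (y q : ℂ) :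
    (∏ θ ∈ rootsJ N, (y - q * θ)) * ∏ θ ∈ rootsK N, (y - q * θ) = y ^ N - kappa N * q ^ N := by
  have hcard : (rootsJ N).card + (rootsK N).card = N := by
    have := card_rootsJ hN hE
    have := card_rootsK hN hE
    obtain ⟨M, rfl⟩ := hE
    omega
  by_cases hq : q = 0
  · simp [hq, ← pow_add, hcard, hN.ne']
  · have h := congrArg (Polynomial.eval (y / q)) (prod_X_sub_C_roots hN hE)
    simp only [Polynomial.eval_mul, Polynomial.eval_prod, Polynomial.eval_sub, Polynomial.eval_X,
      Polynomial.eval_C, Polynomial.eval_pow] at h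
    have h1 : ∀ S : Finset ℂ, ∏ θ ∈ S, (y - q * θ) = q ^ S.card * ∏ θ ∈ S, (y / q - θ) := by
      intro S
      rw [← Finset.prod_const, ← Finset.prod_mul_distrib]
      exact Finset.prod_congr rfl fun θ _ => by field_simp
    rw [h1, h1, mul_mul_mul_comm, h, ← pow_add, hcard, div_pow]
    field_simp

/-- Logarithmic derivative in `y` of the factorization of `y^N - κ q^N`. -/
theorem sum_inv_sub_mul_roots {N : ℕ} (hN : 0 < N) (hE : Even N) {y q : ℂ}
    (hJ : ∀ θ ∈ rootsJ N, y - q * θ ≠ 0) (hK : ∀ θ ∈ rootsK N, y - q * θ ≠ 0) :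
    ∑ θ ∈ rootsJ N, (y - q * θ)⁻¹ + ∑ θ ∈ rootsK N, (y - q * θ)⁻¹ =
      N * y ^ (N - 1) / (y ^ N - kappa N * q ^ N) := by
  have h1 : ∀ S : Finset ℂ, (∀ θ ∈ S, y - q * θ ≠ 0) →
      logDeriv (fun y => ∏ θ ∈ S, (y - q * θ)) y = ∑ θ ∈ S, (y - q * θ)⁻¹ := fun S hS => by
    rw [logDeriv_prod (f := fun θ y => y - q * θ) hS (fun i _ => by fun_prop)]
    simp [logDeriv_apply]
  rw [← h1 _ hJ, ← h1 _ hK, ← logDeriv_mul (f := fun y => ∏ θ ∈ rootsJ N, (y - q * θ))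
    (g := fun y => ∏ θ ∈ rootsK N, (y - q * θ)) y (Finset.prod_ne_zero_iff.2 hJ)
    (Finset.prod_ne_zero_iff.2 hK) (by fun_prop) (by fun_prop)]
  simp only [prod_sub_mul_roots hN hE, logDeriv_apply]
  simp

/-- The roots in `J` stay `π/N` away from the imaginary axis. -/
theorem re_mul_exp_nonneg {N : ℕ} (hN : 0 < N) (hE : Even N) {c : ℂ} (hc : c ∈ rootsJ N) {φ : ℝ}
    (hφ : |φ| ≤ Real.pi / N) : 0 ≤ (c * Complex.exp (φ * Complex.I)).re := by
  rw [mem_rootsJ hN] at hc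
  obtain ⟨hcN, hre⟩ := hc
  have hnorm := norm_eq_one_of_pow_eq_kappa hN.ne' hcN
  set ψ := Complex.arg c with hψ
  have hcψ : c = Complex.exp (ψ * Complex.I) := by
    have := Complex.norm_mul_exp_arg_mul_I c
    rw [hnorm] at this
    simpa using this.symm
  have harg : |ψ| < Real.pi / 2 := Complex.abs_arg_lt_pi_div_two_iff.2 (Or.inl hre)
  obtain ⟨M, rfl⟩ := hE
  have hM : 0 < M := by omega
  have hMR : (0 : ℝ) < M := by exact_mod_cast hM
  have hpi := Real.pi_pos
  have hk : kappa (M + M) = Complex.exp ((1 + M : ℕ) * (Real.pi * Complex.I)) := by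
    rw [Complex.exp_nat_mul, Complex.exp_pi_mul_I, kappa]
    congr 2; omega
  rw [hcψ, ← Complex.exp_nat_mul, hk, Complex.exp_eq_exp_iff_exists_int] at hcN
  obtain ⟨n, hn⟩ := hcN
  have hn' : 2 * M * ψ = Real.pi * (1 + M + 2 * n) := by
    have h2 : ((2 * M * ψ : ℝ) : ℂ) = ((Real.pi * (1 + M + 2 * n) : ℝ) : ℂ) := by
      apply mul_right_cancel₀ Complex.I_ne_zero
      push_cast at hn ⊢
      linear_combination hn
    exact_mod_cast h2
  rw [abs_lt] at harg
  -- `2Mψ/π` is an integer, and `|ψ| < π/2` puts it strictly between `-M` and `M`; integrality turns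
  -- this into a gap of one unit, that is, an angle of `π/(2M) = π/N`.
  have hbound : |2 * M * ψ| ≤ Real.pi * (M - 1) := by
    have hu : (1 + M + 2 * n : ℝ) < M := by
      by_contra hcon
      push Not at hcon
      have : Real.pi * M ≤ 2 * M * ψ := by rw [hn']; gcongr
      nlinarith
    have hl : -(M : ℝ) < 1 + M + 2 * n := by
      by_contra hcon
      push Not at hcon
      have : 2 * M * ψ ≤ Real.pi * (-M) := by rw [hn']; gcongr
      nlinarith
    have hu' : 1 + (M : ℤ) + 2 * n < M := by exact_mod_cast hu
    have hl' : -(M : ℤ) < 1 + M + 2 * n := by exact_mod_cast hl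
    have hu2 : 1 + (M : ℤ) + 2 * n ≤ M - 1 := by omega
    have hl2 : -((M : ℤ) - 1) ≤ 1 + M + 2 * n := by omega
    have hu3 : (1 + M + 2 * n : ℝ) ≤ M - 1 := by exact_mod_cast hu2
    have hl3 : -((M : ℝ) - 1) ≤ 1 + M + 2 * n := by exact_mod_cast hl2
    rw [hn', abs_mul, abs_of_pos hpi]
    gcongr
    exact abs_le.2 ⟨hl3, hu3⟩
  rw [hcψ, ← Complex.exp_add, ← add_mul, ← Complex.ofReal_add, Complex.exp_ofReal_mul_I_re]
  have hsum : |2 * M * (ψ + φ)| ≤ Real.pi * M := by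
    rw [mul_add]
    refine (abs_add_le _ _).trans ?_
    have : |2 * M * φ| ≤ Real.pi := by
      rw [abs_mul, abs_of_pos (by positivity)]
      calc 2 * M * |φ| ≤ 2 * M * (Real.pi / (M + M : ℕ)) := by gcongr
        _ = Real.pi := by push_cast; field_simp; ring
    linarith
  rw [abs_mul, abs_of_pos (by positivity)] at hsum
  have : |ψ + φ| ≤ Real.pi / 2 := by nlinarith
  rw [abs_le] at this
  exact Real.cos_nonneg_of_neg_pi_div_two_le_of_le (by linarith) this.2

/-! ### Partial fractions -/

-- Lagrange interpolation of the constant `1` at the nodes `S`: normalizing the basis polynomial of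
-- `c` by its value at `0` brings out the coefficient `vandermondeCoeff S c`.
open Polynomial in
theorem sum_vandermondeCoeff_mul_prod {S : Finset ℂ} (hS : S.Nonempty) (h0 : (0 : ℂ) ∉ S) :
    ∑ c ∈ S, C (vandermondeCoeff S c) * ∏ i ∈ S.erase c, (1 - C i⁻¹ * X) = 1 := by
  refine Eq.trans ?_ (Lagrange.sum_basis (v := id) Function.injective_id.injOn hS)
  refine Finset.sum_congr rfl fun c _ => ?_
  rw [vandermondeCoeff, map_prod, ← Finset.prod_mul_distrib, Lagrange.basis]
  refine Finset.prod_congr rfl fun i hi => ?_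
  have hi0 : i ≠ 0 := fun h => h0 (h ▸ Finset.mem_of_mem_erase hi)
  rw [Lagrange.basisDivisor, mul_sub, mul_one, ← mul_assoc, ← C_mul, id, id,
    show i / (i - c) * i⁻¹ = -(c - i)⁻¹ by
      rw [div_mul_eq_mul_div, mul_inv_cancel₀ hi0, ← neg_sub, one_div, inv_neg],
    show i / (i - c) = -((c - i)⁻¹ * i) by
      rw [div_eq_mul_inv, ← neg_sub c i, inv_neg]; ring]
  simp only [map_neg, C_mul]
  ring

theorem sum_vandermondeCoeff_div {S : Finset ℂ} (hS : S.Nonempty) (h0 : (0 : ℂ) ∉ S) {z : ℂ}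
    (hz : ∀ c ∈ S, 1 - c⁻¹ * z ≠ 0) :
    ∑ c ∈ S, vandermondeCoeff S c / (1 - c⁻¹ * z) = ∏ c ∈ S, (1 - c⁻¹ * z)⁻¹ := by
  have h := congrArg (Polynomial.eval z) (sum_vandermondeCoeff_mul_prod hS h0)
  simp only [Polynomial.eval_finsetSum, Polynomial.eval_mul, Polynomial.eval_prod,
    Polynomial.eval_sub, Polynomial.eval_C, Polynomial.eval_X, Polynomial.eval_one] at h
  rw [Finset.prod_inv_distrib]
  refine Eq.trans ?_ ((congrArg (· * (∏ c ∈ S, (1 - c⁻¹ * z))⁻¹) h).trans (one_mul _))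
  rw [Finset.sum_mul]
  refine Finset.sum_congr rfl fun c hc => ?_
  rw [← Finset.mul_prod_erase S _ hc]
  have h1 := hz c hc
  have h2 : ∏ i ∈ S.erase c, (1 - i⁻¹ * z) ≠ 0 :=
    Finset.prod_ne_zero_iff.2 fun i hi => hz i (Finset.mem_of_mem_erase hi)
  rw [mul_inv, mul_mul_mul_comm, mul_inv_cancel₀ h2, mul_one, div_eq_mul_inv]

-- Geometric expansion of the partial fractions: the sums `∑ A_c c^{-m}` are the Taylor coefficients
-- of `1/∏ (1 - X/c)`. For `S = J` they are the `α_{-m}`.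
open PowerSeries in
theorem mk_sum_vandermondeCoeff_mul_prod {S : Finset ℂ} (hS : S.Nonempty) (h0 : (0 : ℂ) ∉ S) :
    (mk fun m => ∑ c ∈ S, vandermondeCoeff S c * c⁻¹ ^ m) * ∏ c ∈ S, (1 - C c⁻¹ * X) = 1 := by
  have h := congrArg (Polynomial.coeToPowerSeries.ringHom (R := ℂ))
    (sum_vandermondeCoeff_mul_prod hS h0)
  simp only [map_sum, map_mul, map_prod, map_sub, map_one,
    Polynomial.coeToPowerSeries.ringHom_apply, Polynomial.coe_C, Polynomial.coe_X] at h
  have h1 : (mk fun m => ∑ c ∈ S, vandermondeCoeff S c * c⁻¹ ^ m) =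
      ∑ c ∈ S, C (vandermondeCoeff S c) * mk fun m => c⁻¹ ^ m := by
    ext m; simp [coeff_mk]
  rw [h1, Finset.sum_mul]
  refine Eq.trans ?_ h
  refine Finset.sum_congr rfl fun c hc => ?_
  have h2 : (PowerSeries.mk fun m => c⁻¹ ^ m) * (1 - C c⁻¹ * X) = 1 := by
    ext m
    cases m with
    | zero => simp [mul_sub]
    | succ m =>
      rw [mul_sub, mul_one, mul_left_comm, map_sub, coeff_C_mul, coeff_succ_mul_X, coeff_mk,
        coeff_mk, coeff_one, if_neg m.succ_ne_zero, pow_succ']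
      ring
  rw [← Finset.mul_prod_erase S _ hc, mul_assoc, ← mul_assoc (PowerSeries.mk _), h2, one_mul]

open PowerSeries in
/-- `∏_{θ ∈ K} (1 - θ q) = ∑_{m ≤ #K} α_{-m} q^m`. -/
theorem prod_rootsK_eq_sum_alpha {N : ℕ} (hN : 0 < N) (hE : Even N) (q : ℂ) :
    ∏ θ ∈ rootsK N, (1 - θ * q) =
      ∑ m ∈ Finset.range ((rootsK N).card + 1), alpha N (-(m : ℤ)) * q ^ m := by
  have hcard := card_rootsJ hN hE
  have hcardK := card_rootsK hN hE
  have hne : (rootsJ N).Nonempty := by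
    rw [← Finset.card_pos, hcard]; obtain ⟨M, rfl⟩ := hE; omega
  have h0 : (0 : ℂ) ∉ rootsJ N := fun h => ne_zero_of_mem_rootsJ hN h rfl
  have h1 := mk_sum_vandermondeCoeff_mul_prod hne h0
  rw [prod_rootsJ_inv hN fun c => 1 - C c * X] at h1
  let P : Finset ℂ → Polynomial ℂ := fun S => ∏ c ∈ S, (1 - Polynomial.C c * Polynomial.X)
  have hP : P (rootsJ N) * P (rootsK N) = 1 - Polynomial.C (kappa N) * Polynomial.X ^ N := by
    refine Polynomial.funext fun x => ?_
    have := prod_sub_mul_roots hN hE 1 x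
    simp only [P, Polynomial.eval_mul, Polynomial.eval_prod, Polynomial.eval_sub,
      Polynomial.eval_one, Polynomial.eval_C, Polynomial.eval_X, Polynomial.eval_pow]
    simpa [mul_comm] using this
  have hcoe : ∀ S, ((P S : Polynomial ℂ) : PowerSeries ℂ) = ∏ c ∈ S, (1 - C c * X) := fun S => by
    rw [← Polynomial.coeToPowerSeries.ringHom_apply, map_prod]
    simp
  -- `∏_K (1 - θX) = (1 - κX^N) / ∏_J (1 - cX)`. Below degree `N` the factor `1 - κX^N` is
  -- invisible, and the left side has degree at most `#K < N`, so its coefficients are those of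
  -- `1/∏_J`, namely `α_{-m}`.
  have hK : ((P (rootsK N) : Polynomial ℂ) : PowerSeries ℂ) =
      (PowerSeries.mk fun m => ∑ c ∈ rootsJ N, vandermondeCoeff (rootsJ N) c * c⁻¹ ^ m) *
        (1 - C (kappa N) * X ^ N) := by
    have := congrArg (Polynomial.coeToPowerSeries.ringHom (R := ℂ)) hP
    simp only [map_mul, map_sub, map_one, map_pow,
      Polynomial.coeToPowerSeries.ringHom_apply, Polynomial.coe_C, Polynomial.coe_X] at this
    rw [← this, ← mul_assoc, hcoe (rootsJ N), h1, one_mul]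
  have hdeg : (P (rootsK N)).natDegree < (rootsK N).card + 1 := by
    refine Nat.lt_succ_of_le ((Polynomial.natDegree_prod_le _ _).trans ?_)
    rw [Finset.card_eq_sum_ones]
    refine Finset.sum_le_sum fun c _ => ?_
    compute_degree
  have heval : ∏ θ ∈ rootsK N, (1 - θ * q) = (P (rootsK N)).eval q := by
    simp [P, Polynomial.eval_prod]
  rw [heval, Polynomial.eval_eq_sum_range' hdeg]
  refine Finset.sum_congr rfl fun m hm => ?_
  have hm' : m < N := by
    have := Finset.mem_range.1 hm
    rw [hcardK, hcard] at this
    obtain ⟨M, rfl⟩ := hE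
    omega
  rw [← Polynomial.coeff_coe, hK, mul_sub, mul_one, ← mul_assoc, map_sub, coeff_mul_X_pow',
    if_neg (by omega), sub_zero, coeff_mk, alpha]
  simp

/-- Partial fraction decomposition of `∏_{θ ∈ J} (y + p θ)⁻¹` with respect to `y`. -/
theorem sum_vandermondeCoeff_mul_div {N : ℕ} (hN : 0 < N) (hE : Even N) {y p : ℂ} (hy : y ≠ 0)
    (h : ∀ c ∈ rootsJ N, y + p * c ≠ 0) :
    ∑ c ∈ rootsJ N, vandermondeCoeff (rootsJ N) c * c / (c * y + p) =
      y ^ ((rootsJ N).card - 1) * ∏ c ∈ rootsJ N, (y + p * c)⁻¹ := by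
  have hcard := card_rootsJ hN hE
  have hpos : 0 < (rootsJ N).card := by rw [hcard]; obtain ⟨M, rfl⟩ := hE; omega
  have h0 : (0 : ℂ) ∉ rootsJ N := fun h => ne_zero_of_mem_rootsJ hN h rfl
  have hinv : ∀ c ∈ rootsJ N, y + p * c⁻¹ ≠ 0 := fun c hc => by
    rw [inv_eq_conj_of_mem_rootsJ hN hc]; exact h _ (conj_mem_rootsJ hN hc)
  have hz : ∀ c ∈ rootsJ N, 1 - c⁻¹ * (-p / y) = (y + p * c⁻¹) / y := fun c _ => by
    field_simp; ring
  have key := sum_vandermondeCoeff_div (S := rootsJ N) (Finset.card_pos.1 hpos) h0 (z := -p / y)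
    fun c hc => by rw [hz c hc]; exact div_ne_zero (hinv c hc) hy
  rw [← prod_rootsJ_inv hN fun c => (y + p * c)⁻¹]
  rw [Finset.prod_congr rfl fun c hc => by rw [hz c hc, inv_div],
    Finset.sum_congr rfl fun c hc => by rw [hz c hc]] at key
  simp only [div_eq_mul_inv y, Finset.prod_mul_distrib, Finset.prod_const] at key
  obtain ⟨k, hk⟩ := Nat.exists_eq_succ_of_ne_zero hpos.ne'
  rw [hk, pow_succ'] at key
  rw [hk, Nat.succ_sub_one]
  apply mul_left_cancel₀ hy
  rw [← mul_assoc, ← key, Finset.mul_sum]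
  refine Finset.sum_congr rfl fun c hc => ?_
  have hc0 := ne_zero_of_mem_rootsJ hN hc
  have h1 := hinv c hc
  have h2 : c * y + p = c * (y + p * c⁻¹) := by field_simp
  rw [h2]
  field_simp

/-! ### The kernel `p(t;x)` -/

theorem integrable_pow_mul_exp_neg_pow {N : ℕ} (hN : 2 ≤ N) (hE : Even N) (k : ℕ) :
    Integrable fun x : ℝ => x ^ k * Real.exp (-x ^ N) := by
  have h1 : Integrable fun x : ℝ => x ^ k * Real.exp (-1 * x ^ 2) := by
    simpa using integrable_rpow_mul_exp_neg_mul_sq (b := 1) one_pos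
      (s := k) (by linarith [Nat.cast_nonneg (α := ℝ) k])
  refine (h1.norm.const_mul (Real.exp 1)).mono' (by fun_prop) (Eventually.of_forall fun x => ?_)
  rw [norm_mul, norm_mul, Real.norm_of_nonneg (Real.exp_pos _).le,
    Real.norm_of_nonneg (Real.exp_pos _).le, mul_left_comm, ← Real.exp_add]
  gcongr
  rcases le_total 1 |x| with h | h
  · have : |x| ^ 2 ≤ |x| ^ N := pow_le_pow_right₀ h hN
    rw [sq_abs, hE.pow_abs] at this
    linarith
  · have : |x| ^ 2 ≤ 1 := pow_le_one₀ (abs_nonneg _) h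
    rw [sq_abs] at this
    linarith [hE.pow_nonneg x]

/-- `e^{-μ^N}`. -/
noncomputable def expNegPow (N : ℕ) (μ : ℝ) : ℂ := (Real.exp (-μ ^ N) : ℂ)

theorem integrable_poly_mul_expNegPow {N : ℕ} (hN : 2 ≤ N) (hE : Even N) (k : ℕ) :
    Integrable fun x : ℝ => (x : ℂ) ^ k * expNegPow N x := by
  refine (integrable_pow_mul_exp_neg_pow hN hE k).ofReal.congr (Eventually.of_forall fun x => ?_)
  simp [expNegPow]

theorem hasDerivAt_expNegPow (N : ℕ) (x : ℝ) :
    HasDerivAt (expNegPow N) (-(N : ℂ) * x ^ (N - 1) * expNegPow N x) x := by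
  have h : HasDerivAt (fun x : ℝ => -x ^ N) (-(N * x ^ (N - 1))) x := (hasDerivAt_pow N x).neg
  refine h.exp.ofReal_comp.congr_deriv ?_
  rw [expNegPow]; push_cast; ring

-- Two integrable derivatives make the Fourier transform `O(1/(1+x²))`.
open FourierTransform in
theorem integrable_fourier_expNegPow {N : ℕ} (hN : 2 ≤ N) (hE : Even N) :
    Integrable (𝓕 (expNegPow N)) := by
  have hi := integrable_poly_mul_expNegPow hN hE
  have hd : deriv (expNegPow N) = fun x : ℝ => -(N : ℂ) * x ^ (N - 1) * expNegPow N x :=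
    funext fun x => (hasDerivAt_expNegPow N x).deriv
  have hd2 : deriv (deriv (expNegPow N)) = fun x : ℝ =>
      -(N : ℂ) * ((N - 1 : ℕ) * (x : ℂ) ^ (N - 1 - 1) * expNegPow N x) +
        N * N * (x ^ (N - 1 + (N - 1)) * expNegPow N x) := by
    rw [hd]
    funext x
    have h1 : HasDerivAt (fun x : ℝ => (x : ℂ) ^ (N - 1))
        ((N - 1 : ℕ) * (x : ℂ) ^ (N - 1 - 1)) x := by
      simpa using (hasDerivAt_pow (N - 1) x).ofReal_comp
    refine ((h1.const_mul (-(N : ℂ))).mul (hasDerivAt_expNegPow N x)).deriv.trans ?_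
    rw [pow_add]
    ring
  have hg0 : Integrable (expNegPow N) := by simpa using hi 0
  have hdiff : Differentiable ℝ (expNegPow N) := fun x => (hasDerivAt_expNegPow N x).differentiableAt
  have hg1 : Integrable (deriv (expNegPow N)) := by
    rw [hd]; simpa [mul_assoc] using (hi (N - 1)).const_mul (-(N : ℂ))
  have hg2 : Integrable (deriv (deriv (expNegPow N))) := by
    rw [hd2]
    exact Integrable.add (by simpa [mul_assoc] using
      ((hi (N - 1 - 1)).const_mul ((N - 1 : ℕ) : ℂ)).const_mul (-(N : ℂ))) ((hi _).const_mul _)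
  have hdiff1 : Differentiable ℝ (deriv (expNegPow N)) := by
    rw [hd]
    intro x
    have := (hasDerivAt_expNegPow N x).differentiableAt
    fun_prop
  have hF2 : ∀ x, 𝓕 (deriv (deriv (expNegPow N))) x =
      (2 * Real.pi * Complex.I * x) * ((2 * Real.pi * Complex.I * x) * 𝓕 (expNegPow N) x) := by
    intro x
    rw [Real.fourier_deriv hg1 hdiff1 hg2, Real.fourier_deriv hg0 hdiff hg1]
    simp
  have hb : ∀ (f : ℝ → ℂ) (x : ℝ), ‖𝓕 f x‖ ≤ ∫ v, ‖f v‖ := fun f x => by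
    rw [Real.fourier_eq]
    refine (norm_integral_le_integral_norm _).trans (le_of_eq ?_)
    simp [Circle.norm_smul]
  set A := ∫ v, ‖expNegPow N v‖
  set B := ∫ v, ‖deriv (deriv (expNegPow N)) v‖
  refine (integrable_inv_one_add_sq.const_mul (A + B)).mono' ?_ (Eventually.of_forall fun x => ?_)
  · have : Continuous (𝓕 (expNegPow N)) :=
      VectorFourier.fourierIntegral_continuous Real.continuous_fourierChar
        (by exact continuous_inner) hg0
    exact this.aestronglyMeasurable
  · rw [← div_eq_mul_inv, le_div_iff₀ (by positivity), mul_add, mul_one]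
    refine add_le_add (hb _ x) ?_
    refine le_trans ?_ (hb _ x)
    have h1 : (1 : ℝ) ≤ 2 * Real.pi := by linarith [Real.pi_gt_three]
    have h3 : ‖(2 * Real.pi * Complex.I * x : ℂ)‖ = 2 * Real.pi * ‖x‖ := by
      rw [norm_mul, norm_mul, norm_mul, Complex.norm_real, Complex.norm_real,
        Complex.norm_I, RCLike.norm_ofNat, Real.norm_of_nonneg Real.pi_pos.le, mul_one]
    rw [hF2, norm_mul (2 * Real.pi * Complex.I * x : ℂ), norm_mul (2 * Real.pi * Complex.I * x : ℂ), h3]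
    have h2 : ‖x‖ * (‖x‖ * 1) = x ^ 2 := by rw [mul_one, Real.norm_eq_abs, ← sq, sq_abs]
    calc ‖𝓕 (expNegPow N) x‖ * x ^ 2 = (1 * ‖x‖) * ((1 * ‖x‖) * ‖𝓕 (expNegPow N) x‖) := by
          rw [← h2]; ring
      _ ≤ _ := by gcongr

/-- Conjugating the integrand amounts to `μ ↦ -μ`, so the inversion integral is already real and the
real part in `kernel` loses nothing. -/
theorem ofReal_kernel {N : ℕ} (hE : Even N) (t x : ℝ) :
    (kernel N t x : ℂ) = (2 * Real.pi : ℂ)⁻¹ *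
      ∫ μ : ℝ, Complex.exp (-(Complex.I * μ * x)) * Complex.exp (-(t * μ ^ N)) := by
  have h1 : kernel N t x = ((2 * Real.pi : ℂ)⁻¹ *
      ∫ μ : ℝ, Complex.exp (-(Complex.I * μ * x)) * Complex.exp (-(t * μ ^ N))).re := by
    rw [kernel]
    congr 3
    funext μ
    rw [mul_right_comm (kappa N), kappa_mul_neg_I_mul_pow hE]
    congr 2
    ring_nf
  rw [h1, ← Complex.conj_eq_iff_re, map_mul, ← integral_conj]
  congr 1
  · rw [map_inv₀, map_mul, Complex.conj_ofReal, map_ofNat]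
  · rw [← integral_neg_eq_self]
    congr 1
    funext μ
    rw [map_mul, ← Complex.exp_conj, ← Complex.exp_conj]
    simp [hE.neg_pow]

theorem measurable_kernel (N : ℕ) : Measurable fun q : ℝ × ℝ => kernel N q.1 q.2 := by
  unfold kernel
  refine Complex.measurable_re.comp (Measurable.const_mul ?_ _)
  refine (StronglyMeasurable.integral_prod_right (f := fun (q : ℝ × ℝ) (μ : ℝ) =>
    Complex.exp (-(Complex.I * μ * q.2)) *
    Complex.exp (kappa N * q.1 * (-(Complex.I * μ)) ^ N)) (ν := volume) ?_).measurable
  exact Continuous.stronglyMeasurable (by fun_prop)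

theorem measurable_kernel_right (N : ℕ) (t : ℝ) : Measurable (kernel N t) :=
  Measurable.comp (g := fun q : ℝ × ℝ => kernel N q.1 q.2) (f := fun x => (t, x))
    (measurable_kernel N) (measurable_const.prodMk measurable_id)

theorem kernel_neg {N : ℕ} (hE : Even N) (t x : ℝ) : kernel N t (-x) = kernel N t x := by
  have : (kernel N t (-x) : ℂ) = kernel N t x := by
    rw [ofReal_kernel hE, ofReal_kernel hE]
    congr 1
    refine Eq.trans ?_ (integral_neg_eq_self (fun μ : ℝ => Complex.exp (-(Complex.I * μ * x)) *
      Complex.exp (-(t * μ ^ N))) volume)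
    congr 1
    funext μ
    simp only [Complex.ofReal_neg, hE.neg_pow, mul_neg, neg_mul]
  exact_mod_cast this

/-- Self-similarity, from rescaling `μ`. Writing the time as `c^{-N}` keeps fractional powers out of
the computation; `exists_scale` recovers general `t`. -/
theorem kernel_scaling {N : ℕ} (hE : Even N) {c : ℝ} (hc : 0 < c) (x : ℝ) :
    kernel N (c ^ N)⁻¹ x = c * kernel N 1 (x * c) := by
  have : (kernel N (c ^ N)⁻¹ x : ℂ) = c * kernel N 1 (x * c) := by
    rw [ofReal_kernel hE, ofReal_kernel hE, mul_left_comm]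
    congr 1
    have := Measure.integral_comp_mul_left (fun μ : ℝ => Complex.exp (-(Complex.I * μ * (x * c : ℝ))) *
      Complex.exp (-((1 : ℝ) * μ ^ N))) c⁻¹
    rw [inv_inv, abs_of_pos hc, Complex.real_smul] at this
    rw [← this]
    congr 1
    funext μ
    have hc' : (c : ℂ) ≠ 0 := by exact_mod_cast hc.ne'
    push_cast
    congr 2
    · field_simp
    · rw [mul_pow]; ring
  exact_mod_cast this

theorem kernel_one_eq_fourier {N : ℕ} (hE : Even N) (x : ℝ) : (kernel N 1 x : ℂ) =
    (2 * Real.pi : ℂ)⁻¹ * (FourierTransform.fourier (expNegPow N) : ℝ → ℂ) (x * (2 * Real.pi)⁻¹) := by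
  rw [ofReal_kernel hE, Real.fourier_real_eq_integral_exp_smul]
  congr 2
  funext μ
  rw [smul_eq_mul, expNegPow]
  push_cast
  congr 2
  · field_simp
  · ring

theorem integrable_kernel_one {N : ℕ} (hN : 2 ≤ N) (hE : Even N) : Integrable (kernel N 1) := by
  have h := ((integrable_fourier_expNegPow hN hE).comp_mul_right'
    (inv_ne_zero (by positivity : (2 * Real.pi) ≠ 0))).const_mul (2 * Real.pi : ℂ)⁻¹
  have := (h.congr (Eventually.of_forall fun x => (kernel_one_eq_fourier hE x).symm)).re
  simpa using this

theorem fourier_kernel_one {N : ℕ} (hN : 2 ≤ N) (hE : Even N) (μ : ℝ) :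
    ∫ x : ℝ, Complex.exp (Complex.I * (μ * x : ℝ)) * kernel N 1 x = Real.exp (-μ ^ N) := by
  have hc : Continuous (expNegPow N) := by unfold expNegPow; fun_prop
  have hg : Integrable (expNegPow N) := by simpa using integrable_poly_mul_expNegPow hN hE 0
  have h := congrFun (hc.fourierInv_fourier_eq hg (integrable_fourier_expNegPow hN hE)) μ
  rw [Real.fourierInv_eq'] at h
  rw [expNegPow] at h
  rw [← h]
  have := Measure.integral_comp_mul_right (fun v : ℝ => Complex.exp (Complex.I * (μ * (2 * Real.pi * v) : ℝ)) *
    (FourierTransform.fourier (expNegPow N) : ℝ → ℂ) v) (2 * Real.pi)⁻¹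
  have hpi : (2 * Real.pi : ℂ) ≠ 0 := by
    exact_mod_cast (by positivity : (2 * Real.pi) ≠ 0)
  rw [inv_inv, abs_of_pos (by positivity), Complex.real_smul] at this
  simp only [kernel_one_eq_fourier hE]
  calc _ = (2 * Real.pi : ℂ)⁻¹ * ∫ x : ℝ, Complex.exp (Complex.I * (μ * (2 * Real.pi * (x * (2 * Real.pi)⁻¹)) : ℝ)) *
    (FourierTransform.fourier (expNegPow N) : ℝ → ℂ) (x * (2 * Real.pi)⁻¹) := by
        rw [← integral_const_mul]
        congr 1
        funext x
        rw [show 2 * Real.pi * (x * (2 * Real.pi)⁻¹) = x by field_simp]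
        ring
    _ = _ := by
        rw [this]
        push_cast
        rw [← mul_assoc, inv_mul_cancel₀ hpi, one_mul]
        congr 1
        funext v
        simp only [smul_eq_mul, RCLike.inner_apply, conj_trivial]
        push_cast
        ring_nf

/-- The total variation of the kernel. -/
noncomputable def kernelNorm (N : ℕ) : ℝ := ∫ x, |kernel N 1 x|

theorem kernelNorm_nonneg (N : ℕ) : 0 ≤ kernelNorm N := integral_nonneg fun _ => abs_nonneg _

theorem exists_scale {N : ℕ} (hN : N ≠ 0) {t : ℝ} (ht : 0 < t) :
    ∃ c : ℝ, 0 < c ∧ t = (c ^ N)⁻¹ ∧ c⁻¹ = t ^ (1 / (N : ℝ)) := by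
  refine ⟨(t ^ (1 / (N : ℝ)))⁻¹, by positivity, ?_, inv_inv _⟩
  rw [inv_pow, inv_inv, ← Real.rpow_natCast, ← Real.rpow_mul ht.le, one_div,
    inv_mul_cancel₀ (by exact_mod_cast hN), Real.rpow_one]

theorem integrable_kernel {N : ℕ} (hN : 2 ≤ N) (hE : Even N) {t : ℝ} (ht : 0 < t) :
    Integrable (kernel N t) := by
  obtain ⟨c, hc, rfl, -⟩ := exists_scale (by omega : N ≠ 0) ht
  rw [funext (kernel_scaling hE hc)]
  exact ((integrable_kernel_one hN hE).comp_mul_right' hc.ne').const_mul c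

theorem integral_abs_kernel {N : ℕ} (hN : 2 ≤ N) (hE : Even N) {t : ℝ} (ht : 0 < t) :
    ∫ x, |kernel N t x| = kernelNorm N := by
  obtain ⟨c, hc, rfl, -⟩ := exists_scale (by omega : N ≠ 0) ht
  simp only [kernel_scaling hE hc, abs_mul, abs_of_pos hc]
  rw [integral_const_mul, Measure.integral_comp_mul_right (fun x => |kernel N 1 x|),
    abs_of_pos (by positivity), smul_eq_mul, ← mul_assoc, mul_inv_cancel₀ hc.ne', one_mul,
    kernelNorm]

/-- `∫_S e^{iμx} p(t;x) dx`. -/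
noncomputable def partialFourier (N : ℕ) (S : Set ℝ) (t μ : ℝ) : ℂ :=
  ∫ x, S.indicator (fun x => Complex.exp (Complex.I * (μ * x : ℝ)) * kernel N t x) x

theorem norm_exp_I_mul (x : ℝ) : ‖Complex.exp (Complex.I * x)‖ = 1 := by
  rw [mul_comm, Complex.norm_exp_ofReal_mul_I]

theorem integrable_exp_mul {g : ℝ → ℂ} (hg : Integrable g) (μ : ℝ) :
    Integrable fun x => Complex.exp (Complex.I * (μ * x : ℝ)) * g x :=
  hg.bdd_mul (c := 1) (by fun_prop) (Eventually.of_forall fun x => (norm_exp_I_mul _).le)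

/-- `hS` says that `S` is a cone, so self-similarity trades the time for a dilation of `μ`.
Continuity in `t` thus reduces to continuity in `μ` at time `1`. -/
theorem partialFourier_scaling {N : ℕ} (hN : 2 ≤ N) (hE : Even N) {S : Set ℝ}
    (hS : ∀ c x : ℝ, 0 < c → (x * c ∈ S ↔ x ∈ S)) {t : ℝ} (ht : 0 < t) (μ : ℝ) :
    partialFourier N S t μ = partialFourier N S 1 (μ * t ^ (1 / (N : ℝ))) := by
  obtain ⟨c, hc, rfl, hc'⟩ := exists_scale (by omega : N ≠ 0) ht
  rw [← hc', partialFourier, partialFourier]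
  have hcC : (c : ℂ) ≠ 0 := by exact_mod_cast hc.ne'
  have := Measure.integral_comp_mul_right (fun x => S.indicator (fun x =>
    Complex.exp (Complex.I * (μ * c⁻¹ * x : ℝ)) * kernel N 1 x) x) c
  rw [abs_of_pos (by positivity), Complex.real_smul] at this
  have h2 : ∀ I : ℂ, I = c * ((c⁻¹ : ℝ) * I) := fun I => by
    rw [Complex.ofReal_inv, ← mul_assoc, mul_inv_cancel₀ hcC, one_mul]
  refine Eq.trans ?_ (h2 _).symm
  rw [← this, ← integral_const_mul]
  congr 1
  funext x
  by_cases hx : x ∈ S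
  · rw [indicator_of_mem hx, indicator_of_mem ((hS c x hc).2 hx),
      kernel_scaling hE hc]
    push_cast
    rw [mul_left_comm]
    congr 3
    field_simp
  · rw [indicator_of_notMem hx, indicator_of_notMem (fun h => hx ((hS c x hc).1 h)), mul_zero]

theorem norm_partialFourier_le {N : ℕ} (hN : 2 ≤ N) (hE : Even N) (S : Set ℝ)
    {t : ℝ} (ht : 0 < t) (μ : ℝ) : ‖partialFourier N S t μ‖ ≤ kernelNorm N := by
  rw [← integral_abs_kernel hN hE ht]
  refine norm_integral_le_of_norm_le (integrable_kernel hN hE ht).abs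
    (Eventually.of_forall fun x => ?_)
  refine (norm_indicator_le_norm_self _ _).trans ?_
  rw [norm_mul, norm_exp_I_mul, one_mul, Complex.norm_real, Real.norm_eq_abs]

theorem continuous_partialFourier_one {N : ℕ} (hN : 2 ≤ N) (hE : Even N) {S : Set ℝ}
    (hS : MeasurableSet S) : Continuous (partialFourier N S 1) := by
  refine continuous_of_dominated (bound := fun x => |kernel N 1 x|) (fun μ => ?_) (fun μ => ?_)
    (integrable_kernel_one hN hE).abs (Eventually.of_forall fun x => ?_)
  · exact ((integrable_exp_mul (integrable_kernel_one hN hE).ofReal μ).indicator hS).1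
  · refine Eventually.of_forall fun x => (norm_indicator_le_norm_self _ _).trans ?_
    rw [norm_mul, norm_exp_I_mul, one_mul, Complex.norm_real, Real.norm_eq_abs]
  · by_cases hx : x ∈ S
    · simp only [indicator_of_mem hx]; fun_prop
    · simp only [indicator_of_notMem hx]; fun_prop

theorem continuousOn_partialFourier {N : ℕ} (hN : 2 ≤ N) (hE : Even N) {S : Set ℝ}
    (hSm : MeasurableSet S) (hS : ∀ c x : ℝ, 0 < c → (x * c ∈ S ↔ x ∈ S)) (μ : ℝ) :
    ContinuousOn (fun t => partialFourier N S t μ) (Ioi 0) := by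
  refine ContinuousOn.congr ?_ fun t ht => partialFourier_scaling hN hE hS ht μ
  refine (continuous_partialFourier_one hN hE hSm).comp_continuousOn ?_
  refine continuousOn_const.mul (continuousOn_id.rpow_const fun x hx => Or.inl (ne_of_gt hx))

theorem mul_mem_Ici_iff (c x : ℝ) (hc : 0 < c) : x * c ∈ Ici (0 : ℝ) ↔ x ∈ Ici (0 : ℝ) := by
  simp [mul_nonneg_iff_of_pos_right hc]

theorem mul_mem_Iio_iff (c x : ℝ) (hc : 0 < c) : x * c ∈ Iio (0 : ℝ) ↔ x ∈ Iio (0 : ℝ) := by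
  simp [mul_neg_iff, hc, hc.le]

theorem partialFourier_univ {N : ℕ} (hN : 2 ≤ N) (hE : Even N) {t : ℝ} (ht : 0 < t) (μ : ℝ) :
    partialFourier N univ t μ = Real.exp (-(t * μ ^ N)) := by
  rw [partialFourier_scaling hN hE (by simp) ht, partialFourier]
  simp only [indicator_univ]
  rw [fourier_kernel_one hN hE, mul_pow, ← Real.rpow_natCast (t ^ _), ← Real.rpow_mul ht.le,
    one_div, inv_mul_cancel₀ (by positivity), Real.rpow_one, mul_comm]

theorem partialFourier_Ici_add_Iio {N : ℕ} (hN : 2 ≤ N) (hE : Even N) {t : ℝ} (ht : 0 < t) (μ : ℝ) :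
    partialFourier N (Ici 0) t μ + partialFourier N (Iio 0) t μ = Real.exp (-(t * μ ^ N)) := by
  have hi := integrable_exp_mul (integrable_kernel hN hE ht).ofReal μ
  rw [← partialFourier_univ hN hE ht, partialFourier, partialFourier, partialFourier,
    ← integral_add]
  rotate_left
  · exact hi.indicator measurableSet_Ici
  · exact hi.indicator measurableSet_Iio
  congr 1
  funext x
  rw [indicator_univ, ← compl_Ici]
  exact indicator_self_add_compl_apply _ _ _

/-! ### Fourier transforms of integrable functions carried by a half line -/

/-- `F` is the Fourier transform of an integrable function vanishing outside `S`. -/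
def IsFourierOn (S : Set ℝ) (F : ℝ → ℂ) : Prop :=
  ∃ g : ℝ → ℂ, Integrable g ∧ (∀ x ∉ S, g x = 0) ∧
    ∀ μ : ℝ, F μ = ∫ x, Complex.exp (Complex.I * (μ * x : ℝ)) * g x

theorem IsFourierOn.zero (S : Set ℝ) : IsFourierOn S 0 :=
  ⟨0, integrable_zero _ _ _, fun _ _ => rfl, fun μ => by simp⟩

theorem IsFourierOn.add {S : Set ℝ} {F G : ℝ → ℂ} (hF : IsFourierOn S F) (hG : IsFourierOn S G) :
    IsFourierOn S (F + G) := by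
  obtain ⟨f, hf, hfS, hF⟩ := hF
  obtain ⟨g, hg, hgS, hG⟩ := hG
  refine ⟨f + g, hf.add hg, fun x hx => by simp [hfS x hx, hgS x hx], fun μ => ?_⟩
  simp only [Pi.add_apply, hF, hG, mul_add]
  rw [integral_add (integrable_exp_mul hf μ) (integrable_exp_mul hg μ)]

theorem IsFourierOn.const_mul {S : Set ℝ} {F : ℝ → ℂ} (c : ℂ) (hF : IsFourierOn S F) :
    IsFourierOn S (fun μ => c * F μ) := by
  obtain ⟨f, hf, hfS, hF⟩ := hF
  refine ⟨fun x => c * f x, hf.const_mul c, fun x hx => by simp [hfS x hx], fun μ => ?_⟩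
  simp only [hF, mul_left_comm _ c]
  rw [integral_const_mul]

theorem IsFourierOn.neg {S : Set ℝ} {F : ℝ → ℂ} (hF : IsFourierOn S F) :
    IsFourierOn S (-F) := by
  have := hF.const_mul (-1)
  simp only [neg_mul, one_mul] at this
  exact this

open scoped Convolution in
theorem fourier_convolution {f g : ℝ → ℂ} (hf : Integrable f) (hg : Integrable g) (μ : ℝ) :
    ∫ x, Complex.exp (Complex.I * (μ * x : ℝ)) * (f ⋆[ContinuousLinearMap.mul ℂ ℂ] g) x =
      (∫ x, Complex.exp (Complex.I * (μ * x : ℝ)) * f x) *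
        ∫ x, Complex.exp (Complex.I * (μ * x : ℝ)) * g x := by
  rw [← ContinuousLinearMap.mul_apply' ℂ ℂ,
    ← integral_convolution (ContinuousLinearMap.mul ℂ ℂ) (integrable_exp_mul hf μ)
      (integrable_exp_mul hg μ)]
  congr 1
  funext x
  rw [convolution_def, convolution_def, ← integral_const_mul]
  congr 1
  funext t
  simp only [ContinuousLinearMap.mul_apply']
  rw [mul_mul_mul_comm, ← Complex.exp_add]
  congr 2
  push_cast
  ring

open scoped Convolution in
theorem IsFourierOn.mul {S : Set ℝ} (hS : ∀ x ∈ S, ∀ y ∈ S, x + y ∈ S) {F G : ℝ → ℂ}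
    (hF : IsFourierOn S F) (hG : IsFourierOn S G) : IsFourierOn S (F * G) := by
  obtain ⟨f, hf, hfS, hF⟩ := hF
  obtain ⟨g, hg, hgS, hG⟩ := hG
  refine ⟨f ⋆[ContinuousLinearMap.mul ℂ ℂ] g, hf.integrable_convolution _ hg, fun x hx => ?_,
    fun μ => ?_⟩
  · rw [convolution_def]
    refine integral_eq_zero_of_ae (Eventually.of_forall fun t => ?_)
    by_cases ht : t ∈ S
    · have : x - t ∉ S := fun h => hx (by simpa using hS t ht _ h)
      simp [hgS _ this]
    · simp [hfS t ht]
  · rw [Pi.mul_apply, hF, hG, fourier_convolution hf hg]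

theorem IsFourierOn.sum {S : Set ℝ} {ι : Type*} (s : Finset ι) {F : ι → ℝ → ℂ}
    (hF : ∀ i ∈ s, IsFourierOn S (F i)) : IsFourierOn S (∑ i ∈ s, F i) :=
  Finset.sum_induction _ (IsFourierOn S) (fun _ _ => IsFourierOn.add) (IsFourierOn.zero S) hF

/-- By Fourier injectivity the two underlying functions agree almost everywhere, yet they live on
disjoint sets. This replaces Liouville's theorem in the Wiener–Hopf arguments below. -/
theorem IsFourierOn.eq_zero {S T : Set ℝ} (hST : Disjoint S T) {F : ℝ → ℂ}
    (hS : IsFourierOn S F) (hT : IsFourierOn T F) : F = 0 := by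
  obtain ⟨f, hf, hfS, hF⟩ := hS
  obtain ⟨g, hg, hgT, hG⟩ := hT
  have h := ae_eq_zero_of_fourier (hf.sub hg) fun μ => by
    simp only [Pi.sub_apply, mul_sub]
    rw [integral_sub (integrable_exp_mul hf μ) (integrable_exp_mul hg μ), ← hF, ← hG, sub_self]
  have hf0 : f =ᵐ[volume] 0 := by
    filter_upwards [h] with x hx
    by_cases hxS : x ∈ S
    · have : g x = 0 := hgT x (disjoint_left.1 hST hxS)
      simpa [this] using hx
    · exact hfS x hxS
  funext μ
  rw [hF, Pi.zero_apply]
  exact integral_eq_zero_of_ae (by filter_upwards [hf0] with x hx; simp [hx])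

theorem add_mem_Ici_zero : ∀ x ∈ Ici (0 : ℝ), ∀ y ∈ Ici (0 : ℝ), x + y ∈ Ici (0 : ℝ) :=
  fun _ hx _ hy => add_nonneg (mem_Ici.1 hx) (mem_Ici.1 hy)

theorem add_mem_Iio_zero : ∀ x ∈ Iio (0 : ℝ), ∀ y ∈ Iio (0 : ℝ), x + y ∈ Iio (0 : ℝ) :=
  fun _ hx _ hy => add_neg (mem_Iio.1 hx) (mem_Iio.1 hy)

theorem disjoint_Ici_Iio_zero : Disjoint (Ici (0 : ℝ)) (Iio 0) :=
  disjoint_left.2 fun _ h h' => not_lt.2 (mem_Ici.1 h) (mem_Iio.1 h')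

/-! ### The factorization of Spitzer and Baxter -/

/-- If `u U = U'` and the coefficients of `U - 1` are transforms carried by `S`, so are those of
the logarithmic derivative `u`. -/
theorem IsFourierOn.of_logDeriv {S : Set ℝ} (hS : ∀ x ∈ S, ∀ y ∈ S, x + y ∈ S)
    {U u : ℕ → ℝ → ℂ} (hU0 : U 0 = 1) (hU : ∀ k, IsFourierOn S (U (k + 1)))
    (h : ∀ k, ∑ ij ∈ Finset.HasAntidiagonal.antidiagonal k, u ij.1 * U ij.2 = U (k + 1) * (k + 1)) (k : ℕ) :
    IsFourierOn S (u k) := by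
  induction k using Nat.strong_induction_on with
  | _ k ih =>
    have h1 := h k
    rw [Finset.Nat.sum_antidiagonal_eq_sum_range_succ (fun i j => u i * U j),
      Finset.sum_range_succ, Nat.sub_self, hU0, mul_one] at h1
    -- As `U 0 = 1`, the identity of order `k` is solved for `u k` in terms of `U (k+1)` and
    -- products of earlier terms, all carried by the semigroup `S`.
    rw [eq_sub_of_add_eq' h1, sub_eq_add_neg]
    refine IsFourierOn.add ?_ (IsFourierOn.neg (IsFourierOn.sum _ fun i hi => ?_))
    · convert (hU k).const_mul (k + 1) using 1
      funext μ
      simp [mul_comm]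
    · have hi := Finset.mem_range.1 hi
      refine (ih i hi).mul hS ?_
      obtain ⟨j, hj⟩ := Nat.exists_eq_succ_of_ne_zero (Nat.sub_ne_zero_of_lt hi)
      rw [hj]
      exact hU j

open PowerSeries in
/-- Spitzer's identity in differential form: if `H_{k+1} = f (H_k^- + w H_k^+)` (with `H_1 = f`),
then `U = 1 - (1-w) H^+` and `V = 1 + (1-w) H^-` have logarithmic derivatives
`∑ (w^{k+1} - 1) f_{k+1}^+ X^k` and `-∑ (w^{k+1} - 1) f_{k+1}^- X^k`, where `f_k^±` are the parts of
`f^k`. -/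
theorem spitzer_identity {w : ℂ} {f : ℝ → ℂ} {Hp Hm fp fm : ℕ → ℝ → ℂ}
    (hHp : ∀ k, IsFourierOn (Ici 0) (Hp k)) (hHm : ∀ k, IsFourierOn (Iio 0) (Hm k))
    (hfp : ∀ k, IsFourierOn (Ici 0) (fp k)) (hfm : ∀ k, IsFourierOn (Iio 0) (fm k))
    (h0 : Hp 0 + Hm 0 = f)
    (hH : ∀ k, Hp (k + 1) + Hm (k + 1) = f * fun μ => Hm k μ + w * Hp k μ)
    (hf : ∀ k, fp k + fm k = f ^ (k + 1))
    {U V : ℕ → ℝ → ℂ} (hU0 : U 0 = 1) (hV0 : V 0 = 1)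
    (hU : ∀ k, U (k + 1) = fun μ => -(1 - w) * Hp k μ)
    (hV : ∀ k, V (k + 1) = fun μ => (1 - w) * Hm k μ) (k : ℕ) (μ : ℝ) :
    (∑ ij ∈ Finset.HasAntidiagonal.antidiagonal k, (w ^ (ij.1 + 1) - 1) * fp ij.1 μ * U ij.2 μ =
      U (k + 1) μ * (k + 1)) ∧
    ∑ ij ∈ Finset.HasAntidiagonal.antidiagonal k, -((w ^ (ij.1 + 1) - 1) * fm ij.1 μ) * V ij.2 μ =
      V (k + 1) μ * (k + 1) := by
  let W : ℝ → ℂ := fun _ => w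
  -- The common factor: its coefficients also include the weight of the current position. The
  -- recursion for `Hp`, `Hm` makes multiplication by `1 - fX` leave only the plus parts (`U`), and
  -- multiplication by `1 - wfX` only the minus parts (`V`).
  let G : PowerSeries (ℝ → ℂ) := PowerSeries.mk fun k => Nat.casesOn k 1 fun k => Hm k + W * Hp k
  let r : (ℝ → ℂ) → PowerSeries (ℝ → ℂ) := fun c => -PowerSeries.mk fun j => (c * f) ^ (j + 1)
  have hr : ∀ c, r c * (1 - X * C (c * f)) = d⁄dX (ℝ → ℂ) (1 - X * C (c * f)) := by
    intro c
    ext1 k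
    have : r c * (1 - X * C (c * f)) = r c - r c * C (c * f) * X := by ring
    rw [this, map_sub, coeff_derivative]
    cases k with
    | zero => simp [r, coeff_one]
    | succ k =>
      rw [coeff_succ_mul_X, coeff_mul_C, map_sub, coeff_succ_X_mul, coeff_C, coeff_one]
      simp [r, pow_succ, mul_assoc]
  have hPU : (1 - X * C (1 * f)) * G = PowerSeries.mk U := by
    ext1 k
    have : (1 - X * C (1 * f)) * G = G - X * (C f * G) := by rw [one_mul]; ring
    rw [this, map_sub]
    cases k with
    | zero => simp [G, hU0]
    | succ k =>
      rw [coeff_succ_X_mul, coeff_C_mul]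
      cases k with
      | zero =>
        simp only [G, coeff_mk, hU, ← h0]
        funext μ
        change Hm 0 μ + w * Hp 0 μ - (Hp 0 μ + Hm 0 μ) * 1 = -(1 - w) * Hp 0 μ
        ring
      | succ k =>
        simp only [G, coeff_mk, hU]
        funext μ
        have h2 : Hp (k + 1) μ + Hm (k + 1) μ = f μ * (Hm k μ + w * Hp k μ) := congrFun (hH k) μ
        change Hm (k + 1) μ + w * Hp (k + 1) μ - f μ * (Hm k μ + w * Hp k μ) =
          -(1 - w) * Hp (k + 1) μ
        rw [← h2]; ring
  have hPV : (1 - X * C (W * f)) * G = PowerSeries.mk V := by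
    ext1 k
    have : (1 - X * C (W * f)) * G = G - X * (C W * (C f * G)) := by rw [map_mul]; ring
    rw [this, map_sub]
    cases k with
    | zero => simp [G, hV0]
    | succ k =>
      rw [coeff_succ_X_mul, coeff_C_mul, coeff_C_mul]
      cases k with
      | zero =>
        simp only [G, coeff_mk, hV, ← h0]
        funext μ
        change Hm 0 μ + w * Hp 0 μ - w * ((Hp 0 μ + Hm 0 μ) * 1) = (1 - w) * Hm 0 μ
        ring
      | succ k =>
        simp only [G, coeff_mk, hV]
        funext μ
        have h2 : Hp (k + 1) μ + Hm (k + 1) μ = f μ * (Hm k μ + w * Hp k μ) := congrFun (hH k) μ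
        change Hm (k + 1) μ + w * Hp (k + 1) μ - w * (f μ * (Hm k μ + w * Hp k μ)) =
          (1 - w) * Hm (k + 1) μ
        rw [← h2]; ring
  let g : PowerSeries (ℝ → ℂ) := d⁄dX (ℝ → ℂ) G * invOfUnit G 1
  have hg : g * G = d⁄dX (ℝ → ℂ) G := by
    have : G * invOfUnit G 1 = 1 := mul_invOfUnit G 1 (by simp [G])
    rw [mul_assoc, mul_comm _ G, this, mul_one]
  have hlog : ∀ (c : ℝ → ℂ) (Y : ℕ → ℝ → ℂ), (1 - X * C (c * f)) * G = PowerSeries.mk Y → ∀ k,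
      ∑ ij ∈ Finset.HasAntidiagonal.antidiagonal k, coeff ij.1 (r c + g) * Y ij.2 = Y (k + 1) * (k + 1) := by
    intro c Y hY k
    have h1 : (r c + g) * PowerSeries.mk Y = d⁄dX (ℝ → ℂ) (PowerSeries.mk Y) := by
      rw [← hY, Derivation.leibniz, ← hr, ← hg]
      simp only [smul_eq_mul]
      ring
    have := congrArg (coeff k) h1
    rw [coeff_mul, coeff_derivative] at this
    simpa using this
  have hu := IsFourierOn.of_logDeriv (u := fun k => coeff k (r 1 + g)) add_mem_Ici_zero hU0
    (fun k => by rw [hU]; exact (hHp k).const_mul _) (hlog 1 U hPU)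
  have hv := IsFourierOn.of_logDeriv (u := fun k => coeff k (r W + g)) add_mem_Iio_zero hV0
    (fun k => by rw [hV]; exact (hHm k).const_mul _) (hlog W V hPV)
  -- The logarithmic derivative `g` of `G` cancels in the difference of those of `U` and `V`, which
  -- leaves `∑ (w^{k+1} - 1) f^{k+1} X^k`. After splitting `f^{k+1}` into its two parts, the left
  -- side is carried by `[0,∞)` and the right side by `(-∞,0)`; both vanish.
  have hdiff : ∀ k, coeff k (r 1 + g) + -(fun μ => (w ^ (k + 1) - 1) * fp k μ) =
      coeff k (r W + g) + fun μ => (w ^ (k + 1) - 1) * fm k μ := by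
    intro k
    have h1 := hf k
    funext μ
    have h2 := congrFun h1 μ
    simp [r, W, mul_pow] at h2 ⊢
    linear_combination (1 - w ^ (k + 1)) * h2
  have hz : ∀ k, coeff k (r 1 + g) + -(fun μ => (w ^ (k + 1) - 1) * fp k μ) = 0 := fun k =>
    IsFourierOn.eq_zero disjoint_Ici_Iio_zero ((hu k).add ((hfp k).const_mul _).neg)
      (by rw [hdiff]; exact (hv k).add ((hfm k).const_mul _))
  constructor
  · have := congrFun (hlog 1 U hPU k) μ
    simp only [Finset.sum_apply, Pi.mul_apply] at this
    refine Eq.trans (Finset.sum_congr rfl fun ij _ => ?_) (this.trans (by simp))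
    have := congrFun (hz ij.1) μ
    simp only [Pi.add_apply, Pi.neg_apply, Pi.zero_apply] at this
    rw [eq_neg_of_add_eq_zero_left this, neg_neg]
  · have := congrFun (hlog W V hPV k) μ
    simp only [Finset.sum_apply, Pi.mul_apply] at this
    refine Eq.trans (Finset.sum_congr rfl fun ij _ => ?_) (this.trans (by simp))
    have := congrFun ((hdiff ij.1).symm.trans (hz ij.1)) μ
    simp only [Pi.add_apply, Pi.zero_apply] at this
    rw [eq_neg_of_add_eq_zero_left this]

/-! ### Exponentials of power series -/

/-- An intermediate radius `s` absorbs the factor `k`, since `k (r/s)^k` is bounded. -/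
theorem summable_nat_mul_norm {a : ℕ → ℂ}
    (ha : ∀ r : ℝ, 0 ≤ r → r < 1 → Summable fun k => ‖a k‖ * r ^ k) {r : ℝ} (hr0 : 0 < r)
    (hr : r < 1) : Summable fun k : ℕ => k * ‖a k‖ * r ^ (k - 1) := by
  obtain ⟨s, hrs, hs⟩ := exists_between hr
  have hs0 : 0 < s := hr0.trans hrs
  have hq : Tendsto (fun k : ℕ => (k : ℝ) * (r / s) ^ k) atTop (𝓝 0) :=
    tendsto_self_mul_const_pow_of_lt_one (by positivity) ((div_lt_one hs0).2 hrs)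
  obtain ⟨M, hM⟩ := hq.bddAbove_range
  refine Summable.of_nonneg_of_le (fun k => by positivity) (fun k => ?_)
    ((ha s hs0.le hs).mul_left (M / r))
  have h1 := hM ⟨k, rfl⟩
  cases k with
  | zero =>
    have : 0 ≤ M := by simpa using h1
    simp; positivity
  | succ k =>
    rw [Nat.succ_sub_one, div_mul_eq_mul_div, le_div_iff₀ hr0]
    calc (↑(k + 1) * ‖a (k + 1)‖ * r ^ k * r : ℝ)
        = (↑(k + 1) * (r / s) ^ (k + 1)) * (‖a (k + 1)‖ * s ^ (k + 1)) := by
          rw [div_pow, pow_succ r]; field_simp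
      _ ≤ _ := by gcongr

theorem hasDerivAt_tsum_pow {a : ℕ → ℂ}
    (ha : ∀ r : ℝ, 0 ≤ r → r < 1 → Summable fun k => ‖a k‖ * r ^ k) {z : ℂ} (hz : ‖z‖ < 1) :
    HasDerivAt (fun z => ∑' k, a k * z ^ k) (∑' k, a (k + 1) * (k + 1) * z ^ k) z := by
  obtain ⟨r, hzr, hr⟩ := exists_between hz
  have hr0 : 0 < r := (norm_nonneg z).trans_lt hzr
  have hs := summable_nat_mul_norm ha hr0 hr
  have hb : ∀ n : ℕ, ∀ y ∈ Metric.ball (0 : ℂ) r,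
      ‖a n * (n * y ^ (n - 1))‖ ≤ n * ‖a n‖ * r ^ (n - 1) := fun n y hy => by
    rw [norm_mul, norm_mul, norm_pow, Complex.norm_natCast, mul_left_comm, ← mul_assoc]
    gcongr
    exact (mem_ball_zero_iff.1 hy).le
  have hzb : z ∈ Metric.ball (0 : ℂ) r := mem_ball_zero_iff.2 hzr
  have := hasDerivAt_tsum_of_isPreconnected (g := fun k z => a k * z ^ k) hs Metric.isOpen_ball
    (convex_ball _ _).isPreconnected (fun n y _ => (hasDerivAt_pow n y).const_mul (a n)) hb
    (Metric.mem_ball_self hr0) (summable_of_ne_finset_zero (s := {0}) fun n hn => by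
      simp [Finset.notMem_singleton.1 hn]) hzb
  refine this.congr_deriv ?_
  rw [(Summable.of_norm_bounded hs fun n => hb n z hzb).tsum_eq_zero_add]
  simp [mul_assoc]

/-- If the logarithmic derivative has coefficients bounded by `C`, then `U` is majorized by
`(1-z)^{-C}`, whose logarithmic derivative `C/(1-z)` has all coefficients equal to `C`. So `U`
converges in the unit disc, where it solves `U' = uU`. -/
theorem summable_and_tsum_eq_exp {U u : ℕ → ℂ} {C : ℝ} (hC : 0 < C) (hu : ∀ k, ‖u k‖ ≤ C)
    (hU0 : U 0 = 1)
    (h : ∀ k, ∑ ij ∈ Finset.HasAntidiagonal.antidiagonal k, u ij.1 * U ij.2 = U (k + 1) * (k + 1)) {z : ℝ}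
    (hz0 : 0 ≤ z) (hz : z < 1) :
    (Summable fun k => ‖U k‖ * z ^ k) ∧
      ∑' k, U k * (z : ℂ) ^ k = Complex.exp (∑' k, u k / (k + 1) * (z : ℂ) ^ (k + 1)) := by
  -- The Taylor coefficients of `(1-z)^{-C}`.
  let b : ℕ → ℝ := fun k => Nat.rec 1 (fun k b => b * ((k + C) / (k + 1))) k
  have hbs : ∀ k, b (k + 1) = b k * ((k + C) / (k + 1)) := fun k => rfl
  have hbpos : ∀ k, 0 < b k := by
    intro k
    induction k with
    | zero => exact one_pos
    | succ k ih => rw [hbs]; positivity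
  have hbsum : ∀ k, C * ∑ j ∈ Finset.range (k + 1), b j = b (k + 1) * (k + 1) := by
    intro k
    induction k with
    | zero => simp [b]
    | succ k ih =>
      rw [Finset.sum_range_succ, mul_add, ih, hbs (k + 1)]
      push_cast
      field_simp
  have hUb : ∀ k, ‖U k‖ ≤ b k := by
    intro k
    induction k using Nat.strong_induction_on with
    | _ k ih =>
      cases k with
      | zero => simp [hU0, b]
      | succ k =>
        have h1 := congrArg norm (h k)
        rw [norm_mul] at h1
        have h2 : ‖((k : ℂ) + 1)‖ = k + 1 := by exact_mod_cast Complex.norm_natCast (k + 1)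
        rw [h2] at h1
        have h3 : ‖U (k + 1)‖ * (k + 1) ≤ b (k + 1) * (k + 1) := by
          rw [← h1, ← hbsum, Finset.mul_sum,
            Finset.Nat.sum_antidiagonal_eq_sum_range_succ (fun i j => u i * U j),
            ← Finset.sum_range_reflect]
          refine norm_sum_le_of_le _ fun j hj => ?_
          have hj := Finset.mem_range.1 hj
          rw [norm_mul]
          have : k - (k + 1 - 1 - j) = j := by omega
          rw [this]
          exact mul_le_mul (hu _) (ih j (by omega)) (norm_nonneg _) hC.le
        exact le_of_mul_le_mul_right h3 (by positivity)
  have hbsummable : ∀ r : ℝ, 0 < r → r < 1 → Summable fun k => b k * r ^ k := by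
    intro r hr0 hr
    refine summable_of_ratio_test_tendsto_lt_one hr
      (Eventually.of_forall fun n => (mul_pos (hbpos n) (pow_pos hr0 n)).ne') ?_
    have h1 : ∀ k : ℕ, ‖b (k + 1) * r ^ (k + 1)‖ / ‖b k * r ^ k‖ = (k + C) / (k + 1) * r := by
      intro k
      have := hbpos k
      rw [Real.norm_of_nonneg (by have := hbpos (k + 1); positivity),
        Real.norm_of_nonneg (by positivity), hbs, pow_succ]
      field_simp
    simp only [h1]
    have h2 : Tendsto (fun k : ℕ => ((k : ℝ) + C) / (k + 1)) atTop (𝓝 1) := by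
      have h3 : Tendsto (fun k : ℕ => 1 + (C - 1) * (1 / ((k : ℝ) + 1))) atTop (𝓝 (1 + (C - 1) * 0)) :=
        (tendsto_one_div_add_atTop_nhds_zero_nat.const_mul _).const_add _
      rw [mul_zero, add_zero] at h3
      refine h3.congr fun k => ?_
      field_simp
      ring
    simpa using h2.mul_const r
  have hUs : ∀ r : ℝ, 0 ≤ r → r < 1 → Summable fun k => ‖U k‖ * r ^ k := by
    intro r hr0 hr
    rcases hr0.eq_or_lt with rfl | hr0
    · exact summable_of_ne_finset_zero (s := {0}) fun n hn => by
        simp [Finset.notMem_singleton.1 hn]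
    · exact Summable.of_nonneg_of_le (fun k => by positivity)
        (fun k => by gcongr; exact hUb k) (hbsummable r hr0 hr)
  let s : ℕ → ℂ := fun k => Nat.casesOn k 0 fun k => u k / (k + 1)
  have hs1 : ∀ k : ℕ, s (k + 1) * (k + 1) = u k := fun k => by
    have : ((k : ℂ) + 1) ≠ 0 := Nat.cast_add_one_ne_zero k
    simp only [s]; field_simp
  have hss : ∀ r : ℝ, 0 ≤ r → r < 1 → Summable fun k => ‖s k‖ * r ^ k := by
    intro r hr0 hr
    refine Summable.of_nonneg_of_le (fun k => by positivity) (fun k => ?_)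
      ((summable_geometric_of_lt_one hr0 hr).mul_left C)
    gcongr
    cases k with
    | zero => simp [s, hC.le]
    | succ k =>
      have h2 : ‖((k : ℂ) + 1)‖ = k + 1 := by exact_mod_cast Complex.norm_natCast (k + 1)
      simp only [s]
      rw [norm_div, h2]
      exact (div_le_self (norm_nonneg _) (by linarith [Nat.cast_nonneg (α := ℝ) k])).trans (hu k)
  have hus : ∀ r : ℝ, 0 ≤ r → r < 1 → Summable fun k => ‖u k‖ * r ^ k := fun r hr0 hr =>
    Summable.of_nonneg_of_le (fun k => by positivity) (fun k => by gcongr; exact hu k)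
      ((summable_geometric_of_lt_one hr0 hr).mul_left C)
  refine ⟨hUs z hz0 hz, ?_⟩
  -- The series times the inverse of the claimed exponential; its derivative vanishes on the disc.
  let Φ : ℂ → ℂ := fun z => (∑' k, U k * z ^ k) * Complex.exp (-∑' k, s k * z ^ k)
  have hΦ : ∀ y ∈ Metric.ball (0 : ℂ) 1, HasDerivAt Φ 0 y := by
    intro y hy
    have hy1 := mem_ball_zero_iff.1 hy
    have h1 := hasDerivAt_tsum_pow hUs hy1
    have h2 := hasDerivAt_tsum_pow hss hy1
    simp only [hs1] at h2
    have h3 : ∑' k, U (k + 1) * (k + 1) * y ^ k = (∑' k, u k * y ^ k) * ∑' k, U k * y ^ k := by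
      rw [tsum_mul_tsum_eq_tsum_sum_antidiagonal_of_summable_norm]
      · refine tsum_congr fun k => ?_
        rw [← h k, Finset.sum_mul]
        refine Finset.sum_congr rfl fun ij hij => ?_
        rw [← Finset.HasAntidiagonal.mem_antidiagonal.1 hij, pow_add]
        ring
      · simpa using hus ‖y‖ (norm_nonneg y) hy1
      · simpa using hUs ‖y‖ (norm_nonneg y) hy1
    refine (h1.mul h2.neg.cexp).congr_deriv ?_
    rw [h3]
    ring
  have hconst := Metric.isOpen_ball.is_const_of_deriv_eq_zero (convex_ball _ _).isPreconnected
    (fun y hy => (hΦ y hy).differentiableAt.differentiableWithinAt)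
    (fun y hy => (hΦ y hy).deriv) (Metric.mem_ball_self one_pos)
    (show (z : ℂ) ∈ Metric.ball 0 1 by
      rw [mem_ball_zero_iff, Complex.norm_real, Real.norm_of_nonneg hz0]; exact hz)
  have hat0 : ∀ a : ℕ → ℂ, ∑' k, a k * (0 : ℂ) ^ k = a 0 := fun a => by
    rw [tsum_eq_single 0 fun k hk => by simp [hk]]; simp
  have hsz : ∑' k, s k * (z : ℂ) ^ k = ∑' k, u k / (k + 1) * (z : ℂ) ^ (k + 1) := by
    have : Summable fun k => s k * (z : ℂ) ^ k := by
      refine Summable.of_norm ?_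
      simpa [abs_of_nonneg hz0] using hss z hz0 hz
    rw [this.tsum_eq_zero_add]
    simp [s]
  simp only [Φ, hat0, hU0] at hconst
  rw [← hsz]
  have hs0 : s 0 = 0 := rfl
  rw [hs0, neg_zero, Complex.exp_zero, one_mul, Complex.exp_neg,
    eq_mul_inv_iff_mul_eq₀ (Complex.exp_ne_zero _), one_mul] at hconst
  exact hconst.symm

/-! ### Pseudo-expectations of multiplicative functionals -/

theorem measurable_observations {k : ℕ} (j : ℕ) :
    Measurable fun y : Fin k → ℝ => observations y j := by
  unfold observations
  split_ifs
  · exact measurable_pi_apply _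
  · exact measurable_const

theorem observations_zero {k : ℕ} (y : Fin k → ℝ) : observations y 0 = 0 := by
  simp [observations]

theorem observations_snoc_of_le {k : ℕ} (y : Fin k → ℝ) (x : ℝ) {j : ℕ} (hj : j ≤ k) :
    observations (Fin.snoc y x : Fin (k + 1) → ℝ) j = observations y j := by
  unfold observations
  by_cases h : 1 ≤ j
  · rw [dif_pos ⟨h, by omega⟩, dif_pos ⟨h, hj⟩]
    have : (⟨j - 1, by omega⟩ : Fin (k + 1)) = Fin.castSucc ⟨j - 1, by omega⟩ := rfl
    rw [this, Fin.snoc_castSucc (α := fun _ => ℝ)]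
  · rw [dif_neg (by tauto), dif_neg (by tauto)]

theorem observations_snoc_last {k : ℕ} (y : Fin k → ℝ) (x : ℝ) :
    observations (Fin.snoc y x : Fin (k + 1) → ℝ) (k + 1) = x := by
  unfold observations
  rw [dif_pos ⟨by omega, le_rfl⟩]
  exact Fin.snoc_last (α := fun _ => ℝ) _ _

theorem measurePreserving_snoc (k : ℕ) :
    MeasurePreserving fun q : ℝ × (Fin k → ℝ) => (Fin.snoc q.2 q.1 : Fin (k + 1) → ℝ) := by
  have := (volume_preserving_piFinSuccAbove (fun _ : Fin (k + 1) => ℝ) (Fin.last k)).symm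
  convert this using 1
  funext q
  exact (Fin.insertNth_last' q.1 q.2).symm

theorem measurableEmbedding_snoc (k : ℕ) :
    MeasurableEmbedding fun q : ℝ × (Fin k → ℝ) => (Fin.snoc q.2 q.1 : Fin (k + 1) → ℝ) := by
  have := (MeasurableEquiv.piFinSuccAbove (fun _ : Fin (k + 1) => ℝ) (Fin.last k)).symm.measurableEmbedding
  convert this using 1
  funext q
  exact (Fin.insertNth_last' q.1 q.2).symm

/-- The weight `w` on `[0,∞)` and `1` on `(-∞,0)`. -/
noncomputable def halfWeight (w x : ℝ) : ℝ := if 0 ≤ x then w else 1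

theorem measurable_halfWeight (w : ℝ) : Measurable (halfWeight w) :=
  Measurable.ite measurableSet_Ici measurable_const measurable_const

theorem abs_halfWeight_le (w x : ℝ) : |halfWeight w x| ≤ max |w| 1 := by
  unfold halfWeight
  split_ifs
  · exact le_max_left _ _
  · simp

/-- `∏_{j<k} m(x_j) p(h; x_j - x_{j+1})` with `m = halfWeight w`. -/
noncomputable def pathWeight (N : ℕ) (h w : ℝ) (k : ℕ) (y : Fin k → ℝ) : ℝ :=
  ∏ j ∈ Finset.range k,
    (halfWeight w (observations y j) * kernel N h (observations y j - observations y (j + 1)))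

theorem pathWeight_snoc (N : ℕ) (h w : ℝ) (k : ℕ) (y : Fin k → ℝ) (x : ℝ) :
    pathWeight N h w (k + 1) (Fin.snoc y x) = pathWeight N h w k y *
      (halfWeight w (observations y k) * kernel N h (observations y k - x)) := by
  rw [pathWeight, Finset.prod_range_succ, observations_snoc_last, observations_snoc_of_le _ _ le_rfl,
    pathWeight]
  congr 1
  refine Finset.prod_congr rfl fun j hj => ?_
  have := Finset.mem_range.1 hj
  rw [observations_snoc_of_le _ _ (by omega), observations_snoc_of_le _ _ (by omega)]

theorem measurable_pathWeight (N : ℕ) (h w : ℝ) (k : ℕ) : Measurable (pathWeight N h w k) :=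
  Finset.measurable_prod _ fun j _ =>
    ((measurable_halfWeight w).comp (measurable_observations j)).mul
      ((measurable_kernel_right N h).comp
        ((measurable_observations j).sub (measurable_observations (j + 1))))

/-- Tonelli with the newest position integrated first: it contributes at most `max |w| 1` times the
total variation of the kernel. -/
theorem integrable_pathWeight_snoc {N : ℕ} (hN : 2 ≤ N) (hE : Even N) {h : ℝ} (hh : 0 < h) (w : ℝ)
    {k : ℕ} (hk : Integrable (pathWeight N h w k)) :
    Integrable fun q : ℝ × (Fin k → ℝ) => pathWeight N h w k q.2 *
      (halfWeight w (observations q.2 k) * kernel N h (observations q.2 k - q.1)) := by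
  have hmeas : AEStronglyMeasurable (fun q : ℝ × (Fin k → ℝ) => pathWeight N h w k q.2 *
      (halfWeight w (observations q.2 k) * kernel N h (observations q.2 k - q.1)))
      (volume.prod volume) := by
    refine Measurable.aestronglyMeasurable ?_
    refine ((measurable_pathWeight N h w k).comp measurable_snd).mul
      (((measurable_halfWeight w).comp ((measurable_observations k).comp measurable_snd)).mul
      ((measurable_kernel_right N h).comp
        (((measurable_observations k).comp measurable_snd).sub measurable_fst)))
  rw [Measure.volume_eq_prod, integrable_prod_iff' hmeas]
  constructor
  · refine Eventually.of_forall fun y => ?_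
    exact (((integrable_kernel hN hE hh).comp_sub_left (observations y k)).const_mul
      (halfWeight w (observations y k))).const_mul (pathWeight N h w k y)
  · have h1 : ∀ y : Fin k → ℝ, ∫ x, ‖pathWeight N h w k y *
      (halfWeight w (observations y k) * kernel N h (observations y k - x))‖ =
        ‖pathWeight N h w k y‖ * (|halfWeight w (observations y k)| * kernelNorm N) := by
      intro y
      simp only [norm_mul]
      rw [integral_const_mul, integral_const_mul, Real.norm_eq_abs, Real.norm_eq_abs]
      congr 2
      rw [← integral_abs_kernel hN hE hh]
      exact integral_sub_left_eq_self (fun x => |kernel N h x|) volume _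
    simp only [h1]
    refine hk.norm.mul_bdd (c := max |w| 1 * kernelNorm N) ?_ (Eventually.of_forall fun y => ?_)
    · have := ((measurable_halfWeight w).comp (measurable_observations (k := k) k))
      exact ((Measurable.norm this).mul_const _).aestronglyMeasurable
    · rw [Real.norm_of_nonneg (mul_nonneg (abs_nonneg _) (kernelNorm_nonneg N))]
      exact mul_le_mul_of_nonneg_right (abs_halfWeight_le w _) (kernelNorm_nonneg N)

theorem integrable_pathWeight {N : ℕ} (hN : 2 ≤ N) (hE : Even N) {h : ℝ} (hh : 0 < h) (w : ℝ)
    (k : ℕ) : Integrable (pathWeight N h w k) := by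
  induction k with
  | zero =>
    have : IsFiniteMeasure (volume : Measure (Fin 0 → ℝ)) := by
      rw [Measure.volume_pi_eq_dirac 0]; infer_instance
    exact Integrable.of_finite
  | succ k ih =>
    rw [← (measurePreserving_snoc k).integrable_comp_emb (measurableEmbedding_snoc k)]
    simpa only [Function.comp_def, pathWeight_snoc] using
      integrable_pathWeight_snoc hN hE hh w ih

theorem integral_pathWeight_zero (N : ℕ) (h w : ℝ) (φ : ℝ → ℂ) :
    ∫ y : Fin 0 → ℝ, φ (observations y 0) * (pathWeight N h w 0 y : ℂ) = φ 0 := by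
  rw [Measure.volume_pi_eq_dirac 0, integral_dirac, observations_zero]
  simp [pathWeight]

theorem integral_pathWeight_succ {N : ℕ} (hN : 2 ≤ N) (hE : Even N) {h : ℝ} (hh : 0 < h) (w : ℝ)
    (k : ℕ) {φ : ℝ → ℂ} (hφ : Measurable φ) {C : ℝ} (hC : ∀ x, ‖φ x‖ ≤ C) :
    ∫ y : Fin (k + 1) → ℝ, φ (observations y (k + 1)) * (pathWeight N h w (k + 1) y : ℂ) =
      ∫ y : Fin k → ℝ, (halfWeight w (observations y k) *
        ∫ x, φ x * (kernel N h (observations y k - x) : ℂ)) * (pathWeight N h w k y : ℂ) := by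
  rw [← (measurePreserving_snoc k).integral_comp (measurableEmbedding_snoc k)]
  simp only [observations_snoc_last, pathWeight_snoc]
  rw [Measure.volume_eq_prod, integral_prod_symm]
  · refine integral_congr_ae (Eventually.of_forall fun y => ?_)
    simp only
    rw [← integral_const_mul, ← integral_mul_const]
    congr 1
    funext x
    push_cast
    ring
  · refine (integrable_pathWeight_snoc hN hE hh w
      (integrable_pathWeight hN hE hh w k)).ofReal.bdd_mul (c := C)
      (hφ.comp measurable_fst).aestronglyMeasurable (Eventually.of_forall fun q => hC q.1)

open scoped Convolution in
/-- The density of the `(k+1)`-st position under the measure weighted by `m(x_1) ⋯ m(x_k)`. -/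
noncomputable def weightedDensity (N : ℕ) (h w : ℝ) : ℕ → ℝ → ℂ
  | 0 => fun x => kernel N h x
  | k + 1 => (fun y => halfWeight w y * weightedDensity N h w k y)
      ⋆[ContinuousLinearMap.mul ℂ ℂ] fun x => (kernel N h x : ℂ)

theorem integrable_halfWeight_mul {w : ℝ} {g : ℝ → ℂ} (hg : Integrable g) :
    Integrable fun y => (halfWeight w y : ℂ) * g y :=
  hg.bdd_mul (c := max |w| 1)
    (Complex.measurable_ofReal.comp (measurable_halfWeight w)).aestronglyMeasurable
    (Eventually.of_forall fun x => by
      rw [Complex.norm_real]; exact abs_halfWeight_le w x)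

theorem integrable_weightedDensity {N : ℕ} (hN : 2 ≤ N) (hE : Even N) {h : ℝ} (hh : 0 < h) (w : ℝ)
    (k : ℕ) : Integrable (weightedDensity N h w k) := by
  induction k with
  | zero => exact (integrable_kernel hN hE hh).ofReal
  | succ k ih =>
    exact (integrable_halfWeight_mul ih).integrable_convolution _ (integrable_kernel hN hE hh).ofReal

/-- The last position is integrated out, which replaces `φ` by a weighted convolution with the
kernel, and the induction continues with one step fewer. The factor `w` is the weight of the
starting point `0 ∈ [0,∞)`, which `weightedDensity` leaves out. -/
theorem integral_pathWeight_eq {N : ℕ} (hN : 2 ≤ N) (hE : Even N) {h : ℝ} (hh : 0 < h) {w : ℝ}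
    (k : ℕ) {φ : ℝ → ℂ} (hφ : Measurable φ) {C : ℝ} (hC : ∀ x, ‖φ x‖ ≤ C) :
    ∫ y : Fin (k + 1) → ℝ, φ (observations y (k + 1)) * (pathWeight N h w (k + 1) y : ℂ) =
      w * ∫ x, φ x * weightedDensity N h w k x := by
  induction k generalizing φ C with
  | zero =>
    rw [integral_pathWeight_succ hN hE hh w 0 hφ hC]
    rw [integral_pathWeight_zero N h w fun y => halfWeight w y * ∫ x, φ x * (kernel N h (y - x) : ℂ)]
    simp [halfWeight, kernel_neg hE, weightedDensity]
  | succ k ih =>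
    have hP : Measurable fun y : ℝ => ∫ x, φ x * (kernel N h (y - x) : ℂ) := by
      refine (StronglyMeasurable.integral_prod_right (f := fun y x : ℝ =>
        φ x * (kernel N h (y - x) : ℂ)) (ν := volume) ?_).measurable
      refine Measurable.stronglyMeasurable ?_
      exact (hφ.comp measurable_snd).mul (Complex.measurable_ofReal.comp
        ((measurable_kernel_right N h).comp (measurable_fst.sub measurable_snd)))
    have hPb : ∀ y : ℝ, ‖∫ x, φ x * (kernel N h (y - x) : ℂ)‖ ≤ C * kernelNorm N := by
      intro y
      rw [← integral_abs_kernel hN hE hh, ← integral_sub_left_eq_self (fun x => |kernel N h x|) volume y,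
        ← integral_const_mul]
      refine norm_integral_le_of_norm_le
        ((((integrable_kernel hN hE hh).comp_sub_left y).abs).const_mul C)
        (Eventually.of_forall fun x => ?_)
      rw [norm_mul, Complex.norm_real, Real.norm_eq_abs]
      exact mul_le_mul_of_nonneg_right (hC x) (abs_nonneg _)
    have hC0 : 0 ≤ C := (norm_nonneg _).trans (hC 0)
    rw [integral_pathWeight_succ hN hE hh w (k + 1) hφ hC]
    rw [ih (φ := fun y => halfWeight w y * ∫ x, φ x * (kernel N h (y - x) : ℂ))
      (C := max |w| 1 * (C * kernelNorm N))]
    · congr 1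
      have hq := integrable_halfWeight_mul (w := w) (integrable_weightedDensity hN hE hh w k)
      have hint := (hq.convolution_integrand (ContinuousLinearMap.mul ℂ ℂ)
        (integrable_kernel hN hE hh).ofReal (𝕜 := ℂ) (μ := volume)).bdd_mul
        (f := fun q : ℝ × ℝ => φ q.1) (c := C)
        (hφ.comp measurable_fst).aestronglyMeasurable (Eventually.of_forall fun q => hC q.1)
      have h1 : ∀ x, φ x * weightedDensity N h w (k + 1) x = ∫ y, φ x *
          ((ContinuousLinearMap.mul ℂ ℂ) (halfWeight w y * weightedDensity N h w k y)
            (kernel N h (x - y) : ℂ)) := fun x => by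
        rw [integral_const_mul]; rfl
      simp only [h1]
      rw [integral_integral_swap hint]
      congr 1
      funext y
      rw [mul_right_comm, mul_comm, ← integral_mul_const]
      congr 1
      funext x
      -- Paths carry `p(x_j - x_{j+1})` while the convolution carries the opposite difference; the
      -- kernel is even.
      rw [← kernel_neg hE, neg_sub]
      simp only [ContinuousLinearMap.mul_apply']
      ring
    · exact (Complex.measurable_ofReal.comp (measurable_halfWeight w)).mul hP
    · intro x
      rw [norm_mul, Complex.norm_real]
      exact mul_le_mul (abs_halfWeight_le w x) (hPb x) (norm_nonneg _)
        ((abs_nonneg _).trans (le_max_left _ _))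

/-! ### The step functional -/

theorem floor_of_mem_Ioo {n j : ℕ} {t : ℝ} (ht : t ∈ Ioo ((j : ℝ) / 2 ^ n) ((j + 1) / 2 ^ n)) :
    ⌊2 ^ n * t⌋₊ = j := by
  have h2 : (0 : ℝ) < 2 ^ n := by positivity
  have h1 := (div_lt_iff₀ h2).1 ht.1
  have h3 := (lt_div_iff₀ h2).1 ht.2
  rw [Nat.floor_eq_iff (by nlinarith [Nat.cast_nonneg (α := ℝ) j])]
  constructor <;> linarith

/-- `1_{[0,∞)}`. -/
noncomputable def halfIndicator (x : ℝ) : ℝ := (Ici (0 : ℝ)).indicator (fun _ => (1 : ℝ)) x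

theorem intervalIntegrable_halfIndicator_stepPath (n : ℕ) (ω : ℕ → ℝ) (a b : ℝ) :
    IntervalIntegrable (fun u => halfIndicator (stepPath n ω u)) volume a b := by
  have hmeas : Measurable fun u : ℝ => halfIndicator (stepPath n ω u) := by
    unfold stepPath
    exact (measurable_from_nat (f := fun j => halfIndicator (ω j))).comp
      (Nat.measurable_floor.comp (measurable_id.const_mul _))
  refine (intervalIntegrable_const (c := (1 : ℝ))).mono_fun hmeas.aestronglyMeasurable
    (Eventually.of_forall fun u => ?_)
  simp only [halfIndicator]
  exact norm_indicator_le_norm_self (fun _ => (1 : ℝ)) _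

theorem integral_halfIndicator_stepPath {n : ℕ} (ω : ℕ → ℝ) {j : ℕ} {t : ℝ}
    (ht : t ∈ Icc ((j : ℝ) / 2 ^ n) ((j + 1) / 2 ^ n)) :
    ∫ u in ((j : ℝ) / 2 ^ n)..t, halfIndicator (stepPath n ω u) =
      (t - j / 2 ^ n) * halfIndicator (ω j) := by
  rw [intervalIntegral.integral_congr_Ioo_of_le (g := fun _ => halfIndicator (ω j)) ht.1]
  · simp
  · intro u hu
    simp only [stepPath, floor_of_mem_Ioo ⟨hu.1, hu.2.trans_le ht.2⟩]

theorem stepSojourn_eq {n : ℕ} (ω : ℕ → ℝ) {k : ℕ} {t : ℝ}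
    (ht : t ∈ Icc ((k : ℝ) / 2 ^ n) ((k + 1) / 2 ^ n)) :
    stepSojourn n ω t = (∑ j ∈ Finset.range k, halfIndicator (ω j)) / 2 ^ n +
      (t - k / 2 ^ n) * halfIndicator (ω k) := by
  have hII := intervalIntegrable_halfIndicator_stepPath n ω
  have h0 : ∀ k : ℕ, ∫ u in (0 : ℝ)..(k / 2 ^ n), halfIndicator (stepPath n ω u) =
      (∑ j ∈ Finset.range k, halfIndicator (ω j)) / 2 ^ n := by
    intro k
    induction k with
    | zero => simp
    | succ k ih =>
      rw [← intervalIntegral.integral_add_adjacent_intervals (hII 0 (k / 2 ^ n)) (hII _ _), ih,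
        Finset.sum_range_succ, Nat.cast_succ, integral_halfIndicator_stepPath ω
          ⟨by gcongr; linarith, le_rfl⟩]
      ring
  rw [← integral_halfIndicator_stepPath ω ht, ← h0 k,
    intervalIntegral.integral_add_adjacent_intervals (hII _ _) (hII _ _)]
  rfl

/-- `∫_0^h e^{-(λ + ν 1(x ≥ 0)) u} du`. -/
noncomputable def endWeight (lam ν h x : ℝ) : ℝ :=
  if 0 ≤ x then (1 - Real.exp (-((lam + ν) * h))) / (lam + ν) else (1 - Real.exp (-(lam * h))) / lam

theorem integral_exp_neg_mul {σ : ℝ} (hσ : 0 < σ) (h : ℝ) :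
    ∫ u in (0 : ℝ)..h, Complex.exp (-(σ * u : ℝ)) = ((1 - Real.exp (-(σ * h))) / σ : ℝ) := by
  have hσ' : (-σ : ℂ) ≠ 0 := by exact_mod_cast neg_ne_zero.2 hσ.ne'
  have := integral_exp_mul_complex (a := 0) (b := h) hσ'
  simp only [Complex.ofReal_mul, ← neg_mul]
  rw [this]
  push_cast
  rw [mul_zero, Complex.exp_zero, div_neg, ← neg_div, neg_sub, neg_mul]

/-- On the cell `[kh,(k+1)h)` the path is constant and the sojourn time is affine. The past enters
through a product of weights over `j < k`, and the cell itself through an elementary integral. -/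
theorem functionalTerm_eq {lam μ ν : ℝ} (hl : 0 < lam) (hν : 0 < ν) (n k : ℕ) (ω : ℕ → ℝ) :
    functionalTerm lam μ ν n k ω = (Real.exp (-(lam * (1 / 2 ^ n))) ^ k : ℝ) *
      (Complex.exp (Complex.I * (μ * ω k : ℝ)) * endWeight lam ν (1 / 2 ^ n) (ω k)) *
      (∏ j ∈ Finset.range k, halfWeight (Real.exp (-(ν * (1 / 2 ^ n)))) (ω j) : ℝ) := by
  set h : ℝ := 1 / 2 ^ n with hh
  have hpos : 0 < h := by positivity
  have hle : (k : ℝ) / 2 ^ n ≤ (k + 1) / 2 ^ n := by gcongr; linarith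
  have hprod : ∏ j ∈ Finset.range k, halfWeight (Real.exp (-(ν * h))) (ω j) =
      Real.exp (-(ν * ((∑ j ∈ Finset.range k, halfIndicator (ω j)) / 2 ^ n))) := by
    rw [Finset.sum_div, Finset.mul_sum, ← Finset.sum_neg_distrib, Real.exp_sum]
    refine Finset.prod_congr rfl fun j _ => ?_
    by_cases hj : 0 ≤ ω j
    · simp [halfWeight, halfIndicator, hj, hh]
    · simp [halfWeight, halfIndicator, hj]
  have hσ : 0 < lam + ν * halfIndicator (ω k) := by
    have : 0 ≤ halfIndicator (ω k) := indicator_nonneg (fun _ _ => zero_le_one) _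
    positivity
  have hend : endWeight lam ν h (ω k) =
      (1 - Real.exp (-((lam + ν * halfIndicator (ω k)) * h))) / (lam + ν * halfIndicator (ω k)) := by
    by_cases hj : 0 ≤ ω k
    · simp [endWeight, halfIndicator, hj]
    · simp [endWeight, halfIndicator, hj]
  rw [functionalTerm, hprod, hend, ← integral_exp_neg_mul hσ]
  rw [intervalIntegral.integral_congr_Ioo_of_le (g := fun t => ((Real.exp (-(lam * h)) ^ k : ℝ) *
    Complex.exp (Complex.I * (μ * ω k : ℝ)) *
    (Real.exp (-(ν * ((∑ j ∈ Finset.range k, halfIndicator (ω j)) / 2 ^ n))) : ℝ)) *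
    (fun u : ℝ => Complex.exp (-((lam + ν * halfIndicator (ω k)) * u : ℝ))) (t - k / 2 ^ n)) hle]
  · rw [intervalIntegral.integral_const_mul, intervalIntegral.integral_comp_sub_right
      (fun u : ℝ => Complex.exp (-((lam + ν * halfIndicator (ω k)) * u : ℝ)))]
    have : ((k : ℝ) + 1) / 2 ^ n - k / 2 ^ n = h := by rw [hh]; ring
    rw [this, sub_self]
    ring
  · intro t ht
    simp only [stepPath, floor_of_mem_Ioo ht, stepSojourn_eq ω (Ioo_subset_Icc_self ht),
      ← Real.exp_nat_mul]
    push_cast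
    simp only [← Complex.exp_add]
    congr 1
    rw [hh]
    push_cast
    ring

theorem termExpectation_eq {N : ℕ} {lam μ ν : ℝ} (hl : 0 < lam) (hν : 0 < ν) (n k : ℕ) :
    termExpectation N lam μ ν n k = (Real.exp (-(lam * (1 / 2 ^ n))) ^ k : ℝ) *
      ∫ y : Fin k → ℝ, (fun x => Complex.exp (Complex.I * (μ * x : ℝ)) *
        endWeight lam ν (1 / 2 ^ n) x) (observations y k) *
          (pathWeight N (1 / 2 ^ n) (Real.exp (-(ν * (1 / 2 ^ n)))) k y : ℂ) := by
  rw [termExpectation, tameExpectation, ← integral_const_mul]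
  congr 1
  funext y
  rw [functionalTerm_eq hl hν, pathWeight, Finset.prod_mul_distrib]
  push_cast
  ring

/-! ### The expectation of the step functional -/

theorem partialFourier_isFourierOn {N : ℕ} (hN : 2 ≤ N) (hE : Even N) {S : Set ℝ}
    (hS : MeasurableSet S) {t : ℝ} (ht : 0 < t) : IsFourierOn S (partialFourier N S t) := by
  refine ⟨S.indicator fun x => (kernel N t x : ℂ), (integrable_kernel hN hE ht).ofReal.indicator hS,
    fun x hx => indicator_of_notMem hx _, fun μ => ?_⟩
  rw [partialFourier]
  congr 1
  funext x
  by_cases hx : x ∈ S <;> simp [hx]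

theorem measurable_endWeight (lam ν h : ℝ) : Measurable (endWeight lam ν h) :=
  Measurable.ite measurableSet_Ici measurable_const measurable_const

/-- The value of the functional `∫_0^∞ e^{-λt + iμX_n(t) - νT_n(t)} dt` in terms of the partial
Fourier transforms of the kernel. -/
theorem summable_termExpectation_and_tsum {N : ℕ} (hN : 2 ≤ N) (hE : Even N) {lam ν : ℝ}
    (hl : 0 < lam) (hν : 0 < ν) (μ : ℝ) (n : ℕ) :
    (Summable fun k => ‖termExpectation N lam μ ν n k‖) ∧
    ∑' k, termExpectation N lam μ ν n k = endWeight lam ν (1 / 2 ^ n) 0 +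
      Real.exp (-(ν * (1 / 2 ^ n))) / (1 - Real.exp (-(ν * (1 / 2 ^ n)))) *
      (endWeight lam ν (1 / 2 ^ n) 0 * (1 - Complex.exp (-∑' k : ℕ, (1 / 2 ^ n : ℝ) *
          (((Real.exp (-(lam * ((k + 1) / 2 ^ n))) - Real.exp (-((lam + ν) * ((k + 1) / 2 ^ n)))) /
            ((k + 1) / 2 ^ n) : ℝ) * partialFourier N (Ici 0) ((k + 1) / 2 ^ n) μ))) +
        endWeight lam ν (1 / 2 ^ n) (-1) * (Complex.exp (∑' k : ℕ, (1 / 2 ^ n : ℝ) *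
          (((Real.exp (-(lam * ((k + 1) / 2 ^ n))) - Real.exp (-((lam + ν) * ((k + 1) / 2 ^ n)))) /
            ((k + 1) / 2 ^ n) : ℝ) * partialFourier N (Iio 0) ((k + 1) / 2 ^ n) μ)) - 1)) := by
  set h : ℝ := 1 / 2 ^ n with hh
  have hpos : 0 < h := by positivity
  set w : ℝ := Real.exp (-(ν * h)) with hw
  set z : ℝ := Real.exp (-(lam * h)) with hz
  set a := endWeight lam ν h 0
  set b := endWeight lam ν h (-1)
  have hw0 : 0 < w := Real.exp_pos _
  have hw1 : w < 1 := by rw [hw, Real.exp_lt_one_iff]; have := mul_pos hν hpos; linarith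
  have hz0 : 0 < z := Real.exp_pos _
  have hz1 : z < 1 := by rw [hz, Real.exp_lt_one_iff]; have := mul_pos hl hpos; linarith
  have hwC : (1 - w : ℂ) ≠ 0 := by exact_mod_cast (sub_pos.2 hw1).ne'
  have hq := integrable_weightedDensity hN hE hpos w
  let H : Set ℝ → ℕ → ℝ → ℂ := fun S k μ =>
    ∫ x, Complex.exp (Complex.I * (μ * x : ℝ)) * S.indicator (weightedDensity N h w k) x
  have hHS : ∀ {S : Set ℝ}, MeasurableSet S → ∀ k, IsFourierOn S (H S k) := fun hS k =>
    ⟨_, (hq k).indicator hS, fun x hx => indicator_of_notMem hx _, fun μ => rfl⟩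
  have hHadd : ∀ k μ, H (Ici 0) k μ + H (Iio 0) k μ =
      ∫ x, Complex.exp (Complex.I * (μ * x : ℝ)) * weightedDensity N h w k x := by
    intro k μ
    rw [← integral_add (integrable_exp_mul ((hq k).indicator measurableSet_Ici) μ)
      (integrable_exp_mul ((hq k).indicator measurableSet_Iio) μ)]
    congr 1
    funext x
    rw [← mul_add, ← compl_Ici, indicator_self_add_compl_apply]
  have hHw : ∀ (u v : ℂ) (c : ℝ → ℂ) k μ, (∀ x, 0 ≤ x → c x = u) → (∀ x, x < 0 → c x = v) →
      ∫ x, Complex.exp (Complex.I * (μ * x : ℝ)) * (c x * weightedDensity N h w k x) =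
        u * H (Ici 0) k μ + v * H (Iio 0) k μ := by
    intro u v c k μ hu hv
    rw [← integral_const_mul, ← integral_const_mul, ← integral_add
      ((integrable_exp_mul ((hq k).indicator measurableSet_Ici) μ).const_mul _)
      ((integrable_exp_mul ((hq k).indicator measurableSet_Iio) μ).const_mul _)]
    congr 1
    funext x
    rcases le_or_gt 0 x with hx | hx
    · have h1 : x ∈ Ici (0 : ℝ) := hx
      have h2 : x ∉ Iio (0 : ℝ) := not_lt.2 hx
      rw [indicator_of_mem h1, indicator_of_notMem h2, hu x hx]; ring
    · have h1 : x ∉ Ici (0 : ℝ) := not_le.2 hx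
      have h2 : x ∈ Iio (0 : ℝ) := hx
      rw [indicator_of_notMem h1, indicator_of_mem h2, hv x hx]; ring
  have hk1 : ∀ k : ℕ, (0 : ℝ) < (k + 1) * h := fun k => by positivity
  have hf1 : ∀ μ, ∫ x, Complex.exp (Complex.I * (μ * x : ℝ)) * (kernel N h x : ℂ) =
      Real.exp (-(h * μ ^ N)) := fun μ => by
    rw [← partialFourier_univ hN hE hpos, partialFourier]
    simp
  let U : ℕ → ℝ → ℂ := fun k => Nat.casesOn k 1 fun k => fun μ => -(1 - w) * H (Ici 0) k μ
  let V : ℕ → ℝ → ℂ := fun k => Nat.casesOn k 1 fun k => fun μ => (1 - w) * H (Iio 0) k μ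
  -- The symbol of one step satisfies `f^{k+1} = e^{-(k+1)hμ^N}`, so the parts of its powers are the
  -- half-line transforms of `p((k+1)h;·)`.
  have hspitzer := spitzer_identity (w := w) (f := fun μ => Real.exp (-(h * μ ^ N)))
    (fp := fun k => partialFourier N (Ici 0) ((k + 1) * h))
    (fm := fun k => partialFourier N (Iio 0) ((k + 1) * h))
    (hHS measurableSet_Ici) (hHS measurableSet_Iio)
    (fun k => partialFourier_isFourierOn hN hE measurableSet_Ici (hk1 k))
    (fun k => partialFourier_isFourierOn hN hE measurableSet_Iio (hk1 k))
    (by funext μ; rw [Pi.add_apply, hHadd, ← hf1]; rfl)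
    (fun k => by
      funext μ
      have h1 := hHw w 1 (fun x => halfWeight w x) k μ (fun x hx => by simp [halfWeight, hx])
        (fun x hx => by simp [halfWeight, not_le.2 hx])
      rw [Pi.add_apply, hHadd, Pi.mul_apply, ← hf1, weightedDensity]
      have h2 : Integrable fun x => (kernel N h x : ℂ) := (integrable_kernel hN hE hpos).ofReal
      refine (fourier_convolution (integrable_halfWeight_mul (w := w) (hq k)) h2 μ).trans ?_
      rw [h1]
      ring)
    (fun k => by
      funext μ
      rw [Pi.add_apply, partialFourier_Ici_add_Iio hN hE (hk1 k), Pi.pow_apply, ← Complex.ofReal_pow,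
        ← Real.exp_nat_mul]
      congr 2
      push_cast
      ring)
    (U := U) (V := V) rfl rfl (fun k => rfl) (fun k => rfl)
  have hC : 0 < kernelNorm N + 1 := by linarith [kernelNorm_nonneg N]
  have hwb : ∀ k : ℕ, ‖((w : ℂ) ^ (k + 1) - 1)‖ ≤ 1 := fun k => by
    rw [← Complex.ofReal_pow, ← Complex.ofReal_one, ← Complex.ofReal_sub, Complex.norm_real,
      Real.norm_eq_abs, abs_le]
    have h1 := pow_le_one₀ (n := k + 1) hw0.le hw1.le
    have h2 := pow_pos hw0 (k + 1)
    constructor <;> linarith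
  have hub : ∀ (S : Set ℝ) (k : ℕ), ‖((w : ℂ) ^ (k + 1) - 1) * partialFourier N S ((k + 1) * h) μ‖ ≤
      kernelNorm N + 1 := fun S k => by
    rw [norm_mul]
    have h1 := norm_partialFourier_le hN hE S (hk1 k) μ
    have h2 := kernelNorm_nonneg N
    calc _ ≤ 1 * kernelNorm N := mul_le_mul (hwb k) h1 (norm_nonneg _) zero_le_one
      _ ≤ _ := by linarith
  obtain ⟨hUs, hUt⟩ := summable_and_tsum_eq_exp hC (hub (Ici 0)) (U := fun k => U k μ) rfl
    (fun k => (hspitzer k μ).1) hz0.le hz1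
  obtain ⟨hVs, hVt⟩ := summable_and_tsum_eq_exp hC (fun k => by rw [norm_neg]; exact hub (Iio 0) k)
    (U := fun k => V k μ) rfl (fun k => (hspitzer k μ).2) hz0.le hz1
  have hUs' : Summable fun k => U k μ * (z : ℂ) ^ k :=
    Summable.of_norm (by simpa [abs_of_pos hz0] using hUs)
  have hVs' : Summable fun k => V k μ * (z : ℂ) ^ k :=
    Summable.of_norm (by simpa [abs_of_pos hz0] using hVs)
  -- The points `0` and `-1` stand for the two half lines, on each of which the end weight is
  -- constant.
  have hend : ∀ x, endWeight lam ν h x = if 0 ≤ x then a else b := fun x => by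
    have h1 : ¬ (0 : ℝ) ≤ -1 := by norm_num
    simp only [a, b, endWeight, le_refl, if_true, if_neg h1]
  have ht0 : termExpectation N lam μ ν n 0 = a := by
    rw [termExpectation_eq hl hν, integral_pathWeight_zero N _ _ fun x =>
      Complex.exp (Complex.I * (μ * x : ℝ)) * endWeight lam ν (1 / 2 ^ n) x]
    simp [a, hh]
  -- The numerator `w` is the weight of the starting point; the division by `1 - w`, and the sign of
  -- `a`, recover `H^±` from `U` and `V`.
  have htk : ∀ k, termExpectation N lam μ ν n (k + 1) =
      w / (1 - w) * (-a * (U (k + 1) μ * z ^ (k + 1)) + b * (V (k + 1) μ * z ^ (k + 1))) := by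
    intro k
    have h1 := hHw a b (fun x => endWeight lam ν h x) k μ (fun x hx => by simp [hend, hx])
      (fun x hx => by simp [hend, not_le.2 hx])
    rw [termExpectation_eq hl hν, ← hh, ← hw, ← hz, integral_pathWeight_eq hN hE hpos k
      (φ := fun x => Complex.exp (Complex.I * (μ * x : ℝ)) * endWeight lam ν h x) (C := max |a| |b|)]
    · simp only [mul_assoc] at h1 ⊢
      rw [h1]
      simp only [U, V]
      push_cast
      field_simp
    · exact Measurable.mul (by fun_prop)
        (Complex.measurable_ofReal.comp (measurable_endWeight lam ν h))
    · intro x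
      rw [norm_mul, norm_exp_I_mul, one_mul, Complex.norm_real, hend]
      split_ifs
      · exact le_max_left _ _
      · exact le_max_right _ _
  have hsummable : Summable fun k => ‖termExpectation N lam μ ν n k‖ := by
    rw [← summable_nat_add_iff 1]
    simp only [htk]
    have h1 := (summable_nat_add_iff (f := fun k => ‖U k μ * (z : ℂ) ^ k‖) 1).2 hUs'.norm
    have h2 := (summable_nat_add_iff (f := fun k => ‖V k μ * (z : ℂ) ^ k‖) 1).2 hVs'.norm
    refine Summable.of_nonneg_of_le (fun k => norm_nonneg _) (fun k => ?_)
      (((h1.mul_left ‖(-a : ℂ)‖).add (h2.mul_left ‖(b : ℂ)‖)).mul_left ‖(w / (1 - w) : ℂ)‖)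
    rw [norm_mul]
    refine mul_le_mul_of_nonneg_left ((norm_add_le _ _).trans (le_of_eq ?_)) (norm_nonneg _)
    rw [norm_mul, norm_mul (b : ℂ)]
  refine ⟨hsummable, ?_⟩
  rw [hsummable.of_norm.tsum_eq_zero_add, ht0]
  simp only [htk]
  have h1 := (summable_nat_add_iff (f := fun k => U k μ * (z : ℂ) ^ k) 1).2 hUs'
  have h2 := (summable_nat_add_iff (f := fun k => V k μ * (z : ℂ) ^ k) 1).2 hVs'
  rw [tsum_mul_left, (h1.mul_left _).tsum_add (h2.mul_left _), tsum_mul_left, tsum_mul_left]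
  have e1 : ∑' k, U (k + 1) μ * (z : ℂ) ^ (k + 1) = ∑' k, U k μ * (z : ℂ) ^ k - 1 := by
    rw [hUs'.tsum_eq_zero_add]; simp [U]
  have e2 : ∑' k, V (k + 1) μ * (z : ℂ) ^ (k + 1) = ∑' k, V k μ * (z : ℂ) ^ k - 1 := by
    rw [hVs'.tsum_eq_zero_add]; simp [V]
  rw [e1, e2, hUt, hVt]
  -- With `t = (k+1)h`, the coefficient `(w^{k+1} - 1) z^{k+1}/(k+1)` is `-h (e^{-λt} -
  -- e^{-(λ+ν)t})/t`: a term of a Riemann sum.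
  have hterm : ∀ (S : Set ℝ) (k : ℕ), ((w : ℂ) ^ (k + 1) - 1) * partialFourier N S ((k + 1) * h) μ /
      (k + 1) * (z : ℂ) ^ (k + 1) = -((h : ℝ) *
          (((Real.exp (-(lam * ((k + 1) / 2 ^ n))) - Real.exp (-((lam + ν) * ((k + 1) / 2 ^ n)))) /
            ((k + 1) / 2 ^ n) : ℝ) * partialFourier N S ((k + 1) / 2 ^ n) μ)) := by
    intro S k
    have h3 : ((k : ℝ) + 1) / 2 ^ n = (k + 1) * h := by rw [hh]; ring
    have h4 : Real.exp (-(lam * ((k + 1) * h))) = z ^ (k + 1) := by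
      rw [hz, ← Real.exp_nat_mul]; congr 1; push_cast; ring
    have h5 : Real.exp (-((lam + ν) * ((k + 1) * h))) = z ^ (k + 1) * w ^ (k + 1) := by
      rw [hz, hw, ← Real.exp_nat_mul, ← Real.exp_nat_mul, ← Real.exp_add]; congr 1; push_cast; ring
    have h6 : ((k : ℂ) + 1) ≠ 0 := Nat.cast_add_one_ne_zero k
    have h7 : (h : ℂ) ≠ 0 := by exact_mod_cast hpos.ne'
    rw [h3, h4, h5]
    push_cast
    field_simp
    ring
  simp only [neg_mul, neg_div, hterm, neg_neg, tsum_neg]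
  ring

/-! ### Riemann sums on the half line -/

/-- The sum is the integral of a step function that samples at right endpoints. Sampling to the
right of `t` preserves the decreasing bound `C e^{-λt}` and avoids the origin, so dominated
convergence applies. -/
theorem tendsto_riemannSum {Φ : ℝ → ℂ} (hΦ : ContinuousOn Φ (Ioi 0)) {C lam : ℝ} (hl : 0 < lam)
    (hb : ∀ t, 0 < t → ‖Φ t‖ ≤ C * Real.exp (-(lam * t))) :
    Tendsto (fun n : ℕ => ∑' k : ℕ, (1 / 2 ^ n : ℝ) * Φ ((k + 1) / 2 ^ n)) atTop
      (𝓝 (∫ t in Ioi (0 : ℝ), Φ t)) := by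
  have hC : 0 ≤ C := by
    have := (norm_nonneg _).trans (hb 1 one_pos)
    exact nonneg_of_mul_nonneg_left this (Real.exp_pos _)
  let g : ℕ → ℝ → ℂ := fun n t => Φ ((⌊2 ^ n * t⌋₊ + 1) / 2 ^ n)
  have hgm : ∀ n, Measurable (g n) := fun n =>
    (measurable_from_nat (f := fun k : ℕ => Φ ((k + 1) / 2 ^ n))).comp
      (Nat.measurable_floor.comp (measurable_id.const_mul _))
  have hgb : ∀ n, ∀ t ∈ Ioi (0 : ℝ), ‖g n t‖ ≤ C * Real.exp (-(lam * t)) := by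
    intro n t ht
    refine (hb _ (by positivity)).trans ?_
    have : t ≤ (⌊2 ^ n * t⌋₊ + 1) / 2 ^ n := by
      rw [le_div_iff₀ (by positivity), mul_comm]
      exact (Nat.lt_floor_add_one _).le
    gcongr
  have hbi : IntegrableOn (fun t => C * Real.exp (-(lam * t))) (Ioi 0) := by
    have h1 : IntegrableOn (fun t => C * Real.exp (-lam * t)) (Ioi 0) :=
      (exp_neg_integrableOn_Ioi 0 hl).const_mul C
    simpa only [neg_mul] using h1
  have hgi : ∀ n, IntegrableOn (g n) (Ioi 0) := fun n =>
    hbi.mono' (hgm n).aestronglyMeasurable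
      ((ae_restrict_iff' measurableSet_Ioi).2 (Eventually.of_forall (hgb n)))
  have hsum : ∀ n : ℕ, ∑' k : ℕ, (1 / 2 ^ n : ℝ) * Φ ((k + 1) / 2 ^ n) =
      ∫ t in Ioi (0 : ℝ), g n t := by
    intro n
    have h2 : (0 : ℝ) < 2 ^ n := by positivity
    have hpart : ∀ K : ℕ, ∫ t in (0 : ℝ)..(K / 2 ^ n), g n t =
        ∑ k ∈ Finset.range K, (1 / 2 ^ n : ℝ) * Φ ((k + 1) / 2 ^ n) := by
      intro K
      have hint : ∀ k : ℕ, IntervalIntegrable (g n) volume (k / 2 ^ n) ((k + 1 : ℕ) / 2 ^ n) := by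
        intro k
        rw [intervalIntegrable_iff_integrableOn_Ioc_of_le (by gcongr; omega)]
        refine (hgi n).mono_set fun t ht => ?_
        exact (by positivity : (0 : ℝ) ≤ k / 2 ^ n).trans_lt ht.1
      have := intervalIntegral.sum_integral_adjacent_intervals (n := K) (fun k _ => hint k)
      simp only [Nat.cast_zero, zero_div] at this
      rw [← this]
      refine Finset.sum_congr rfl fun k _ => ?_
      rw [intervalIntegral.integral_congr_Ioo_of_le (g := fun _ => Φ ((k + 1) / 2 ^ n))
        (by gcongr; omega)]
      · rw [intervalIntegral.integral_const, Complex.real_smul]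
        congr 2
        push_cast
        ring
      · intro t ht
        simp only [g]
        rw [floor_of_mem_Ioo (j := k) (by simpa using ht)]
    have hlim := intervalIntegral_tendsto_integral_Ioi 0 (hgi n)
      ((tendsto_natCast_atTop_atTop (R := ℝ)).atTop_div_const h2)
    simp only [hpart] at hlim
    have hS : Summable fun k : ℕ => (1 / 2 ^ n : ℝ) * Φ ((k + 1) / 2 ^ n) := by
      have hgeo : Summable fun k : ℕ => Real.exp (-(lam / 2 ^ n)) ^ k :=
        summable_geometric_of_lt_one (Real.exp_pos _).le
          (Real.exp_lt_one_iff.2 (neg_neg_of_pos (by positivity)))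
      refine Summable.of_norm_bounded (hgeo.mul_left (1 / 2 ^ n * C)) fun k => ?_
      rw [norm_mul, Complex.norm_real, Real.norm_of_nonneg (by positivity), mul_assoc]
      refine mul_le_mul_of_nonneg_left ((hb _ (by positivity)).trans ?_) (by positivity)
      rw [← Real.exp_nat_mul]
      refine mul_le_mul_of_nonneg_left (Real.exp_le_exp.2 ?_) hC
      rw [mul_neg, neg_le_neg_iff, mul_div_assoc', mul_div_assoc']
      exact div_le_div_of_nonneg_right (by nlinarith) h2.le
    exact tendsto_nhds_unique hS.hasSum.tendsto_sum_nat hlim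
  simp only [hsum]
  refine tendsto_integral_of_dominated_convergence _ (fun n => (hgm n).aestronglyMeasurable) hbi
    (fun n => (ae_restrict_iff' measurableSet_Ioi).2 (Eventually.of_forall (hgb n)))
    ((ae_restrict_iff' measurableSet_Ioi).2 (Eventually.of_forall fun t ht => ?_))
  have ht0 : 0 < t := ht
  have hpow : Tendsto (fun n : ℕ => (2 : ℝ) ^ n) atTop atTop :=
    tendsto_pow_atTop_atTop_of_one_lt one_lt_two
  have h1 : Tendsto (fun n : ℕ => ((⌊2 ^ n * t⌋₊ + 1 : ℝ)) / 2 ^ n) atTop (𝓝 t) := by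
    have h3 := ((tendsto_nat_floor_mul_div_atTop ht0.le).comp hpow).add
      (tendsto_inv_atTop_zero.comp hpow)
    rw [add_zero] at h3
    refine h3.congr fun n => ?_
    simp only [Function.comp_apply]
    rw [mul_comm t, add_div, one_div]
  exact (hΦ.continuousAt (Ioi_mem_nhds ht0)).tendsto.comp h1

/-! ### The weight `(e^{-λt} - e^{-σt}) / t` -/

/-- `(e^{-λt} - e^{-σt}) / t`. -/
noncomputable def frullani (lam σ t : ℝ) : ℝ :=
  (Real.exp (-(lam * t)) - Real.exp (-(σ * t))) / t

theorem frullani_comm (lam σ t : ℝ) : frullani lam σ t = -frullani σ lam t := by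
  unfold frullani; ring

/-- From `1 - e^{-u} ≤ u`; in particular the singularity at `t = 0` is removable. -/
theorem abs_frullani_le (lam σ : ℝ) {t : ℝ} (ht : 0 < t) :
    |frullani lam σ t| ≤ |σ - lam| * Real.exp (-(min lam σ * t)) := by
  wlog h : lam ≤ σ generalizing lam σ
  · rw [frullani_comm, abs_neg, abs_sub_comm, min_comm]
    exact this σ lam (not_le.1 h).le
  rw [min_eq_left h, abs_of_nonneg (sub_nonneg.2 h), frullani, abs_div, abs_of_pos ht,
    div_le_iff₀ ht, abs_of_nonneg (sub_nonneg.2 (Real.exp_le_exp.2 (by nlinarith)))]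
  have h1 : Real.exp (-(σ * t)) = Real.exp (-(lam * t)) * Real.exp (-((σ - lam) * t)) := by
    rw [← Real.exp_add]; ring_nf
  have h2 := Real.add_one_le_exp (-((σ - lam) * t))
  have h3 := Real.exp_pos (-(lam * t))
  rw [h1]
  nlinarith

theorem continuousOn_frullani (lam σ : ℝ) : ContinuousOn (frullani lam σ) (Ioi 0) := by
  unfold frullani
  exact ContinuousOn.div (by fun_prop) continuousOn_id fun t ht => ne_of_gt ht

/-- `∫_0^∞ (e^{-λt} - e^{-σt}) t⁻¹ ψ_S(t) dt` for `ψ_S(t) = ∫_S e^{iμx} p(t;x) dx`. -/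
noncomputable def frullaniIntegral (N : ℕ) (S : Set ℝ) (μ lam σ : ℝ) : ℂ :=
  ∫ t in Ioi (0 : ℝ), (frullani lam σ t : ℂ) * partialFourier N S t μ

theorem norm_frullani_mul_partialFourier_le {N : ℕ} (hN : 2 ≤ N) (hE : Even N) (S : Set ℝ) (μ : ℝ)
    (lam σ : ℝ) {t : ℝ} (ht : 0 < t) : ‖(frullani lam σ t : ℂ) * partialFourier N S t μ‖ ≤
      |σ - lam| * kernelNorm N * Real.exp (-(min lam σ * t)) := by
  rw [norm_mul, Complex.norm_real, mul_right_comm]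
  exact mul_le_mul (abs_frullani_le lam σ ht) (norm_partialFourier_le hN hE S ht μ) (norm_nonneg _)
    (by positivity)

theorem tendsto_mul_one_sub_exp (σ : ℝ) :
    Tendsto (fun n : ℕ => (1 - Real.exp (-(σ * (1 / 2 ^ n)))) / (1 / 2 ^ n)) atTop (𝓝 σ) := by
  have h1 : HasDerivAt (fun u : ℝ => -Real.exp (-(σ * u))) σ 0 := by
    have h0 : HasDerivAt (fun u : ℝ => -(σ * u)) (-(σ * 1)) 0 :=
      ((hasDerivAt_id (0 : ℝ)).const_mul σ).neg
    have h1 : HasDerivAt (fun u : ℝ => -Real.exp (-(σ * u)))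
      (-(Real.exp (-(σ * 0)) * -(σ * 1))) 0 := h0.exp.neg
    exact h1.congr_deriv (by simp)
  have h2 : Tendsto (fun n : ℕ => (1 / 2 ^ n : ℝ)) atTop (𝓝[≠] 0) := by
    refine tendsto_nhdsWithin_of_tendsto_nhds_of_eventually_within _ ?_
      (Eventually.of_forall fun n => by simp)
    simpa using tendsto_pow_atTop_nhds_zero_of_lt_one (r := (1 / 2 : ℝ)) (by norm_num) (by norm_num)
  refine (h1.tendsto_slope_zero.comp h2).congr fun n => ?_
  simp only [Function.comp_apply, zero_add, mul_zero, neg_zero, Real.exp_zero, smul_eq_mul]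
  ring

theorem tendsto_tsum_termExpectation {N : ℕ} (hN : 2 ≤ N) (hE : Even N) {lam ν : ℝ}
    (hl : 0 < lam) (hν : 0 < ν) (μ : ℝ) :
    Tendsto (fun n => ∑' k, termExpectation N lam μ ν n k) atTop
      (𝓝 ((ν : ℂ)⁻¹ * (Complex.exp (frullaniIntegral N (Iio 0) μ lam (lam + ν)) -
        Complex.exp (-frullaniIntegral N (Ici 0) μ lam (lam + ν))))) := by
  have hR : ∀ {S : Set ℝ}, MeasurableSet S → (∀ c x : ℝ, 0 < c → (x * c ∈ S ↔ x ∈ S)) →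
      Tendsto (fun n : ℕ => ∑' k : ℕ, (1 / 2 ^ n : ℝ) *
        ((frullani lam (lam + ν) ((k + 1) / 2 ^ n) : ℂ) * partialFourier N S ((k + 1) / 2 ^ n) μ))
        atTop (𝓝 (frullaniIntegral N S μ lam (lam + ν))) := by
    intro S hS hSc
    refine tendsto_riemannSum (Φ := fun t => (frullani lam (lam + ν) t : ℂ) * partialFourier N S t μ)
      (C := |lam + ν - lam| * kernelNorm N) ?_ hl fun t ht => ?_
    · exact (Complex.continuous_ofReal.comp_continuousOn (continuousOn_frullani _ _)).mul
        (continuousOn_partialFourier hN hE hS hSc μ)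
    · have := norm_frullani_mul_partialFourier_le hN hE S μ lam (lam + ν) ht
      rwa [min_eq_left (by linarith)] at this
  have hp := hR measurableSet_Ici mul_mem_Ici_iff
  have hm := hR measurableSet_Iio mul_mem_Iio_iff
  have hσ : 0 < lam + ν := by positivity
  have hh0 : Tendsto (fun n : ℕ => (1 / 2 ^ n : ℝ)) atTop (𝓝 0) := by
    simpa using tendsto_pow_atTop_nhds_zero_of_lt_one (r := (1 / 2 : ℝ)) (by norm_num) (by norm_num)
  have hexp : ∀ σ : ℝ, Tendsto (fun n : ℕ => Real.exp (-(σ * (1 / 2 ^ n)))) atTop (𝓝 1) := by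
    intro σ
    have := (Real.continuous_exp.tendsto 0).comp ((hh0.const_mul σ).neg.trans (by simp))
    rw [Real.exp_zero] at this
    exact this
  have ha0 : Tendsto (fun n : ℕ => endWeight lam ν (1 / 2 ^ n) 0) atTop (𝓝 0) := by
    have := ((hexp (lam + ν)).const_sub 1).div_const (lam + ν)
    simpa [endWeight] using this
  -- An end weight is asymptotic to `h` and `w/(1-w)` to `1/(νh)`, so both products tend to `1/ν`,
  -- whereas the isolated `k = 0` term tends to `0`.
  have hr : ∀ σ : ℝ, 0 < σ → Tendsto (fun n : ℕ => Real.exp (-(ν * (1 / 2 ^ n))) /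
      (1 - Real.exp (-(ν * (1 / 2 ^ n)))) * ((1 - Real.exp (-(σ * (1 / 2 ^ n)))) / σ)) atTop
      (𝓝 ν⁻¹) := by
    intro σ hσ
    have := ((hexp ν).div (tendsto_mul_one_sub_exp ν) hν.ne').mul
      ((tendsto_mul_one_sub_exp σ).div_const σ)
    rw [div_self hσ.ne', mul_one, one_div] at this
    refine this.congr fun n => ?_
    have h2 : (2 : ℝ) ^ n ≠ 0 := by positivity
    have h3 : 1 - Real.exp (-(ν * (1 / 2 ^ n))) ≠ 0 := by
      have : 0 < ν * (1 / 2 ^ n) := by positivity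
      have : Real.exp (-(ν * (1 / 2 ^ n))) < 1 := Real.exp_lt_one_iff.2 (by linarith)
      linarith
    simp only [Pi.div_apply]
    field_simp
  have h1 := (Complex.continuous_ofReal.tendsto _).comp ha0
  have h2 := (Complex.continuous_ofReal.tendsto _).comp (hr (lam + ν) hσ)
  have h3 := (Complex.continuous_ofReal.tendsto _).comp (hr lam hl)
  have key := h1.add ((h2.mul ((hp.neg.cexp).const_sub 1)).add (h3.mul (hm.cexp.sub_const 1)))
  have hlim : ((0 : ℝ) : ℂ) + (((ν⁻¹ : ℝ) : ℂ) *
      (1 - Complex.exp (-frullaniIntegral N (Ici 0) μ lam (lam + ν))) + ((ν⁻¹ : ℝ) : ℂ) *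
      (Complex.exp (frullaniIntegral N (Iio 0) μ lam (lam + ν)) - 1)) =
      (ν : ℂ)⁻¹ * (Complex.exp (frullaniIntegral N (Iio 0) μ lam (lam + ν)) -
        Complex.exp (-frullaniIntegral N (Ici 0) μ lam (lam + ν))) := by
    push_cast; ring
  rw [hlim] at key
  refine key.congr fun n => ?_
  rw [(summable_termExpectation_and_tsum hN hE hl hν μ n).2]
  simp only [Function.comp_apply, endWeight, le_refl, if_true, frullani,
    if_neg (by norm_num : ¬ (0 : ℝ) ≤ -1)]
  push_cast
  ring

/-! ### Laplace transforms of the partial Fourier transforms -/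

theorem IsFourierOn.congr {S : Set ℝ} {F G : ℝ → ℂ} (hF : IsFourierOn S F) (h : ∀ μ, F μ = G μ) :
    IsFourierOn S G :=
  funext h ▸ hF

theorem isFourierOn_inv_sub {a : ℂ} (ha : 0 < a.re) :
    IsFourierOn (Ici 0) fun μ => (a - Complex.I * μ)⁻¹ := by
  refine ⟨(Ici (0 : ℝ)).indicator fun x => Complex.exp (-a * x), ?_,
    fun x hx => indicator_of_notMem hx _, fun μ => ?_⟩
  · rw [integrable_indicator_iff measurableSet_Ici, integrableOn_Ici_iff_integrableOn_Ioi]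
    exact integrableOn_exp_mul_complex_Ioi (by simpa using ha) 0
  · have h1 : ∀ x : ℝ, Complex.exp (Complex.I * (μ * x : ℝ)) *
        (Ici (0 : ℝ)).indicator (fun x : ℝ => Complex.exp (-a * x)) x =
        (Ici (0 : ℝ)).indicator (fun x : ℝ => Complex.exp ((-a + Complex.I * μ) * x)) x := fun x => by
      by_cases hx : x ∈ Ici (0 : ℝ)
      · rw [indicator_of_mem hx, indicator_of_mem hx, ← Complex.exp_add]
        congr 1; push_cast; ring
      · rw [indicator_of_notMem hx, indicator_of_notMem hx, mul_zero]
    simp only [h1]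
    rw [integral_indicator measurableSet_Ici, integral_Ici_eq_integral_Ioi,
      integral_exp_mul_complex_Ioi (by simpa using ha)]
    rw [Complex.ofReal_zero, mul_zero, Complex.exp_zero, neg_div, ← div_neg, one_div]
    congr 1
    ring

theorem isFourierOn_inv_add {a : ℂ} (ha : 0 < a.re) :
    IsFourierOn (Iio 0) fun μ => (a + Complex.I * μ)⁻¹ := by
  refine ⟨(Iio (0 : ℝ)).indicator fun x => Complex.exp (a * x), ?_,
    fun x hx => indicator_of_notMem hx _, fun μ => ?_⟩
  · rw [integrable_indicator_iff measurableSet_Iio, ← integrableOn_Iic_iff_integrableOn_Iio]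
    exact integrableOn_exp_mul_complex_Iic ha 0
  · have h1 : ∀ x : ℝ, Complex.exp (Complex.I * (μ * x : ℝ)) *
        (Iio (0 : ℝ)).indicator (fun x : ℝ => Complex.exp (a * x)) x =
        (Iio (0 : ℝ)).indicator (fun x : ℝ => Complex.exp ((a + Complex.I * μ) * x)) x := fun x => by
      by_cases hx : x ∈ Iio (0 : ℝ)
      · rw [indicator_of_mem hx, indicator_of_mem hx, ← Complex.exp_add]
        congr 1; push_cast; ring
      · rw [indicator_of_notMem hx, indicator_of_notMem hx, mul_zero]
    simp only [h1]
    rw [integral_indicator measurableSet_Iio, ← integral_Iic_eq_integral_Iio,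
      integral_exp_mul_complex_Iic (by simpa using ha)]
    simp

/-- `∫_0^∞ e^{-σt} ψ_S(t) dt` for `ψ_S(t) = ∫_S e^{iμx} p(t;x) dx`. -/
noncomputable def laplacePartialFourier (N : ℕ) (S : Set ℝ) (σ μ : ℝ) : ℂ :=
  ∫ t in Ioi (0 : ℝ), (Real.exp (-(σ * t)) : ℂ) * partialFourier N S t μ

theorem integrableOn_exp_neg_mul {σ : ℝ} (hσ : 0 < σ) :
    IntegrableOn (fun t => Real.exp (-(σ * t))) (Ioi 0) := by
  simpa only [neg_mul] using exp_neg_integrableOn_Ioi 0 hσ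

theorem integrable_laplacePartialFourier {N : ℕ} (hN : 2 ≤ N) (hE : Even N) {S : Set ℝ}
    (hSm : MeasurableSet S) (hS : ∀ c x : ℝ, 0 < c → (x * c ∈ S ↔ x ∈ S)) {σ : ℝ} (hσ : 0 < σ)
    (μ : ℝ) :
    IntegrableOn (fun t => (Real.exp (-(σ * t)) : ℂ) * partialFourier N S t μ) (Ioi 0) := by
  refine ((integrableOn_exp_neg_mul hσ).mul_const (kernelNorm N)).mono' ?_
    ((ae_restrict_iff' measurableSet_Ioi).2 (Eventually.of_forall fun t ht => ?_))
  · exact ((Continuous.continuousOn (by fun_prop)).mul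
      (continuousOn_partialFourier hN hE hSm hS μ)).aestronglyMeasurable measurableSet_Ioi
  · rw [norm_mul, Complex.norm_real, Real.norm_of_nonneg (Real.exp_pos _).le]
    exact mul_le_mul_of_nonneg_left (norm_partialFourier_le hN hE S ht μ) (Real.exp_pos _).le

theorem isFourierOn_laplacePartialFourier {N : ℕ} (hN : 2 ≤ N) (hE : Even N) {S : Set ℝ}
    (hSm : MeasurableSet S) {σ : ℝ} (hσ : 0 < σ) :
    IsFourierOn S (laplacePartialFourier N S σ) := by
  have hm : Measurable fun q : ℝ × ℝ =>
      (Real.exp (-(σ * q.1)) : ℂ) * S.indicator (fun x => (kernel N q.1 x : ℂ)) q.2 := by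
    have h1 : Measurable fun q : ℝ × ℝ => S.indicator (fun x => (kernel N q.1 x : ℂ)) q.2 := by
      have : (fun q : ℝ × ℝ => S.indicator (fun x => (kernel N q.1 x : ℂ)) q.2) =
          (Prod.snd ⁻¹' S).indicator fun q => (kernel N q.1 q.2 : ℂ) := by
        funext q
        rfl
      rw [this]
      exact (Complex.measurable_ofReal.comp (measurable_kernel N)).indicator (measurable_snd hSm)
    exact Measurable.mul (by fun_prop) h1
  have hI : Integrable (fun q : ℝ × ℝ =>
      (Real.exp (-(σ * q.1)) : ℂ) * S.indicator (fun x => (kernel N q.1 x : ℂ)) q.2)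
      ((volume.restrict (Ioi 0)).prod volume) := by
    rw [integrable_prod_iff hm.aestronglyMeasurable]
    constructor
    · refine (ae_restrict_iff' measurableSet_Ioi).2 (Eventually.of_forall fun t ht => ?_)
      have h1 : Integrable fun x => (kernel N t x : ℂ) := (integrable_kernel hN hE ht).ofReal
      exact (h1.indicator hSm).const_mul (Real.exp (-(σ * t)) : ℂ)
    · refine ((integrableOn_exp_neg_mul hσ).mul_const (kernelNorm N)).mono'
        hm.aestronglyMeasurable.norm.integral_prod_right'
        ((ae_restrict_iff' measurableSet_Ioi).2 (Eventually.of_forall fun t ht => ?_))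
      rw [Real.norm_of_nonneg (integral_nonneg fun _ => norm_nonneg _),
        ← integral_abs_kernel hN hE ht, ← integral_const_mul]
      refine integral_mono_of_nonneg (Eventually.of_forall fun _ => norm_nonneg _)
        ((integrable_kernel hN hE ht).abs.const_mul _) (Eventually.of_forall fun x => ?_)
      simp only [norm_mul, Complex.norm_real, Real.norm_of_nonneg (Real.exp_pos _).le]
      refine mul_le_mul_of_nonneg_left ?_ (Real.exp_pos _).le
      refine (norm_indicator_le_norm_self _ _).trans ?_
      rw [Complex.norm_real, Real.norm_eq_abs]
  refine ⟨fun x => ∫ t in Ioi (0 : ℝ),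
    (Real.exp (-(σ * t)) : ℂ) * S.indicator (fun x => (kernel N t x : ℂ)) x, hI.integral_prod_right,
    fun x hx => by simp [hx], fun μ => ?_⟩
  have hI2 : Integrable (Function.uncurry fun t x : ℝ => Complex.exp (Complex.I * (μ * x : ℝ)) *
      ((Real.exp (-(σ * t)) : ℂ) * S.indicator (fun x => (kernel N t x : ℂ)) x))
      ((volume.restrict (Ioi 0)).prod volume) :=
    hI.bdd_mul (f := fun q : ℝ × ℝ => Complex.exp (Complex.I * (μ * q.2 : ℝ))) (c := 1)
      (by fun_prop) (Eventually.of_forall fun x => (norm_exp_I_mul _).le)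
  simp only [← integral_const_mul]
  rw [← integral_integral_swap hI2, laplacePartialFourier]
  congr 1
  funext t
  rw [partialFourier, ← integral_const_mul]
  congr 1
  funext x
  by_cases hx : x ∈ S
  · simp only [indicator_of_mem hx]; ring
  · simp only [indicator_of_notMem hx, mul_zero]

theorem sub_I_mul_ne_zero {N : ℕ} (hE : Even N) {y : ℝ} (hy : 0 < y) (μ : ℝ) {θ : ℂ}
    (hθ : θ ^ N = kappa N) : (y - Complex.I * μ * θ : ℂ) ≠ 0 := fun h => by
  have h1 : (y : ℂ) ^ N = -(μ : ℂ) ^ N := by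
    rw [sub_eq_zero.1 h, mul_pow, hθ, mul_comm, kappa_mul_I_mul_pow hE]
  have h2 : y ^ N = -μ ^ N := by exact_mod_cast h1
  have h3 := hE.pow_nonneg μ
  have h4 := pow_pos hy N
  linarith

theorem rpow_one_div_natCast_pow {N : ℕ} (hN : 2 ≤ N) {σ : ℝ} (hσ : 0 < σ) :
    (σ ^ (1 / (N : ℝ))) ^ N = σ := by
  rw [one_div]; exact Real.rpow_inv_natCast_pow hσ.le (by omega)

/-- The two half-line transforms add up to `1/(σ+μ^N)`, whose partial fractions split over `J` and
`K`. Terms from `J` are transforms of exponentials on `[0,∞)`, those from `K` of exponentials on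
`(-∞,0)`, and `IsFourierOn.eq_zero` makes such a splitting unique. -/
theorem laplacePartialFourier_eq {N : ℕ} (hN : 2 ≤ N) (hE : Even N) {σ y : ℝ} (hy : 0 < y)
    (hyσ : y ^ N = σ) (μ : ℝ) :
    laplacePartialFourier N (Ici 0) σ μ =
      (N * (y : ℂ) ^ (N - 1))⁻¹ * ∑ θ ∈ rootsJ N, (y - Complex.I * μ * θ)⁻¹ ∧
    laplacePartialFourier N (Iio 0) σ μ =
      (N * (y : ℂ) ^ (N - 1))⁻¹ * ∑ θ ∈ rootsK N, (y - Complex.I * μ * θ)⁻¹ := by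
  have h0 : 0 < N := by omega
  have hσ : 0 < σ := hyσ ▸ pow_pos hy N
  have hre : ∀ c ∈ rootsJ N, 0 < ((y : ℂ) * c⁻¹).re := fun c hc => by
    rw [Complex.re_ofReal_mul, inv_eq_conj_of_mem_rootsJ h0 hc, Complex.conj_re]
    exact mul_pos hy ((mem_rootsJ h0).1 hc).2
  have hJ : IsFourierOn (Ici 0) (∑ θ ∈ rootsJ N, fun μ : ℝ => (y - Complex.I * μ * θ : ℂ)⁻¹) := by
    refine IsFourierOn.sum _ fun c hc => ?_
    have hc0 := ne_zero_of_mem_rootsJ h0 hc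
    have h := (isFourierOn_inv_sub (hre c hc)).const_mul c⁻¹
    refine h.congr fun μ => ?_
    rw [← mul_inv, mul_sub, mul_comm, mul_assoc, inv_mul_cancel₀ hc0]
    ring_nf
  have hK : IsFourierOn (Iio 0) (∑ θ ∈ rootsK N, fun μ : ℝ => (y - Complex.I * μ * θ : ℂ)⁻¹) := by
    rw [rootsK_eq_map h0 hE, Finset.sum_map]
    refine IsFourierOn.sum _ fun c hc => ?_
    have hc0 := ne_zero_of_mem_rootsJ h0 hc
    have h := (isFourierOn_inv_add (hre c hc)).const_mul c⁻¹
    refine h.congr fun μ => ?_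
    change (c⁻¹ * (y * c⁻¹ + Complex.I * μ)⁻¹ : ℂ) = (y - Complex.I * μ * -c)⁻¹
    rw [← mul_inv, mul_add, mul_comm, mul_assoc, inv_mul_cancel₀ hc0]
    ring_nf
  set C : ℂ := (N * (y : ℂ) ^ (N - 1))⁻¹ with hC
  have hsum : ∀ μ, laplacePartialFourier N (Ici 0) σ μ + laplacePartialFourier N (Iio 0) σ μ =
      C * ∑ θ ∈ rootsJ N, (y - Complex.I * μ * θ : ℂ)⁻¹ +
        C * ∑ θ ∈ rootsK N, (y - Complex.I * μ * θ : ℂ)⁻¹ := by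
    intro μ
    rw [← mul_add, sum_inv_sub_mul_roots h0 hE
      (fun θ hθ => sub_I_mul_ne_zero hE hy μ ((mem_rootsJ h0).1 hθ).1)
      (fun θ hθ => sub_I_mul_ne_zero hE hy μ ((mem_rootsK h0).1 hθ).1), kappa_mul_I_mul_pow hE,
      sub_neg_eq_add, hC, ← mul_div_assoc, inv_mul_cancel₀ (mul_ne_zero (by exact_mod_cast h0.ne')
        (pow_ne_zero _ (by exact_mod_cast hy.ne'))), laplacePartialFourier, laplacePartialFourier,
      ← integral_add (integrable_laplacePartialFourier hN hE measurableSet_Ici mul_mem_Ici_iff hσ μ)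
        (integrable_laplacePartialFourier hN hE measurableSet_Iio mul_mem_Iio_iff hσ μ)]
    have hpos : 0 < σ + μ ^ N := by have := hE.pow_nonneg μ; linarith
    have h1 : ∀ t ∈ Ioi (0 : ℝ), (Real.exp (-(σ * t)) : ℂ) * partialFourier N (Ici 0) t μ +
        Real.exp (-(σ * t)) * partialFourier N (Iio 0) t μ =
        (Real.exp (-(σ + μ ^ N) * t) : ℝ) := fun t ht => by
      rw [← mul_add, partialFourier_Ici_add_Iio hN hE ht, ← Complex.ofReal_mul, ← Real.exp_add]
      congr 2; ring
    rw [setIntegral_congr_fun measurableSet_Ioi h1, integral_complex_ofReal,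
      integral_exp_mul_Ioi (by linarith), ← hyσ]
    push_cast
    rw [mul_zero, Complex.exp_zero, neg_div_neg_eq]
  have hz := IsFourierOn.eq_zero disjoint_Ici_Iio_zero
    ((isFourierOn_laplacePartialFourier hN hE measurableSet_Ici hσ).add (hJ.const_mul C).neg)
    (F := laplacePartialFourier N (Ici 0) σ + -fun μ =>
      C * (∑ θ ∈ rootsJ N, fun μ : ℝ => (y - Complex.I * μ * θ : ℂ)⁻¹) μ) ?_
  · have h1 := congrFun hz μ
    have h2 := hsum μ
    simp only [Pi.add_apply, Pi.neg_apply, Pi.zero_apply, Finset.sum_apply] at h1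
    constructor
    · linear_combination h1
    · linear_combination h2 - h1
  · have h := (isFourierOn_laplacePartialFourier hN hE measurableSet_Iio hσ).neg.add
      (hK.const_mul C)
    refine h.congr fun μ => ?_
    have h2 := hsum μ
    simp only [Pi.add_apply, Pi.neg_apply, Finset.sum_apply]
    linear_combination -h2

/-! ### Evaluation of the transform -/

/-- Differentiation in `σ` cancels the factor `1/t`, leaving a Laplace transform. -/
theorem hasDerivAt_frullaniIntegral {N : ℕ} (hN : 2 ≤ N) (hE : Even N) {S : Set ℝ}
    (hSm : MeasurableSet S) (hS : ∀ c x : ℝ, 0 < c → (x * c ∈ S ↔ x ∈ S)) (μ : ℝ) {lam σ : ℝ}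
    (hl : 0 < lam) (hσ : 0 < σ) :
    HasDerivAt (frullaniIntegral N S μ lam) (laplacePartialFourier N S σ μ) σ := by
  have hψ := continuousOn_partialFourier hN hE hSm hS μ
  have hfm : ∀ σ', AEStronglyMeasurable (fun t => (frullani lam σ' t : ℂ) * partialFourier N S t μ)
      (volume.restrict (Ioi 0)) := fun σ' =>
    ((Complex.continuous_ofReal.comp_continuousOn (continuousOn_frullani _ _)).mul
      hψ).aestronglyMeasurable measurableSet_Ioi
  have hσ2 : 0 < σ / 2 := by positivity
  refine (hasDerivAt_integral_of_dominated_loc_of_deriv_le (Metric.ball_mem_nhds σ hσ2)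
    (bound := fun t => Real.exp (-(σ / 2 * t)) * kernelNorm N)
    (F' := fun σ' t => (Real.exp (-(σ' * t)) : ℂ) * partialFourier N S t μ)
    (Eventually.of_forall hfm) ?_
    (integrable_laplacePartialFourier hN hE hSm hS hσ μ).1 ?_
    ((integrableOn_exp_neg_mul hσ2).mul_const _) ?_).2
  · refine ((integrableOn_exp_neg_mul (lt_min hl hσ)).const_mul (|σ - lam| * kernelNorm N)).mono'
      (hfm σ) ((ae_restrict_iff' measurableSet_Ioi).2 (Eventually.of_forall fun t ht => ?_))
    exact norm_frullani_mul_partialFourier_le hN hE S μ lam σ ht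
  · refine (ae_restrict_iff' measurableSet_Ioi).2 (Eventually.of_forall fun t ht σ' hσ' => ?_)
    rw [norm_mul, Complex.norm_real, Real.norm_of_nonneg (Real.exp_pos _).le]
    have ht0 : (0 : ℝ) < t := ht
    rw [Metric.mem_ball, Real.dist_eq, abs_lt] at hσ'
    refine mul_le_mul (Real.exp_le_exp.2 ?_) (norm_partialFourier_le hN hE S ht μ) (norm_nonneg _)
      (Real.exp_pos _).le
    nlinarith
  · refine (ae_restrict_iff' measurableSet_Ioi).2 (Eventually.of_forall fun t ht σ' hσ' => ?_)
    refine HasDerivAt.mul_const ?_ _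
    refine HasDerivAt.ofReal_comp ?_
    have ht0 : t ≠ 0 := ne_of_gt ht
    have h1 : HasDerivAt (fun u : ℝ => -(u * t)) (-(1 * t)) σ' := ((hasDerivAt_id σ').mul_const t).neg
    have h2 : HasDerivAt (fun u : ℝ => (Real.exp (-(lam * t)) - Real.exp (-(u * t))) / t)
      (-(Real.exp (-(σ' * t)) * -(1 * t)) / t) σ' := (h1.exp.const_sub _).div_const t
    refine h2.congr_deriv ?_
    field_simp

theorem frullaniIntegral_self (N : ℕ) (S : Set ℝ) (μ lam : ℝ) :
    frullaniIntegral N S μ lam lam = 0 := by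
  simp [frullaniIntegral, frullani]

/-- A function with the logarithmic derivative of `∏_θ (σ^{1/N} - iμθ)` is given by this product. -/
theorem cexp_eq_prod_div_prod {N : ℕ} (hN : 2 ≤ N) (R : Finset ℂ) (μ : ℝ) {lam : ℝ} {D D' : ℝ → ℂ}
    (hl : 0 < lam) (hR : ∀ y : ℝ, 0 < y → ∀ θ ∈ R, (y - Complex.I * μ * θ : ℂ) ≠ 0)
    (hD : ∀ σ, 0 < σ → HasDerivAt D (D' σ) σ) (hD0 : D lam = 0)
    (hD' : ∀ y : ℝ, 0 < y → D' (y ^ N) =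
      (N * (y : ℂ) ^ (N - 1))⁻¹ * ∑ θ ∈ R, (y - Complex.I * μ * θ)⁻¹) {σ : ℝ} (hσ : 0 < σ) :
    Complex.exp (D σ) * ∏ θ ∈ R, (((lam ^ (1 / (N : ℝ)) : ℝ) : ℂ) - Complex.I * μ * θ) =
      ∏ θ ∈ R, (((σ ^ (1 / (N : ℝ)) : ℝ) : ℂ) - Complex.I * μ * θ) := by
  set P : ℝ → ℂ := fun σ => ∏ θ ∈ R, (((σ ^ (1 / (N : ℝ)) : ℝ) : ℂ) - Complex.I * μ * θ) with hP
  have hPd : ∀ σ, 0 < σ → HasDerivAt P (P σ * D' σ) σ := by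
    intro σ hσ
    set y := σ ^ (1 / (N : ℝ)) with hy
    have hy0 : 0 < y := Real.rpow_pos_of_pos hσ _
    have hyN : y ^ N = σ := rpow_one_div_natCast_pow hN hσ
    have h1 : HasDerivAt (fun σ : ℝ => ((σ ^ (1 / (N : ℝ)) : ℝ) : ℂ)) ((N * (y : ℂ) ^ (N - 1))⁻¹) σ := by
      have := (Real.hasDerivAt_rpow_const (p := 1 / (N : ℝ)) (Or.inl hσ.ne')).ofReal_comp
      refine this.congr_deriv ?_
      rw [Real.rpow_sub hσ, Real.rpow_one, ← hy, ← hyN]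
      have : (y : ℂ) ≠ 0 := by exact_mod_cast hy0.ne'
      have hNN : N = N - 1 + 1 := by omega
      push_cast
      nth_rewrite 2 [hNN]
      rw [pow_succ]
      field_simp
    have h2 := HasDerivAt.fun_finsetProd (u := R) (x := σ)
      (f := fun θ σ => (((σ ^ (1 / (N : ℝ)) : ℝ) : ℂ) - Complex.I * μ * θ))
      (f' := fun _ => (N * (y : ℂ) ^ (N - 1))⁻¹) (fun θ _ => h1.sub_const _)
    refine h2.congr_deriv ?_
    rw [← hyN, hD' y hy0, hyN, Finset.mul_sum, Finset.mul_sum]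
    refine Finset.sum_congr rfl fun θ hθ => ?_
    rw [hP]
    simp only
    rw [← Finset.prod_erase_mul R _ hθ, smul_eq_mul, ← hy]
    have := hR y hy0 θ hθ
    field_simp
  -- `e^{-D} P` has zero derivative on `(0,∞)`, so its values at `λ` and at `σ` agree.
  have hc : ∀ σ, 0 < σ → HasDerivAt (fun σ => Complex.exp (-D σ) * P σ) 0 σ := by
    intro σ hσ
    have h1 : HasDerivAt (fun σ => -D σ) (-D' σ) σ := (hD σ hσ).neg
    refine (h1.cexp.mul (hPd σ hσ)).congr_deriv ?_
    ring
  have key := isOpen_Ioi.is_const_of_deriv_eq_zero isPreconnected_Ioi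
    (fun σ hσ => (hc σ hσ).differentiableAt.differentiableWithinAt)
    (fun σ hσ => (hc σ hσ).deriv) (mem_Ioi.2 hl) (mem_Ioi.2 hσ)
  simp only [hD0, neg_zero, Complex.exp_zero, one_mul] at key
  change _ * P lam = P σ
  rw [key, ← mul_assoc, ← Complex.exp_add]
  simp

/-- The Laplace–Fourier transform of sojourn time and position. -/
theorem hasTransform {N : ℕ} (hN : 2 ≤ N) (hE : Even N) {lam ν : ℝ} (hl : 0 < lam) (hν : 0 < ν)
    (μ : ℝ) : HasTransform N lam μ ν
      ((∏ θ ∈ rootsJ N, ((((lam + ν) ^ (1 / (N : ℝ)) : ℝ) : ℂ) - Complex.I * μ * θ)) *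
        ∏ θ ∈ rootsK N, (((lam ^ (1 / (N : ℝ)) : ℝ) : ℂ) - Complex.I * μ * θ))⁻¹ := by
  refine ⟨fun n => (summable_termExpectation_and_tsum hN hE hl hν μ n).1, ?_⟩
  convert tendsto_tsum_termExpectation hN hE hl hν μ using 2
  have h0 : 0 < N := by omega
  have hσ : 0 < lam + ν := by positivity
  have hJ0 : ∀ y : ℝ, 0 < y → ∀ θ ∈ rootsJ N, (y - Complex.I * μ * θ : ℂ) ≠ 0 :=
    fun y hy θ hθ => sub_I_mul_ne_zero hE hy μ ((mem_rootsJ h0).1 hθ).1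
  have hK0 : ∀ y : ℝ, 0 < y → ∀ θ ∈ rootsK N, (y - Complex.I * μ * θ : ℂ) ≠ 0 :=
    fun y hy θ hθ => sub_I_mul_ne_zero hE hy μ ((mem_rootsK h0).1 hθ).1
  have hJ := cexp_eq_prod_div_prod hN (rootsJ N) μ hl hJ0
    (fun σ hσ => hasDerivAt_frullaniIntegral hN hE measurableSet_Ici mul_mem_Ici_iff μ hl hσ)
    (frullaniIntegral_self _ _ _ _) (fun y hy => (laplacePartialFourier_eq hN hE hy rfl μ).1) hσ
  have hK := cexp_eq_prod_div_prod hN (rootsK N) μ hl hK0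
    (fun σ hσ => hasDerivAt_frullaniIntegral hN hE measurableSet_Iio mul_mem_Iio_iff μ hl hσ)
    (frullaniIntegral_self _ _ _ _) (fun y hy => (laplacePartialFourier_eq hN hE hy rfl μ).2) hσ
  -- The full products at `λ` and `λ+ν` are `λ+μ^N` and `λ+ν+μ^N`. Over the common denominator their
  -- difference `ν` cancels the prefactor `ν⁻¹`.
  have hprod : ∀ σ : ℝ, 0 < σ →
      (∏ θ ∈ rootsJ N, (((σ ^ (1 / (N : ℝ)) : ℝ) : ℂ) - Complex.I * μ * θ)) *
        ∏ θ ∈ rootsK N, (((σ ^ (1 / (N : ℝ)) : ℝ) : ℂ) - Complex.I * μ * θ) = σ + μ ^ N := by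
    intro σ hσ
    rw [prod_sub_mul_roots h0 hE, kappa_mul_I_mul_pow hE, ← Complex.ofReal_pow,
      rpow_one_div_natCast_pow hN hσ]
    ring
  have e1 := hprod lam hl
  have e2 := hprod (lam + ν) hσ
  have n1 := Finset.prod_ne_zero_iff.2 (hJ0 _ (Real.rpow_pos_of_pos hl (1 / (N : ℝ))))
  have n2 := Finset.prod_ne_zero_iff.2 (hJ0 _ (Real.rpow_pos_of_pos hσ (1 / (N : ℝ))))
  have n3 := Finset.prod_ne_zero_iff.2 (hK0 _ (Real.rpow_pos_of_pos hl (1 / (N : ℝ))))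
  have hνC : (ν : ℂ) ≠ 0 := by exact_mod_cast hν.ne'
  rw [Complex.exp_neg, eq_div_of_mul_eq n3 hK, eq_div_of_mul_eq n1 hJ, inv_div]
  generalize (∏ θ ∈ rootsJ N, (((lam ^ (1 / (N : ℝ)) : ℝ) : ℂ) - Complex.I * μ * θ)) = a at *
  generalize (∏ θ ∈ rootsK N, (((lam ^ (1 / (N : ℝ)) : ℝ) : ℂ) - Complex.I * μ * θ)) = b at *
  generalize (∏ θ ∈ rootsJ N, ((((lam + ν) ^ (1 / (N : ℝ)) : ℝ) : ℂ) - Complex.I * μ * θ)) = c at *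
  generalize (∏ θ ∈ rootsK N, ((((lam + ν) ^ (1 / (N : ℝ)) : ℝ) : ℂ) - Complex.I * μ * θ)) = d at *
  rw [eq_inv_mul_iff_mul_eq₀ hνC, mul_inv, eq_comm, div_sub_div _ _ n3 n2,
    div_eq_iff (mul_ne_zero n3 n2)]
  push_cast at e2
  field_simp
  linear_combination e2 - e1

/-! ### A Cauchy integral over the boundary of a sector, in logarithmic coordinates -/

/-- The imaginary part of `Nw` is a multiple of `2π` in `[-π,π]`, hence zero: `e^{Nw} - σ` has a
single zero in the closed strip. -/
theorem cexp_natCast_mul_eq {N : ℕ} (hN : 0 < N) {u σ : ℝ} (hσ : 0 < σ) {w : ℂ}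
    (hw : |w.im| ≤ Real.pi / N) (hu : u = Real.log σ / N) (h : Complex.exp (N * w) = σ) : w = u := by
  have hN0 : (0 : ℝ) < N := by exact_mod_cast hN
  have h1 : Complex.exp (N * w) = Complex.exp (Real.log σ : ℝ) := by
    rw [h, ← Complex.ofReal_exp, Real.exp_log hσ]
  obtain ⟨n, hn⟩ := Complex.exp_eq_exp_iff_exists_int.1 h1
  have him : N * w.im = n * (2 * Real.pi) := by
    have := congrArg Complex.im hn
    simpa using this
  have hre : N * w.re = Real.log σ := by
    have := congrArg Complex.re hn
    simpa using this
  have hn0 : n = 0 := by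
    have h2 : |(n : ℝ)| * (2 * Real.pi) ≤ Real.pi := by
      rw [← abs_of_pos (by positivity : 0 < 2 * Real.pi), ← abs_mul, ← him, abs_mul,
        abs_of_pos hN0, mul_comm, ← le_div_iff₀ hN0]
      exact hw
    have h3 : |(n : ℝ)| < 1 := by
      have := Real.pi_pos
      by_contra! h4
      nlinarith
    exact Int.abs_lt_one_iff.1 (by exact_mod_cast h3)
  rw [hn0, Int.cast_zero, zero_mul] at him
  apply Complex.ext
  · rw [Complex.ofReal_re, hu, eq_div_iff hN0.ne', mul_comm, hre]
  · rw [Complex.ofReal_im]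
    exact (mul_eq_zero.1 him).resolve_left hN0.ne'

/-- Cauchy's theorem on rectangles for `N e^{Nw} (f(w) - f(u₀)) / (e^{Nw} - σ)`, which is
holomorphic at `u₀`. On both horizontal sides `e^{Nw} = -e^{Nu}`, so the constant `f(u₀)` drops out
of their difference. The left side tends to `0`, and the right side supplies the value `f(u₀)`. -/
theorem tendsto_integral_strip {N : ℕ} (hN : 0 < N) {f : ℂ → ℂ} {C σ : ℝ} (hσ : 0 < σ)
    (hf : DifferentiableOn ℂ f {w | |w.im| ≤ Real.pi / N})
    (hb : ∀ w : ℂ, |w.im| ≤ Real.pi / N → ‖f w‖ ≤ C / (1 + Real.exp w.re)) :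
    Tendsto (fun T : ℝ => ∫ u in (-T)..T,
      ((N * Real.exp (N * u) / (Real.exp (N * u) + σ) : ℝ) : ℂ) *
        (f (u + (-(Real.pi / N) : ℝ) * Complex.I) - f (u + (Real.pi / N : ℝ) * Complex.I)))
      atTop (𝓝 (2 * Real.pi * Complex.I * f (Real.log σ / N : ℝ))) := by
  have hN0 : (0 : ℝ) < N := by exact_mod_cast hN
  have hNC : (N : ℂ) ≠ 0 := by exact_mod_cast hN.ne'
  set φ : ℝ := Real.pi / N with hφ
  have hφ0 : 0 < φ := by positivity
  set S : Set ℂ := {w | |w.im| ≤ φ} with hS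
  set u₀ : ℝ := Real.log σ / N with hu₀
  clear_value u₀
  have hC : 0 ≤ C := by
    have h1 := (norm_nonneg _).trans (hb 0 (by simpa using hφ0.le))
    have h2 : (0 : ℝ) < 1 + Real.exp (Complex.re 0) := by positivity
    simpa using (le_div_iff₀ h2).1 h1
  let E : ℂ → ℂ := fun w => Complex.exp (N * w)
  have hEd : Differentiable ℂ E := by simp only [E]; fun_prop
  have hE0 : E u₀ = σ := by
    simp only [E, hu₀]
    rw [← Complex.ofReal_natCast, ← Complex.ofReal_mul, mul_div_cancel₀ _ hN0.ne',
      ← Complex.ofReal_exp, Real.exp_log hσ]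
  have hSn : S ∈ 𝓝 (u₀ : ℂ) := by
    have : Tendsto (fun w : ℂ => |w.im|) (𝓝 (u₀ : ℂ)) (𝓝 |(u₀ : ℂ).im|) :=
      (Complex.continuous_im.abs).tendsto _
    rw [Complex.ofReal_im, abs_zero] at this
    exact (this.eventually_lt_const hφ0).mono fun w hw => hw.le
  -- A quotient of divided differences removes the singularity at `u₀`, where the divided difference
  -- of `e^{Nw}` is the nonzero derivative `Nσ`.
  let g : ℂ → ℂ := fun w => N * E w * (dslope f u₀ w / dslope E u₀ w)
  have hEne : ∀ w ∈ S, w ≠ u₀ → E w - σ ≠ 0 := fun w hw hne h0 =>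
    hne (cexp_natCast_mul_eq hN hσ hw hu₀ (sub_eq_zero.1 h0))
  have hds : ∀ w ∈ S, dslope E u₀ w ≠ 0 := by
    intro w hw
    rcases eq_or_ne w u₀ with rfl | hne
    · rw [dslope_same]
      have : HasDerivAt E (E u₀ * (N * 1)) (u₀ : ℂ) :=
        ((hasDerivAt_id (u₀ : ℂ)).const_mul (N : ℂ)).cexp
      rw [this.deriv, hE0, mul_one]
      exact mul_ne_zero (by exact_mod_cast hσ.ne') hNC
    · rw [dslope_of_ne _ hne, slope_def_field, hE0]
      exact div_ne_zero (hEne w hw hne) (sub_ne_zero.2 hne)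
  have hgd : DifferentiableOn ℂ g S := by
    refine ((hEd.differentiableOn.const_mul _)).mul (DifferentiableOn.div ?_ ?_ hds)
    · exact (Complex.differentiableOn_dslope hSn).2 hf
    · exact (Complex.differentiableOn_dslope hSn).2 hEd.differentiableOn
  have hg : ∀ w ∈ S, w ≠ u₀ → g w = N * E w * ((f w - f u₀) / (E w - σ)) := by
    intro w hw hne
    simp only [g]
    rw [dslope_of_ne _ hne, dslope_of_ne _ hne, slope_def_field, slope_def_field, hE0,
      div_div_div_cancel_right₀ (sub_ne_zero.2 hne)]
  have hrect : ∀ T : ℝ, (∫ u in (-T)..T, g (u + (-φ : ℝ) * Complex.I)) -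
      (∫ u in (-T)..T, g (u + φ * Complex.I)) + Complex.I * (∫ v in (-φ)..φ, g (T + v * Complex.I)) -
      Complex.I * (∫ v in (-φ)..φ, g ((-T : ℝ) + v * Complex.I)) = 0 := by
    intro T
    have := Complex.integral_boundary_rect_eq_zero_of_differentiableOn g ⟨-T, -φ⟩ ⟨T, φ⟩
      (hgd.mono fun w hw => by
        have h2 := hw.2
        simp only [mem_preimage] at h2
        rw [uIcc_of_le (by linarith)] at h2
        exact abs_le.2 h2)
    simpa only [smul_eq_mul] using this
  have hmem : ∀ (u v : ℝ), v ∈ Icc (-φ) φ → (u + v * Complex.I : ℂ) ∈ S := by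
    intro u v hv
    simpa [hS] using abs_le.2 hv
  have hnormE : ∀ u v : ℝ, ‖E (u + v * Complex.I)‖ = Real.exp (N * u) := by
    intro u v
    simp only [E, Complex.norm_exp]
    simp
  -- the horizontal sides
  have hEφ : ∀ u : ℝ, ∀ v : ℝ, v = φ ∨ v = -φ →
      E (u + v * Complex.I) = -(Real.exp (N * u) : ℂ) := by
    intro u v hv
    have h1 : E (u + v * Complex.I) =
        Complex.exp (N * u : ℝ) * Complex.exp ((N * v : ℝ) * Complex.I) := by
      simp only [E]
      rw [← Complex.exp_add]; congr 1; push_cast; ring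
    have h2 : N * φ = Real.pi := mul_div_cancel₀ _ hN0.ne'
    rw [h1, Complex.ofReal_exp]
    rcases hv with rfl | rfl
    · rw [h2, Complex.exp_pi_mul_I]; ring
    · rw [mul_neg, h2, Complex.ofReal_neg, neg_mul, Complex.exp_neg, Complex.exp_pi_mul_I]
      norm_num
  have hgφ : ∀ u : ℝ, ∀ v : ℝ, v = φ ∨ v = -φ → g (u + v * Complex.I) =
      ((N * Real.exp (N * u) / (Real.exp (N * u) + σ) : ℝ) : ℂ) * (f (u + v * Complex.I) - f u₀) := by
    intro u v hv
    have hvS : v ∈ Icc (-φ) φ := by rcases hv with rfl | rfl <;> constructor <;> linarith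
    have hv0 : v ≠ 0 := by rcases hv with rfl | rfl <;> linarith
    rw [hg _ (hmem u v hvS) fun h => hv0 (by simpa using congrArg Complex.im h), hEφ u v hv]
    have hpos : Real.exp (N * u) + σ ≠ 0 := by positivity
    have h1 : (Real.exp (N * u) : ℂ) + σ ≠ 0 := by exact_mod_cast hpos
    have h2 : -(Real.exp (N * u) : ℂ) - σ ≠ 0 := by
      rw [← neg_add']; exact neg_ne_zero.2 h1
    generalize Real.exp (N * u) = X at *
    push_cast
    field_simp
    ring
  have hgi : ∀ v ∈ Icc (-φ) φ, Continuous fun u : ℝ => g (u + v * Complex.I) := by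
    intro v hv
    exact hgd.continuousOn.comp_continuous (by fun_prop) fun u => hmem u v hv
  have hhor : ∀ T : ℝ, (∫ u in (-T)..T, g (u + (-φ : ℝ) * Complex.I)) -
      (∫ u in (-T)..T, g (u + φ * Complex.I)) = ∫ u in (-T)..T,
      ((N * Real.exp (N * u) / (Real.exp (N * u) + σ) : ℝ) : ℂ) *
        (f (u + (-φ : ℝ) * Complex.I) - f (u + φ * Complex.I)) := by
    intro T
    rw [← intervalIntegral.integral_sub
      ((hgi (-φ) ⟨le_rfl, by linarith⟩).intervalIntegrable _ _)
      ((hgi φ ⟨by linarith, le_rfl⟩).intervalIntegrable _ _)]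
    congr 1
    funext u
    rw [hgφ u (-φ) (Or.inr rfl), hgφ u φ (Or.inl rfl)]
    ring
  -- the vertical sides
  have hexpT : Tendsto (fun T : ℝ => Real.exp (N * T)) atTop atTop :=
    Real.tendsto_exp_atTop.comp (tendsto_id.const_mul_atTop hN0)
  have hexpT' : Tendsto (fun T : ℝ => Real.exp (N * (-T))) atTop (𝓝 0) := by
    simp only [mul_neg]
    exact Real.tendsto_exp_neg_atTop_nhds_zero.comp (tendsto_id.const_mul_atTop hN0)
  have hleft : Tendsto (fun T : ℝ => ∫ v in (-φ)..φ, g ((-T : ℝ) + v * Complex.I)) atTop (𝓝 0) := by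
    have hlim : Tendsto (fun T : ℝ => N * Real.exp (N * (-T)) *
        ((C + ‖f u₀‖) / (σ - Real.exp (N * (-T)))) * |φ - -φ|) atTop (𝓝 0) := by
      have h1 := ((hexpT'.const_mul (N : ℝ)).mul (((tendsto_const_nhds (x := C + ‖f u₀‖)).div
        (hexpT'.const_sub σ) (by simpa using hσ.ne')))).mul_const |φ - -φ|
      simpa using h1
    refine squeeze_zero_norm' ?_ hlim
    filter_upwards [hexpT'.eventually_lt_const hσ, eventually_gt_atTop (-u₀)] with T hT hTu
    refine intervalIntegral.norm_integral_le_of_norm_le_const fun v hv => ?_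
    rw [uIoc_of_le (by linarith)] at hv
    have hvS := hmem (-T) v ⟨hv.1.le, hv.2⟩
    rw [hg _ hvS fun h => by
      have := congrArg Complex.re h
      simp at this
      linarith, norm_mul, norm_mul, norm_div, hnormE, Complex.norm_natCast]
    refine mul_le_mul_of_nonneg_left (div_le_div₀ (by positivity) ?_ (sub_pos.2 hT) ?_)
      (by positivity)
    · refine (norm_sub_le _ _).trans (add_le_add_left ((hb _ hvS).trans ?_) _)
      exact div_le_self hC (by linarith [Real.exp_pos (((-T : ℝ) : ℂ) + v * Complex.I).re])
    · rw [norm_sub_rev]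
      refine le_trans (le_of_eq ?_) (norm_sub_norm_le _ _)
      rw [hnormE, Complex.norm_real, Real.norm_of_nonneg hσ.le]
  -- Far to the right `f → 0` and `N e^{Nw}/(e^{Nw} - σ) → N`, so the integrand tends to `-N f(u₀)`
  -- over a segment of length `2π/N`.
  have hright : Tendsto (fun T : ℝ => ∫ v in (-φ)..φ, g (T + v * Complex.I)) atTop
      (𝓝 (-(2 * Real.pi * f u₀))) := by
    have hlim : Tendsto (fun T : ℝ => N * ((C / (1 + Real.exp T) + ‖f u₀‖ * σ / Real.exp (N * T)) /
        (1 - σ / Real.exp (N * T))) * |φ - -φ|) atTop (𝓝 0) := by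
      have h1 : Tendsto (fun T : ℝ => C / (1 + Real.exp T)) atTop (𝓝 0) :=
        tendsto_const_nhds.div_atTop (tendsto_atTop_add_const_left _ _ Real.tendsto_exp_atTop)
      have h2 : ∀ a : ℝ, Tendsto (fun T : ℝ => a / Real.exp (N * T)) atTop (𝓝 0) := fun a =>
        tendsto_const_nhds.div_atTop hexpT
      have h3 := (((h1.add (h2 (‖f u₀‖ * σ))).div ((h2 σ).const_sub 1) (by simp)).const_mul
        (N : ℝ)).mul_const |φ - -φ|
      simpa using h3
    have hconst : -(2 * Real.pi * f u₀) = ∫ v in (-φ)..φ, -(N * f u₀) := by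
      rw [intervalIntegral.integral_const, Complex.real_smul, hφ]
      push_cast
      field_simp
      ring
    rw [tendsto_iff_norm_sub_tendsto_zero]
    refine squeeze_zero_norm' ?_ hlim
    filter_upwards [hexpT.eventually_gt_atTop σ, eventually_gt_atTop u₀] with T hT hTu
    have hcont : Continuous fun v : ℝ => T + v * Complex.I := by fun_prop
    rw [norm_norm, hconst, ← intervalIntegral.integral_sub ?_ intervalIntegrable_const]
    · refine intervalIntegral.norm_integral_le_of_norm_le_const fun v hv => ?_
      rw [uIoc_of_le (by linarith)] at hv
      have hvS := hmem T v ⟨hv.1.le, hv.2⟩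
      have hne : (T + v * Complex.I : ℂ) ≠ u₀ := fun h => by
        have := congrArg Complex.re h
        simp at this
        linarith
      have hE1 := hEne _ hvS hne
      rw [hg _ hvS hne]
      have hX : 0 < Real.exp (N * T) := Real.exp_pos _
      have e : N * E (T + v * Complex.I) * ((f (T + v * Complex.I) - f u₀) /
          (E (T + v * Complex.I) - σ)) - -(N * f u₀) = N * ((f (T + v * Complex.I) *
            E (T + v * Complex.I) - f u₀ * σ) / (E (T + v * Complex.I) - σ)) := by
        field_simp
        ring
      rw [e, norm_mul, norm_div, Complex.norm_natCast]
      refine mul_le_mul_of_nonneg_left ?_ hN0.le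
      have e2 : (C / (1 + Real.exp T) + ‖f u₀‖ * σ / Real.exp (N * T)) / (1 - σ / Real.exp (N * T)) =
          (C / (1 + Real.exp T) * Real.exp (N * T) + ‖f u₀‖ * σ) / (Real.exp (N * T) - σ) := by
        have : Real.exp (N * T) - σ ≠ 0 := (sub_pos.2 hT).ne'
        have : 1 + Real.exp T ≠ 0 := by positivity
        field_simp
      rw [e2]
      refine div_le_div₀ (by positivity) ?_ (sub_pos.2 hT) ?_
      · refine (norm_sub_le _ _).trans ?_
        rw [norm_mul, norm_mul, hnormE, Complex.norm_real, Real.norm_of_nonneg hσ.le]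
        refine add_le_add_left (mul_le_mul_of_nonneg_right ?_ hX.le) _
        simpa using hb _ hvS
      · refine le_trans (le_of_eq ?_) (norm_sub_norm_le _ _)
        rw [hnormE, Complex.norm_real, Real.norm_of_nonneg hσ.le]
    · refine ContinuousOn.intervalIntegrable ?_
      refine hgd.continuousOn.comp hcont.continuousOn fun v hv => ?_
      rw [uIcc_of_le (by linarith)] at hv
      exact hmem T v hv
  have key : ∀ T : ℝ, (∫ u in (-T)..T,
      ((N * Real.exp (N * u) / (Real.exp (N * u) + σ) : ℝ) : ℂ) *
        (f (u + (-φ : ℝ) * Complex.I) - f (u + φ * Complex.I))) =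
      Complex.I * (∫ v in (-φ)..φ, g ((-T : ℝ) + v * Complex.I)) -
        Complex.I * (∫ v in (-φ)..φ, g (T + v * Complex.I)) := by
    intro T
    rw [← hhor]
    linear_combination hrect T
  simp only [key]
  have h := (hleft.const_mul Complex.I).sub (hright.const_mul Complex.I)
  refine h.trans (le_of_eq ?_)
  congr 1
  ring

/-! ### The integrals `∫_0^∞ ρ^{N/2} e^{-sρ^N - bρ} dρ` -/

theorem integrable_pow_mul_exp_neg_mul_pow {N : ℕ} (hN : 2 ≤ N) (hE : Even N) (k : ℕ) {s : ℝ}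
    (hs : 0 < s) : Integrable fun x : ℝ => x ^ k * Real.exp (-(s * x ^ N)) := by
  set c := s ^ (1 / (N : ℝ)) with hc
  have hc0 : 0 < c := Real.rpow_pos_of_pos hs _
  have hcN : c ^ N = s := rpow_one_div_natCast_pow hN hs
  have h := ((integrable_pow_mul_exp_neg_pow hN hE k).comp_mul_left' hc0.ne').const_mul (c ^ k)⁻¹
  refine h.congr (Eventually.of_forall fun x => ?_)
  simp only [mul_pow, hcN]
  field_simp

theorem integrable_polynomial_mul_exp {N : ℕ} (hN : 2 ≤ N) (hE : Even N) (P : Polynomial ℝ) :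
    Integrable fun x : ℝ => P.eval x * Real.exp (-x ^ N) := by
  simp only [Polynomial.eval_eq_sum_range, Finset.sum_mul]
  refine integrable_finsetSum _ fun k _ => ?_
  simpa only [mul_assoc] using (integrable_pow_mul_exp_neg_pow hN hE k).const_mul (P.coeff k)

theorem norm_exp_neg_mul_le {b : ℂ} (hb : 0 ≤ b.re) {x : ℝ} (hx : 0 ≤ x) :
    ‖Complex.exp (-b * x)‖ ≤ 1 := by
  rw [Complex.norm_exp, Real.exp_le_one_iff]
  simpa using mul_nonneg hb hx

theorem integrableOn_mul_cexp {g : ℝ → ℝ} (hg : IntegrableOn g (Ioi 0)) {b : ℂ} (hb : 0 ≤ b.re) :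
    IntegrableOn (fun x => (g x : ℂ) * Complex.exp (-b * x)) (Ioi 0) := by
  have h : Integrable (fun x => (g x : ℂ)) (volume.restrict (Ioi 0)) := Integrable.ofReal hg
  exact h.mul_bdd (c := 1) (by fun_prop) ((ae_restrict_iff' measurableSet_Ioi).2
    (Eventually.of_forall fun x hx => norm_exp_neg_mul_le hb (le_of_lt hx)))

theorem integral_polynomial_mul_exp {N : ℕ} (hN : 2 ≤ N) (hE : Even N) (P : Polynomial ℝ) {b : ℂ}
    (hb : 0 ≤ b.re) (hb0 : b ≠ 0) :
    ∫ x in Ioi (0 : ℝ), ((P.eval x * Real.exp (-x ^ N) : ℝ) : ℂ) * Complex.exp (-b * x) =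
      b⁻¹ * (P.eval 0 + ∫ x in Ioi (0 : ℝ),
        (((P.derivative - (N : Polynomial ℝ) * Polynomial.X ^ (N - 1) * P).eval x *
          Real.exp (-x ^ N) : ℝ) : ℂ) * Complex.exp (-b * x)) := by
  set Q := P.derivative - (N : Polynomial ℝ) * Polynomial.X ^ (N - 1) * P with hQ
  have hP := integrableOn_mul_cexp (integrable_polynomial_mul_exp hN hE P).integrableOn hb
  have hQi := integrableOn_mul_cexp (integrable_polynomial_mul_exp hN hE Q).integrableOn hb
  have hd : ∀ x : ℝ, HasDerivAt (fun x : ℝ => ((P.eval x * Real.exp (-x ^ N) : ℝ) : ℂ) *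
      Complex.exp (-b * x)) (((Q.eval x * Real.exp (-x ^ N) : ℝ) : ℂ) * Complex.exp (-b * x) -
        b * (((P.eval x * Real.exp (-x ^ N) : ℝ) : ℂ) * Complex.exp (-b * x))) x := by
    intro x
    have h1 : HasDerivAt (fun x : ℝ => -x ^ N) (-(N * x ^ (N - 1))) x := (hasDerivAt_pow N x).neg
    have h2 : HasDerivAt (fun x : ℝ => ((P.eval x * Real.exp (-x ^ N) : ℝ) : ℂ))
      ((P.derivative.eval x * Real.exp (-x ^ N) +
        P.eval x * (Real.exp (-x ^ N) * -(N * x ^ (N - 1))) : ℝ) : ℂ) x :=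
      ((P.hasDerivAt x).mul h1.exp).ofReal_comp
    have h3 : HasDerivAt (fun x : ℝ => Complex.exp (-b * x)) (Complex.exp (-b * x) * (-b * 1)) x :=
      (((hasDerivAt_id x).ofReal_comp).const_mul (-b)).cexp
    refine (h2.mul h3).congr_deriv ?_
    simp only [hQ, Polynomial.eval_sub, Polynomial.eval_mul, Polynomial.eval_pow,
      Polynomial.eval_X, Polynomial.eval_natCast]
    push_cast
    ring
  have hi := hQi.sub (hP.const_mul b)
  have hlim := tendsto_zero_of_hasDerivAt_of_integrableOn_Ioi (a := 0) (fun x _ => hd x) hi hP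
  have h := integral_Ioi_of_hasDerivAt_of_tendsto' (a := 0) (fun x _ => hd x) hi hlim
  rw [integral_sub hQi (hP.const_mul b), integral_const_mul] at h
  have h0 : (0 : ℝ) ^ N = 0 := zero_pow (by omega)
  simp only [h0, neg_zero, Real.exp_zero, mul_one, Complex.ofReal_zero, mul_zero,
    Complex.exp_zero, zero_sub] at h
  rw [eq_inv_mul_iff_mul_eq₀ hb0]
  linear_combination -h

/-- `∫_0^∞ ρ^{N/2} e^{-sρ^N - bρ} dρ`. -/
noncomputable def rayIntegral (N : ℕ) (s : ℝ) (b : ℂ) : ℂ :=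
  ∫ ρ in Ioi (0 : ℝ), ((ρ ^ (N / 2) * Real.exp (-(s * ρ ^ N)) : ℝ) : ℂ) * Complex.exp (-b * ρ)

theorem conj_rayIntegral (N : ℕ) (s : ℝ) (b : ℂ) :
    starRingEnd ℂ (rayIntegral N s b) = rayIntegral N s (starRingEnd ℂ b) := by
  rw [rayIntegral, rayIntegral, ← integral_conj]
  congr 1
  funext ρ
  rw [map_mul, Complex.conj_ofReal, ← Complex.exp_conj, map_mul, map_neg, Complex.conj_ofReal]

/-- Two integrations by parts each gain a factor `b⁻¹`; the first boundary term vanishes because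
`ρ^{N/2}` does at `0`. The bound must include imaginary `b`, since `Re (c e^{±iπ/N})` is only known
to be nonnegative for `c ∈ J`. -/
theorem exists_norm_rayIntegral_one_le {N : ℕ} (hN : 2 ≤ N) (hE : Even N) :
    ∃ C : ℝ, 0 ≤ C ∧ ∀ b : ℂ, 0 ≤ b.re → ‖rayIntegral N 1 b‖ ≤ C / (1 + ‖b‖ ^ 2) := by
  set D : Polynomial ℝ → Polynomial ℝ := fun P =>
    P.derivative - (N : Polynomial ℝ) * Polynomial.X ^ (N - 1) * P with hD
  set J : Polynomial ℝ → ℝ := fun P => ∫ x in Ioi (0 : ℝ), |P.eval x * Real.exp (-x ^ N)| with hJ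
  set P : Polynomial ℝ := Polynomial.X ^ (N / 2) with hP
  have hJ0 : ∀ P, 0 ≤ J P := fun P => integral_nonneg fun x => abs_nonneg _
  have hb1 : ∀ (P : Polynomial ℝ) (b : ℂ), 0 ≤ b.re →
      ‖∫ x in Ioi (0 : ℝ), ((P.eval x * Real.exp (-x ^ N) : ℝ) : ℂ) * Complex.exp (-b * x)‖ ≤ J P := by
    intro P b hb
    refine norm_integral_le_of_norm_le (integrable_polynomial_mul_exp hN hE P).integrableOn.abs
      ((ae_restrict_iff' measurableSet_Ioi).2 (Eventually.of_forall fun x hx => ?_))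
    rw [norm_mul, Complex.norm_real, Real.norm_eq_abs]
    exact mul_le_of_le_one_right (abs_nonneg _) (norm_exp_neg_mul_le hb (le_of_lt hx))
  refine ⟨J P + (|(D P).eval 0| + J (D (D P))), by have := hJ0 P; have := hJ0 (D (D P)); positivity,
    fun b hb => ?_⟩
  have h1 : rayIntegral N 1 b =
      ∫ x in Ioi (0 : ℝ), ((P.eval x * Real.exp (-x ^ N) : ℝ) : ℂ) * Complex.exp (-b * x) := by
    simp [rayIntegral, hP]
  have hA := hb1 P b hb
  rw [← h1] at hA
  have hB : ‖b‖ ^ 2 * ‖rayIntegral N 1 b‖ ≤ |(D P).eval 0| + J (D (D P)) := by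
    rcases eq_or_ne b 0 with rfl | hb0
    · rw [norm_zero]; have := hJ0 (D (D P)); simp; positivity
    · have hP0 : P.eval 0 = 0 := by
        rw [hP, Polynomial.eval_pow, Polynomial.eval_X]
        exact zero_pow (by omega)
      rw [h1, integral_polynomial_mul_exp hN hE P hb hb0, hP0, Complex.ofReal_zero, zero_add,
        integral_polynomial_mul_exp hN hE _ hb hb0, norm_mul, norm_mul, norm_inv]
      have hbn : 0 < ‖b‖ := norm_pos_iff.2 hb0
      rw [← mul_assoc, ← mul_assoc, sq, mul_assoc ‖b‖, mul_inv_cancel₀ hbn.ne', mul_one,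
        mul_inv_cancel₀ hbn.ne', one_mul]
      refine (norm_add_le _ _).trans (add_le_add ?_ (hb1 _ b hb))
      rw [Complex.norm_real, Real.norm_eq_abs]
  rw [le_div_iff₀ (by positivity)]
  linarith

theorem rayIntegral_scaling {N : ℕ} {c : ℝ} (hc : 0 < c) (b : ℂ) :
    rayIntegral N (c ^ N)⁻¹ b = c ^ (N / 2 + 1) * rayIntegral N 1 (b * c) := by
  have h := integral_comp_mul_left_Ioi (fun ρ : ℝ =>
    ((ρ ^ (N / 2) * Real.exp (-((c ^ N)⁻¹ * ρ ^ N)) : ℝ) : ℂ) * Complex.exp (-b * ρ)) 0 hc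
  rw [mul_zero, Complex.real_smul, eq_comm, Complex.ofReal_inv] at h
  have hcC : (c : ℂ) ≠ 0 := by exact_mod_cast hc.ne'
  rw [rayIntegral, (inv_mul_eq_iff_eq_mul₀ hcC).1 h, pow_succ', mul_assoc, rayIntegral,
    ← integral_const_mul, ← integral_const_mul, ← integral_const_mul]
  congr 1
  funext ρ
  have h1 : (c ^ N)⁻¹ * (c * ρ) ^ N = 1 * ρ ^ N := by rw [mul_pow]; field_simp
  rw [h1, mul_pow]
  push_cast
  ring_nf

theorem rpow_neg_eq_inv {N : ℕ} {c : ℝ} (hN : N ≠ 0) (hc : 0 < c) :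
    ((c ^ N)⁻¹) ^ (-(1 / (N : ℝ))) = c := by
  rw [Real.rpow_neg (by positivity), Real.inv_rpow (by positivity), inv_inv, one_div,
    Real.pow_rpow_inv_natCast hc.le hN]

theorem rayIntegral_eq {N : ℕ} (hN : 2 ≤ N) {s : ℝ} (hs : 0 < s) (b : ℂ) :
    rayIntegral N s b = ((s ^ (-(1 / (N : ℝ))) : ℝ) : ℂ) ^ (N / 2 + 1) *
      rayIntegral N 1 (b * (s ^ (-(1 / (N : ℝ))) : ℝ)) := by
  obtain ⟨c, hc, rfl, -⟩ := exists_scale (by omega : N ≠ 0) hs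
  rw [rpow_neg_eq_inv (by omega) hc, rayIntegral_scaling hc]

theorem continuousOn_rayIntegral {N : ℕ} (hN : 2 ≤ N) (hE : Even N) :
    ContinuousOn (fun q : ℝ × ℂ => rayIntegral N q.1 q.2) {q | 0 < q.1 ∧ 0 ≤ q.2.re} := by
  have h1 : ContinuousOn (rayIntegral N 1) {b | 0 ≤ b.re} := by
    have hi := (integrable_pow_mul_exp_neg_mul_pow hN hE (N / 2) one_pos).integrableOn (s := Ioi 0)
    refine continuousOn_of_dominated (bound := fun ρ => |ρ ^ (N / 2) * Real.exp (-(1 * ρ ^ N))|)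
      (fun b hb => (integrableOn_mul_cexp hi hb).1) (fun b hb => ?_) hi.abs
      (Eventually.of_forall fun ρ => by fun_prop)
    refine (ae_restrict_iff' measurableSet_Ioi).2 (Eventually.of_forall fun x hx => ?_)
    rw [norm_mul, Complex.norm_real, Real.norm_eq_abs]
    exact mul_le_of_le_one_right (abs_nonneg _) (norm_exp_neg_mul_le hb (le_of_lt hx))
  refine ContinuousOn.congr ?_ fun q hq => rayIntegral_eq hN hq.1 q.2
  have hc : ContinuousOn (fun q : ℝ × ℂ => ((q.1 ^ (-(1 / (N : ℝ))) : ℝ) : ℂ))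
      {q | 0 < q.1 ∧ 0 ≤ q.2.re} :=
    Complex.continuous_ofReal.comp_continuousOn
      (continuousOn_fst.rpow_const fun q hq => Or.inl hq.1.ne')
  refine (hc.pow _).mul (h1.comp (continuousOn_snd.mul hc) fun q hq => ?_)
  simp only [mem_ofPred_eq, Complex.re_mul_ofReal]
  exact mul_nonneg hq.2 (Real.rpow_nonneg hq.1.le _)

/-- The Laplace transform of `x ↦ rayIntegral N s (βx)`. -/
theorem integral_exp_mul_rayIntegral {N : ℕ} (hN : 2 ≤ N) (hE : Even N) {s : ℝ} (hs : 0 < s)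
    {β p : ℂ} (hβ : 0 ≤ β.re) (hp : 0 < p.re) :
    ∫ x in Ioi (0 : ℝ), Complex.exp (-p * x) * rayIntegral N s (β * x) =
      ∫ ρ in Ioi (0 : ℝ), ((ρ ^ (N / 2) * Real.exp (-(s * ρ ^ N)) : ℝ) : ℂ) * (β * ρ + p)⁻¹ := by
  have hi := (integrable_pow_mul_exp_neg_mul_pow hN hE (N / 2) hs).integrableOn (s := Ioi 0)
  have hpi : IntegrableOn (fun x : ℝ => Complex.exp (-p * x)) (Ioi 0) :=
    integrableOn_exp_mul_complex_Ioi (by simpa using hp) 0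
  have hiC : Integrable (fun ρ : ℝ => ((ρ ^ (N / 2) * Real.exp (-(s * ρ ^ N)) : ℝ) : ℂ))
    (volume.restrict (Ioi 0)) := hi.ofReal
  have hprod := (Integrable.mul_prod hpi hiC).mul_bdd (c := 1)
    (g := fun q : ℝ × ℝ => Complex.exp (-(β * q.1) * q.2)) (by fun_prop) (by
      rw [Measure.prod_restrict]
      refine (ae_restrict_iff' (measurableSet_Ioi.prod measurableSet_Ioi)).2
        (Eventually.of_forall fun q hq => ?_)
      refine norm_exp_neg_mul_le ?_ (le_of_lt hq.2)
      rw [Complex.re_mul_ofReal]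
      exact mul_nonneg hβ (le_of_lt hq.1))
  have hswap := integral_integral_swap (f := fun x ρ : ℝ => Complex.exp (-p * x) *
    ((ρ ^ (N / 2) * Real.exp (-(s * ρ ^ N)) : ℝ) : ℂ) * Complex.exp (-(β * x) * ρ)) hprod
  simp only [rayIntegral, ← integral_const_mul]
  simp only [mul_assoc] at hswap ⊢
  rw [hswap]
  refine setIntegral_congr_fun measurableSet_Ioi fun ρ hρ => ?_
  have hre : (-(β * ρ + p)).re < 0 := by
    have := mul_nonneg hβ (le_of_lt (mem_Ioi.1 hρ))
    simp only [Complex.neg_re, Complex.add_re, Complex.re_mul_ofReal]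
    linarith
  have h1 : ∀ x : ℝ, Complex.exp (-p * x) * (((ρ ^ (N / 2) * Real.exp (-(s * ρ ^ N)) : ℝ) : ℂ) *
      Complex.exp (-(β * x) * ρ)) = ((ρ ^ (N / 2) * Real.exp (-(s * ρ ^ N)) : ℝ) : ℂ) *
        Complex.exp (-(β * ρ + p) * x) := by
    intro x
    rw [mul_left_comm, ← Complex.exp_add]
    congr 2
    ring
  simp only [h1]
  rw [integral_const_mul, integral_exp_mul_complex_Ioi hre, Complex.ofReal_zero, mul_zero,
    Complex.exp_zero, neg_div_neg_eq, one_div]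

/-! ### The product `∏_{c ∈ J} (y + pc)⁻¹` -/

/-- `∏_{c ∈ J} (y + pc)⁻¹`. -/
noncomputable def resolventProd (N : ℕ) (p y : ℂ) : ℂ := ∏ c ∈ rootsJ N, (y + p * c)⁻¹

/-- `y + pc = c (c⁻¹y + p)` and `c⁻¹` is again in `J`, so the bracket has real part at least `Re p`.
It also has norm at least `‖y‖ - ‖p‖`, which gives the decay in `y`. -/
theorem norm_inv_add_mul_le {N : ℕ} (hN : 0 < N) {y p c : ℂ} (hc : c ∈ rootsJ N) (hp : 0 < p.re)
    (hy : ∀ c ∈ rootsJ N, 0 ≤ (c * y).re) :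
    y + p * c ≠ 0 ∧ ‖(y + p * c)⁻¹‖ ≤ ((1 + ‖p‖) / p.re + 1) / (1 + ‖y‖) := by
  have hc0 := ne_zero_of_mem_rootsJ hN hc
  have hcn := norm_of_mem_rootsJ hN hc
  have h1 : y + p * c = c * (c⁻¹ * y + p) := by field_simp
  set d := c⁻¹ * y + p with hd
  have hre : p.re ≤ d.re := by
    have := hy _ (conj_mem_rootsJ hN hc)
    rw [← inv_eq_conj_of_mem_rootsJ hN hc] at this
    rw [hd, Complex.add_re]
    linarith
  have hdn : p.re ≤ ‖d‖ := hre.trans (Complex.re_le_norm d)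
  have hd0 : 0 < ‖d‖ := hp.trans_le hdn
  refine ⟨by rw [h1]; exact mul_ne_zero hc0 (norm_pos_iff.1 hd0), ?_⟩
  rw [h1, norm_inv, norm_mul, hcn, one_mul, le_div_iff₀ (by positivity), inv_mul_le_iff₀ hd0]
  have hyn : ‖y‖ ≤ ‖d‖ + ‖p‖ := by
    have h2 : ‖y‖ = ‖d - p‖ := by
      rw [hd, add_sub_cancel_right, norm_mul, norm_inv, hcn, inv_one, one_mul]
    rw [h2]
    exact norm_sub_le _ _
  have h3 : 1 + ‖p‖ ≤ ‖d‖ * ((1 + ‖p‖) / p.re) := by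
    rw [mul_div_assoc', le_div_iff₀ hp, mul_comm]
    gcongr
  linarith

theorem exists_norm_resolventProd_le {N : ℕ} (hN : 2 ≤ N) (hE : Even N) {p : ℂ} (hp : 0 < p.re) :
    ∃ C : ℝ, 0 ≤ C ∧ ∀ y : ℂ, (∀ c ∈ rootsJ N, 0 ≤ (c * y).re) →
      ‖resolventProd N p y‖ ≤ C / (1 + ‖y‖) := by
  have h0 : 0 < N := by omega
  set C := (1 + ‖p‖) / p.re + 1 with hC
  have hC0 : 0 ≤ C := by positivity
  refine ⟨C ^ (rootsJ N).card, by positivity, fun y hy => ?_⟩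
  have h1 : ‖resolventProd N p y‖ ≤ ∏ c ∈ rootsJ N, C / (1 + ‖y‖) := by
    rw [resolventProd, norm_prod]
    exact Finset.prod_le_prod (fun _ _ => norm_nonneg _)
      fun c hc => (norm_inv_add_mul_le h0 hc hp hy).2
  refine h1.trans ?_
  rw [Finset.prod_const, div_pow]
  have hM : (rootsJ N).card ≠ 0 := by rw [card_rootsJ h0 hE]; omega
  refine div_le_div_of_nonneg_left (by positivity) (by positivity) ?_
  exact le_self_pow₀ (by linarith [norm_nonneg y]) hM

theorem re_mul_ray_nonneg {N : ℕ} (hN : 0 < N) (hE : Even N) {r φ : ℝ} (hr : 0 ≤ r)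
    (hφ : |φ| ≤ Real.pi / N) (c : ℂ) (hc : c ∈ rootsJ N) :
    0 ≤ (c * (r * Complex.exp (φ * Complex.I))).re := by
  rw [mul_left_comm, Complex.re_ofReal_mul]
  exact mul_nonneg hr (re_mul_exp_nonneg hN hE hc hφ)

theorem continuousOn_resolventProd_ray {N : ℕ} (hN : 0 < N) (hE : Even N) {p : ℂ} (hp : 0 < p.re)
    {φ : ℝ} (hφ : |φ| ≤ Real.pi / N) :
    ContinuousOn (fun ρ : ℝ => resolventProd N p (ρ * Complex.exp (φ * Complex.I))) (Ici 0) := by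
  unfold resolventProd
  refine continuousOn_finsetProd _ fun c hc => ContinuousOn.inv₀ (by fun_prop) fun ρ hρ => ?_
  exact (norm_inv_add_mul_le hN hc hp (re_mul_ray_nonneg hN hE hρ hφ)).1

theorem integrableOn_resolventProd_ray {N : ℕ} (hN : 2 ≤ N) (hE : Even N) {p : ℂ} (hp : 0 < p.re)
    {φ : ℝ} (hφ : |φ| ≤ Real.pi / N) {σ : ℝ} (hσ : 0 < σ) :
    IntegrableOn (fun ρ : ℝ => ((ρ ^ (N - 1) / (ρ ^ N + σ) : ℝ) : ℂ) *
      resolventProd N p (ρ * Complex.exp (φ * Complex.I))) (Ioi 0) := by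
  have h0 : 0 < N := by omega
  obtain ⟨C, hC, hb⟩ := exists_norm_resolventProd_le hN hE hp
  refine ((integrable_inv_one_add_sq.integrableOn (s := Ioi 0)).const_mul
    (C * (2 + 2 / σ))).mono' ?_ ?_
  · refine ContinuousOn.aestronglyMeasurable ?_ measurableSet_Ioi
    refine ContinuousOn.mul ?_
      ((continuousOn_resolventProd_ray h0 hE hp hφ).mono Ioi_subset_Ici_self)
    refine Complex.continuous_ofReal.comp_continuousOn
      (ContinuousOn.div (by fun_prop) (by fun_prop) fun ρ hρ => ?_)
    have := pow_pos (mem_Ioi.1 hρ) N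
    positivity
  · refine (ae_restrict_iff' measurableSet_Ioi).2 (Eventually.of_forall fun ρ hρ => ?_)
    have hρ0 : 0 < ρ := hρ
    rw [norm_mul, Complex.norm_real, Real.norm_of_nonneg (by positivity)]
    have h1 := hb _ (re_mul_ray_nonneg h0 hE hρ0.le hφ)
    rw [norm_mul, Complex.norm_exp_ofReal_mul_I, mul_one, Complex.norm_real,
      Real.norm_of_nonneg hρ0.le] at h1
    refine (mul_le_mul_of_nonneg_left h1 (by positivity)).trans ?_
    -- For `ρ ≤ 1` the part `2(1+ρ)` of the right side suffices, coming from `(2/σ)·σ`; for `ρ > 1`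
    -- the part `2ρ^N(1+ρ)` does.
    have h2 : ρ ^ (N - 1) * (1 + ρ ^ 2) ≤ (2 + 2 / σ) * ((ρ ^ N + σ) * (1 + ρ)) := by
      have hNN : ρ ^ N = ρ ^ (N - 1) * ρ := by rw [← pow_succ]; congr 1; omega
      have hp1 : 0 < ρ ^ (N - 1) := pow_pos hρ0 _
      have hX : (2 + 2 / σ) * ((ρ ^ N + σ) * (1 + ρ)) = 2 * (ρ ^ N + σ) * (1 + ρ) +
        2 / σ * ρ ^ N * (1 + ρ) + 2 * (1 + ρ) := by field_simp; ring
      rw [hX]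
      have hpos : 0 ≤ 2 / σ * ρ ^ N * (1 + ρ) := by positivity
      have hpos2 : 0 ≤ σ * (1 + ρ) := by positivity
      rcases le_or_gt ρ 1 with h | h
      · have h3 : ρ ^ (N - 1) ≤ 1 := pow_le_one₀ hρ0.le h
        have h4 : 0 ≤ ρ ^ N * (1 + ρ) := by positivity
        have h5 : ρ ^ (N - 1) * (1 + ρ ^ 2) ≤ 1 * (1 + ρ ^ 2) := by gcongr
        nlinarith
      · have h5 : ρ ^ (N - 1) * (1 + ρ ^ 2) ≤ ρ ^ (N - 1) * (2 * ρ ^ 2) :=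
          mul_le_mul_of_nonneg_left (by nlinarith) hp1.le
        have h6 : 0 ≤ ρ ^ N := by positivity
        nlinarith
    rw [div_mul_div_comm, mul_assoc, ← div_eq_mul_inv, mul_div_assoc',
      div_le_div_iff₀ (by positivity) (by positivity)]
    nlinarith [mul_le_mul_of_nonneg_left h2 hC]

/-- Collapsing the Cauchy integral of `resolventProd` onto the boundary of the sector
`|arg y| ≤ π/N`. -/
theorem integral_resolventProd_sector {N : ℕ} (hN : 2 ≤ N) (hE : Even N) {p : ℂ} (hp : 0 < p.re)
    {σ : ℝ} (hσ : 0 < σ) :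
    ∫ ρ in Ioi (0 : ℝ), ((ρ ^ (N - 1) / (ρ ^ N + σ) : ℝ) : ℂ) *
      (resolventProd N p (ρ * Complex.exp ((-(Real.pi / N) : ℝ) * Complex.I)) -
        resolventProd N p (ρ * Complex.exp ((Real.pi / N : ℝ) * Complex.I))) =
      2 * Real.pi * Complex.I / N * resolventProd N p ((σ ^ (1 / (N : ℝ)) : ℝ)) := by
  have h0 : 0 < N := by omega
  have hNC : (N : ℂ) ≠ 0 := by exact_mod_cast h0.ne'
  have hπ : 0 ≤ Real.pi / N := by positivity
  obtain ⟨C, hC, hb⟩ := exists_norm_resolventProd_le hN hE hp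
  have hw : ∀ w : ℂ, |w.im| ≤ Real.pi / N → ∀ c ∈ rootsJ N, 0 ≤ (c * Complex.exp w).re := by
    intro w hw
    have := re_mul_ray_nonneg h0 hE (Real.exp_pos w.re).le hw
    rwa [Complex.ofReal_exp, ← Complex.exp_add, Complex.re_add_im] at this
  have hlim := tendsto_integral_strip h0 (f := fun w => resolventProd N p (Complex.exp w)) (C := C)
    hσ (by
      unfold resolventProd
      refine DifferentiableOn.fun_finsetProd fun c hc => DifferentiableOn.inv (by fun_prop) ?_
      exact fun w hw' => (norm_inv_add_mul_le h0 hc hp (hw w hw')).1) (by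
      intro w hw'
      have := hb _ (hw w hw')
      rwa [Complex.norm_exp] at this)
  set G : ℝ → ℂ := fun ρ => ((ρ ^ (N - 1) / (ρ ^ N + σ) : ℝ) : ℂ) *
      (resolventProd N p (ρ * Complex.exp ((-(Real.pi / N) : ℝ) * Complex.I)) -
        resolventProd N p (ρ * Complex.exp ((Real.pi / N : ℝ) * Complex.I))) with hG
  have hGi : IntegrableOn G (Ioi 0) := by
    have := (integrableOn_resolventProd_ray hN hE hp
      (by rw [abs_neg, abs_of_nonneg hπ]) hσ).sub
      (integrableOn_resolventProd_ray hN hE hp (φ := Real.pi / N) (by rw [abs_of_nonneg hπ]) hσ)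
    refine this.congr (Eventually.of_forall fun ρ => ?_)
    simp only [hG, Pi.sub_apply]
    ring
  -- The substitution `ρ = e^u` identifies the strip integral over `[-T,T]`, as `T → ∞`, with the
  -- integral along the rays.
  have himg : Real.exp '' univ = Ioi 0 := by rw [image_univ, Real.range_exp]
  have hd : ∀ x ∈ (univ : Set ℝ), HasDerivWithinAt Real.exp (Real.exp x) univ x :=
    fun x _ => (Real.hasDerivAt_exp x).hasDerivWithinAt
  have hinj : InjOn Real.exp univ := Real.exp_injective.injOn
  have hI := (integrableOn_image_iff_integrableOn_abs_deriv_smul MeasurableSet.univ hd hinj G).1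
    (by rwa [himg])
  have hV := integral_image_eq_integral_abs_deriv_smul MeasurableSet.univ hd hinj G
  rw [himg, setIntegral_univ] at hV
  rw [integrableOn_univ] at hI
  have hlim2 := (intervalIntegral_tendsto_integral hI tendsto_neg_atTop_atBot tendsto_id).const_mul
    (N : ℂ)
  rw [← hV] at hlim2
  have heq : ∀ T : ℝ, ∫ u in (-T)..T, ((N * Real.exp (N * u) / (Real.exp (N * u) + σ) : ℝ) : ℂ) *
        (resolventProd N p (Complex.exp (u + (-(Real.pi / N) : ℝ) * Complex.I)) -
          resolventProd N p (Complex.exp (u + (Real.pi / N : ℝ) * Complex.I))) =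
      N * ∫ u in (-T)..T, |Real.exp u| • G (Real.exp u) := by
    intro T
    rw [← intervalIntegral.integral_const_mul]
    congr 1
    funext u
    rw [abs_of_pos (Real.exp_pos u), hG, Complex.real_smul, Complex.exp_add, Complex.exp_add,
      ← Complex.ofReal_exp, ← mul_assoc, ← mul_assoc]
    congr 1
    rw [Real.exp_nat_mul]
    have hNN : Real.exp u ^ N = Real.exp u * Real.exp u ^ (N - 1) := by
      rw [← pow_succ']; congr 1; omega
    nth_rewrite 1 [hNN]
    push_cast
    ring
  simp only [heq] at hlim
  have key := tendsto_nhds_unique hlim2 hlim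
  have hy : Complex.exp (Real.log σ / N : ℝ) = ((σ ^ (1 / (N : ℝ)) : ℝ) : ℂ) := by
    rw [Real.rpow_def_of_pos hσ, ← Complex.ofReal_exp, mul_one_div]
  rw [hy] at key
  field_simp
  linear_combination key

/-! ### The joint Laplace density on the quadrant -/

theorem conj_vandermondeCoeff_rootsJ {N : ℕ} (hN : 0 < N) (c : ℂ) :
    starRingEnd ℂ (vandermondeCoeff (rootsJ N) c) =
      vandermondeCoeff (rootsJ N) (starRingEnd ℂ c) := by
  have h : ∀ c : ℂ, vandermondeCoeff (rootsJ N) c =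
      ∏ i ∈ rootsJ N, if i = c then 1 else i / (i - c) := fun c => by
    rw [vandermondeCoeff, ← Finset.prod_erase (a := c) (rootsJ N) (by simp)]
    exact Finset.prod_congr rfl fun i hi => (if_neg (Finset.ne_of_mem_erase hi)).symm
  rw [h c, map_prod, h, ← prod_rootsJ_conj hN fun i =>
    if i = starRingEnd ℂ c then 1 else i / (i - starRingEnd ℂ c)]
  refine Finset.prod_congr rfl fun i _ => ?_
  rcases eq_or_ne i c with rfl | hne
  · simp
  · rw [if_neg hne, if_neg fun h => hne ((starRingEnd ℂ).injective h), map_div₀, map_sub]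

theorem sum_rootsJ_conj {M : Type*} [AddCommMonoid M] {N : ℕ} (hN : 0 < N) (g : ℂ → M) :
    ∑ c ∈ rootsJ N, g (starRingEnd ℂ c) = ∑ c ∈ rootsJ N, g c :=
  prod_rootsJ_conj (M := Multiplicative M) hN g

/-- The contribution of the ray `arg y = φ` to the density `halfDensity`. -/
noncomputable def sectorSum (N : ℕ) (φ s x : ℝ) : ℂ :=
  (Complex.exp (φ * Complex.I) ^ ((rootsJ N).card - 1))⁻¹ *
    ∑ c ∈ rootsJ N, vandermondeCoeff (rootsJ N) c * c *
      rayIntegral N s (c * Complex.exp (φ * Complex.I) * x)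

theorem conj_exp_mul_I (φ : ℝ) : starRingEnd ℂ (Complex.exp (φ * Complex.I)) =
    Complex.exp ((-φ : ℝ) * Complex.I) := by
  rw [← Complex.exp_conj, map_mul, Complex.conj_ofReal, Complex.conj_I]
  push_cast
  ring_nf

theorem conj_sectorSum {N : ℕ} (hN : 0 < N) (φ s x : ℝ) :
    starRingEnd ℂ (sectorSum N φ s x) = sectorSum N (-φ) s x := by
  rw [sectorSum, sectorSum, map_mul, map_inv₀, map_pow, conj_exp_mul_I, map_sum,
    ← sum_rootsJ_conj hN]
  congr 1
  refine Finset.sum_congr rfl fun c _ => ?_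
  rw [map_mul, map_mul, conj_rayIntegral, map_mul, map_mul, conj_exp_mul_I, Complex.conj_ofReal,
    conj_vandermondeCoeff_rootsJ hN, Complex.conj_conj]

/-- The function on `s, x > 0` with the double Laplace transform
`∫∫ e^{-σs-px} ds dx = ∏_{c ∈ J} (σ^{1/N} + pc)⁻¹`. -/
noncomputable def halfDensity (N : ℕ) (s x : ℝ) : ℝ :=
  N / Real.pi * (sectorSum N (-(Real.pi / N)) s x).im

/-- The contributions of the two rays are complex conjugates, so the Cauchy difference is `2i` times
an imaginary part and the density is real. -/
theorem ofReal_halfDensity {N : ℕ} (hN : 0 < N) (s x : ℝ) : (halfDensity N s x : ℂ) =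
    N / (2 * Real.pi * Complex.I) *
      (sectorSum N (-(Real.pi / N)) s x - sectorSum N (Real.pi / N) s x) := by
  have h1 : sectorSum N (Real.pi / N) s x =
      starRingEnd ℂ (sectorSum N (-(Real.pi / N)) s x) := by
    rw [conj_sectorSum hN, neg_neg]
  have hπ : (Real.pi : ℂ) ≠ 0 := by exact_mod_cast Real.pi_ne_zero
  rw [halfDensity, h1, Complex.sub_conj]
  push_cast
  field_simp

theorem re_root_mul_ray_nonneg {N : ℕ} (hN : 0 < N) (hE : Even N) {x φ : ℝ} (hx : 0 ≤ x)
    (hφ : |φ| ≤ Real.pi / N) {c : ℂ} (hc : c ∈ rootsJ N) :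
    0 ≤ (c * Complex.exp (φ * Complex.I) * x).re := by
  rw [Complex.re_mul_ofReal]
  exact mul_nonneg (re_mul_exp_nonneg hN hE hc hφ) hx

theorem abs_neg_pi_div_le (N : ℕ) : |-(Real.pi / N)| ≤ Real.pi / N := by
  rw [abs_neg, abs_of_nonneg (by positivity)]

theorem continuousOn_sectorSum {N : ℕ} (hN : 2 ≤ N) (hE : Even N) {φ : ℝ}
    (hφ : |φ| ≤ Real.pi / N) :
    ContinuousOn (fun q : ℝ × ℝ => sectorSum N φ q.1 q.2) (Ioi 0 ×ˢ Ici 0) := by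
  unfold sectorSum
  refine continuousOn_const.mul (continuousOn_finsetSum _ fun c hc => continuousOn_const.mul ?_)
  exact (continuousOn_rayIntegral hN hE).comp (f := fun q : ℝ × ℝ =>
    (q.1, c * Complex.exp (φ * Complex.I) * q.2)) (by fun_prop)
    fun q hq => ⟨hq.1, re_root_mul_ray_nonneg (by omega) hE hq.2 hφ hc⟩

theorem continuousOn_halfDensity {N : ℕ} (hN : 2 ≤ N) (hE : Even N) :
    ContinuousOn (fun q : ℝ × ℝ => halfDensity N q.1 q.2) (Ioi 0 ×ˢ Ici 0) := by
  unfold halfDensity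
  exact continuousOn_const.mul (Complex.continuous_im.comp_continuousOn
    (continuousOn_sectorSum hN hE (abs_neg_pi_div_le N)))

/-- The bound for `sectorSum` and `halfDensity`. -/
noncomputable def scaledBound (N : ℕ) (s x : ℝ) : ℝ :=
  (s ^ (-(1 / (N : ℝ)))) ^ (N / 2 + 1) / (1 + (x * s ^ (-(1 / (N : ℝ)))) ^ 2)

theorem scaledBound_nonneg (N : ℕ) {s : ℝ} (hs : 0 < s) (x : ℝ) : 0 ≤ scaledBound N s x := by
  have := Real.rpow_pos_of_pos hs (-(1 / (N : ℝ)))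
  unfold scaledBound
  positivity

theorem exists_norm_sectorSum_le {N : ℕ} (hN : 2 ≤ N) (hE : Even N) {φ : ℝ}
    (hφ : |φ| ≤ Real.pi / N) :
    ∃ C : ℝ, 0 ≤ C ∧ ∀ s x : ℝ, 0 < s → 0 ≤ x → ‖sectorSum N φ s x‖ ≤ C * scaledBound N s x := by
  have h0 : 0 < N := by omega
  obtain ⟨C, hC, hb⟩ := exists_norm_rayIntegral_one_le hN hE
  refine ⟨(∑ c ∈ rootsJ N, ‖vandermondeCoeff (rootsJ N) c‖) * C,
    mul_nonneg (Finset.sum_nonneg fun _ _ => norm_nonneg _) hC, fun s x hs hx => ?_⟩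
  rw [sectorSum, norm_mul, norm_inv, norm_pow, Complex.norm_exp_ofReal_mul_I, one_pow, inv_one,
    one_mul]
  refine (norm_sum_le _ _).trans ?_
  rw [mul_assoc, Finset.sum_mul]
  refine Finset.sum_le_sum fun c hc => ?_
  have hcs : 0 < s ^ (-(1 / (N : ℝ))) := Real.rpow_pos_of_pos hs _
  rw [norm_mul, norm_mul, norm_of_mem_rootsJ h0 hc, mul_one, rayIntegral_eq hN hs, norm_mul,
    norm_pow, Complex.norm_real, Real.norm_of_nonneg hcs.le]
  refine mul_le_mul_of_nonneg_left ?_ (norm_nonneg _)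
  have h1 := hb (c * Complex.exp (φ * Complex.I) * x * (s ^ (-(1 / (N : ℝ))) : ℝ)) (by
    rw [Complex.re_mul_ofReal]
    exact mul_nonneg (re_root_mul_ray_nonneg h0 hE hx hφ hc) hcs.le)
  rw [norm_mul, norm_mul, norm_mul, norm_of_mem_rootsJ h0 hc, Complex.norm_exp_ofReal_mul_I,
    Complex.norm_real, Complex.norm_real, Real.norm_of_nonneg hcs.le, Real.norm_of_nonneg hx,
    one_mul, one_mul] at h1
  refine (mul_le_mul_of_nonneg_left h1 (by positivity)).trans (le_of_eq ?_)
  rw [scaledBound]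
  ring

theorem exists_abs_halfDensity_le {N : ℕ} (hN : 2 ≤ N) (hE : Even N) :
    ∃ C : ℝ, 0 ≤ C ∧ ∀ s x : ℝ, 0 < s → 0 ≤ x → |halfDensity N s x| ≤ C * scaledBound N s x := by
  obtain ⟨C, hC, hb⟩ := exists_norm_sectorSum_le hN hE (abs_neg_pi_div_le N)
  have hπ := Real.pi_pos
  refine ⟨N / Real.pi * C, by positivity, fun s x hs hx => ?_⟩
  rw [halfDensity, abs_mul, abs_of_nonneg (by positivity), mul_assoc]
  exact mul_le_mul_of_nonneg_left ((Complex.abs_im_le_norm _).trans (hb s x hs hx)) (by positivity)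

/-- Lebesgue measure on `(0,∞) × (0,∞)`. -/
noncomputable abbrev quadrantMeasure : Measure (ℝ × ℝ) :=
  (volume.restrict (Ioi (0 : ℝ))).prod (volume.restrict (Ioi (0 : ℝ)))

theorem ae_quadrant {P : ℝ × ℝ → Prop} (h : ∀ s x : ℝ, 0 < s → 0 < x → P (s, x)) :
    ∀ᵐ q ∂quadrantMeasure, P q := by
  rw [quadrantMeasure, Measure.prod_restrict]
  exact (ae_restrict_iff' (measurableSet_Ioi.prod measurableSet_Ioi)).2
    (Eventually.of_forall fun q hq => h q.1 q.2 hq.1 hq.2)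

theorem integrableOn_scaledBound (N : ℕ) {s : ℝ} (hs : 0 < s) :
    IntegrableOn (scaledBound N s) (Ioi 0) ∧ ∫ x in Ioi (0 : ℝ), scaledBound N s x =
      (∫ x in Ioi (0 : ℝ), (1 + x ^ 2)⁻¹) * (s ^ (-(1 / (N : ℝ)))) ^ (N / 2) := by
  set c := s ^ (-(1 / (N : ℝ))) with hc
  have hc0 : 0 < c := Real.rpow_pos_of_pos hs _
  have h1 : scaledBound N s = fun x => c ^ (N / 2 + 1) * (1 + (x * c) ^ 2)⁻¹ := by
    funext x
    rw [scaledBound, div_eq_mul_inv]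
  rw [h1]
  constructor
  · exact ((integrable_inv_one_add_sq.comp_mul_right' hc0.ne').const_mul _).integrableOn
  · rw [integral_const_mul, integral_comp_mul_right_Ioi (fun x => (1 + x ^ 2)⁻¹) 0 hc0, zero_mul,
      smul_eq_mul, pow_succ]
    field_simp

theorem continuousOn_scaledBound (N : ℕ) :
    ContinuousOn (fun q : ℝ × ℝ => scaledBound N q.1 q.2) (Ioi 0 ×ˢ univ) := by
  have hc : ContinuousOn (fun q : ℝ × ℝ => q.1 ^ (-(1 / (N : ℝ)))) (Ioi 0 ×ˢ univ) :=
    continuousOn_fst.rpow_const fun q hq => Or.inl (ne_of_gt hq.1)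
  unfold scaledBound
  refine ContinuousOn.div (hc.pow _) ?_ fun q _ => by positivity
  exact continuousOn_const.add ((continuousOn_snd.mul hc).pow 2)

/-- Integrating the bound in `x` costs one power of `s^{-1/N}` out of `N/2 + 1` and leaves a
multiple of `s^{-1/2}`, integrable at `0`. -/
theorem integrable_exp_mul_scaledBound {N : ℕ} (hN : 2 ≤ N) (hE : Even N) {σ : ℝ} (hσ : 0 < σ) :
    Integrable (fun q : ℝ × ℝ => Real.exp (-(σ * q.1)) * scaledBound N q.1 q.2) quadrantMeasure := by
  have hm : AEStronglyMeasurable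
      (fun q : ℝ × ℝ => Real.exp (-(σ * q.1)) * scaledBound N q.1 q.2) quadrantMeasure := by
    rw [quadrantMeasure, Measure.prod_restrict]
    refine ContinuousOn.aestronglyMeasurable ?_ (measurableSet_Ioi.prod measurableSet_Ioi)
    exact (Continuous.continuousOn (by fun_prop)).mul
      ((continuousOn_scaledBound N).mono (prod_mono_right (subset_univ _)))
  refine (integrable_prod_iff hm).2 ⟨?_, ?_⟩
  · exact (ae_restrict_iff' measurableSet_Ioi).2 (Eventually.of_forall fun s hs =>
      (integrableOn_scaledBound N hs).1.const_mul (Real.exp (-(σ * s))))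
  · have h1 : IntegrableOn (fun s : ℝ => (∫ x in Ioi (0 : ℝ), (1 + x ^ 2)⁻¹) *
        (s ^ (-(1 / 2) : ℝ) * Real.exp (-σ * s ^ (1 : ℝ)))) (Ioi 0) :=
      (integrableOn_rpow_mul_exp_neg_mul_rpow (by norm_num) one_pos hσ).const_mul _
    refine h1.congr_fun (fun s hs => ?_) measurableSet_Ioi
    have hs0 : 0 < s := hs
    simp only [norm_mul, Real.norm_of_nonneg (Real.exp_pos _).le,
      Real.norm_of_nonneg (scaledBound_nonneg N hs0 _)]
    rw [integral_const_mul, (integrableOn_scaledBound N hs0).2, ← Real.rpow_natCast (s ^ _),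
      ← Real.rpow_mul hs0.le, Real.rpow_one]
    have hN2 : -(1 / (N : ℝ)) * (N / 2 : ℕ) = -(1 / 2) := by
      rw [Nat.cast_div hE.two_dvd (by norm_num)]
      have : (N : ℝ) ≠ 0 := by positivity
      push_cast
      field_simp
    rw [hN2]
    ring_nf

theorem integrable_exp_mul_of_le_scaledBound {N : ℕ} (hN : 2 ≤ N) (hE : Even N) {σ C : ℝ}
    (hσ : 0 < σ) {g : ℝ → ℝ → ℂ} (hg : ContinuousOn (fun q : ℝ × ℝ => g q.1 q.2) (Ioi 0 ×ˢ Ici 0))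
    (hb : ∀ s x : ℝ, 0 < s → 0 ≤ x → ‖g s x‖ ≤ C * scaledBound N s x) {p : ℂ} (hp : 0 ≤ p.re) :
    Integrable (fun q : ℝ × ℝ => (Real.exp (-(σ * q.1)) : ℂ) * (Complex.exp (-p * q.2) * g q.1 q.2))
      quadrantMeasure := by
  refine ((integrable_exp_mul_scaledBound hN hE hσ).const_mul C).mono' ?_
    (ae_quadrant fun s x hs hx => ?_)
  · rw [quadrantMeasure, Measure.prod_restrict]
    refine ContinuousOn.aestronglyMeasurable ?_ (measurableSet_Ioi.prod measurableSet_Ioi)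
    exact (Continuous.continuousOn (by fun_prop)).mul ((Continuous.continuousOn (by fun_prop)).mul
      (hg.mono (prod_mono_right Ioi_subset_Ici_self)))
  · rw [norm_mul, norm_mul, Complex.norm_real, Real.norm_of_nonneg (Real.exp_pos _).le,
      mul_left_comm C]
    refine mul_le_mul_of_nonneg_left ?_ (Real.exp_pos _).le
    exact (mul_le_of_le_one_left (norm_nonneg _) (norm_exp_neg_mul_le hp hx.le)).trans
      (hb s x hs hx.le)

/-- In `x`, each `e^{-cyx}` becomes `1/(cy+p)`, and the partial fractions reassemble to `y^{#J-1} ∏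
(y+pc)⁻¹`. The surplus power of `y = ρe^{iφ}` is why `sectorSum` carries `e^{-iφ(#J-1)}` and
`ρ^{N/2}` in place of `ρ^{N-1}`. -/
theorem integral_exp_mul_sectorSum {N : ℕ} (hN : 2 ≤ N) (hE : Even N) {s : ℝ} (hs : 0 < s)
    {φ : ℝ} (hφ : |φ| ≤ Real.pi / N) {p : ℂ} (hp : 0 < p.re) :
    ∫ x in Ioi (0 : ℝ), Complex.exp (-p * x) * sectorSum N φ s x =
      ∫ ρ in Ioi (0 : ℝ), ((ρ ^ (N - 1) * Real.exp (-(s * ρ ^ N)) : ℝ) : ℂ) *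
        resolventProd N p (ρ * Complex.exp (φ * Complex.I)) := by
  have h0 : 0 < N := by omega
  have hcard := card_rootsJ h0 hE
  set e := Complex.exp (φ * Complex.I) with he
  have he0 : e ≠ 0 := Complex.exp_ne_zero _
  have hexp : IntegrableOn (fun x : ℝ => Real.exp (-(p.re * x))) (Ioi 0) :=
    integrableOn_exp_neg_mul hp
  have hi : ∀ c ∈ rootsJ N, IntegrableOn (fun x : ℝ => Complex.exp (-p * x) *
      rayIntegral N s (c * e * x)) (Ioi 0) := by
    intro c hc
    obtain ⟨C, hC, hb⟩ := exists_norm_rayIntegral_one_le hN hE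
    refine (hexp.mul_const ((s ^ (-(1 / (N : ℝ)))) ^ (N / 2 + 1) * C)).mono' ?_
      ((ae_restrict_iff' measurableSet_Ioi).2 (Eventually.of_forall fun x hx => ?_))
    · refine ContinuousOn.aestronglyMeasurable ?_ measurableSet_Ioi
      refine (Continuous.continuousOn (by fun_prop)).mul ?_
      exact (continuousOn_rayIntegral hN hE).comp (f := fun x : ℝ => (s, c * e * x))
        (by fun_prop) fun x hx => ⟨hs, re_root_mul_ray_nonneg h0 hE (le_of_lt hx) hφ hc⟩
    · have hcs : 0 < s ^ (-(1 / (N : ℝ))) := Real.rpow_pos_of_pos hs _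
      rw [norm_mul, Complex.norm_exp, rayIntegral_eq hN hs, norm_mul,
        norm_pow, Complex.norm_real, Real.norm_of_nonneg hcs.le]
      have h1 := hb (c * e * x * (s ^ (-(1 / (N : ℝ))) : ℝ)) (by
        rw [Complex.re_mul_ofReal]
        exact mul_nonneg (re_root_mul_ray_nonneg h0 hE (le_of_lt hx) hφ hc) hcs.le)
      have h2 : (-p * (x : ℂ)).re = -(p.re * x) := by simp
      rw [h2]
      gcongr
      exact h1.trans (div_le_self hC (by nlinarith [sq_nonneg ‖c * e * x * (s ^ (-(1 / (N : ℝ))) : ℝ)‖]))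
  have hρ : ∀ c ∈ rootsJ N, ∀ ρ ∈ Ici (0 : ℝ), c * e * ρ + p ≠ 0 := by
    intro c hc ρ hρ h
    have h1 := re_root_mul_ray_nonneg h0 hE (mem_Ici.1 hρ) hφ hc
    have h2 := congrArg Complex.re h
    rw [Complex.add_re, Complex.zero_re] at h2
    linarith
  have hj : ∀ c ∈ rootsJ N, IntegrableOn (fun ρ : ℝ =>
      ((ρ ^ (N / 2) * Real.exp (-(s * ρ ^ N)) : ℝ) : ℂ) * (c * e * ρ + p)⁻¹) (Ioi 0) := by
    intro c hc
    have h1 : Integrable (fun ρ : ℝ => ((ρ ^ (N / 2) * Real.exp (-(s * ρ ^ N)) : ℝ) : ℂ))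
      (volume.restrict (Ioi 0)) :=
      (integrable_pow_mul_exp_neg_mul_pow hN hE (N / 2) hs).integrableOn.ofReal
    refine h1.mul_bdd (c := p.re⁻¹) ?_ ((ae_restrict_iff' measurableSet_Ioi).2
      (Eventually.of_forall fun ρ hρ' => ?_))
    · refine ContinuousOn.aestronglyMeasurable ?_ measurableSet_Ioi
      exact ContinuousOn.inv₀ (by fun_prop) fun ρ hρ' => hρ c hc ρ (Ioi_subset_Ici_self hρ')
    · rw [norm_inv]
      refine inv_anti₀ hp (le_trans ?_ (Complex.re_le_norm _))
      have h1 := re_root_mul_ray_nonneg h0 hE (le_of_lt (mem_Ioi.1 hρ')) hφ hc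
      rw [Complex.add_re]
      linarith
  have hL : ∀ x : ℝ, Complex.exp (-p * x) * sectorSum N φ s x =
      ∑ c ∈ rootsJ N, (e ^ ((rootsJ N).card - 1))⁻¹ * (vandermondeCoeff (rootsJ N) c * c) *
        (Complex.exp (-p * x) * rayIntegral N s (c * e * x)) := by
    intro x
    rw [sectorSum, Finset.mul_sum, Finset.mul_sum]
    exact Finset.sum_congr rfl fun c _ => by ring
  simp only [hL]
  rw [integral_finsetSum _ fun c hc => (hi c hc).const_mul _]
  simp only [integral_const_mul]
  rw [Finset.sum_congr rfl fun c hc => by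
    rw [integral_exp_mul_rayIntegral hN hE hs (re_mul_exp_nonneg h0 hE hc hφ) hp,
      ← integral_const_mul], ← integral_finsetSum _ fun c hc => (hj c hc).const_mul _]
  refine setIntegral_congr_fun measurableSet_Ioi fun ρ hρ' => ?_
  have hρ0 : (ρ : ℂ) ≠ 0 := by exact_mod_cast (ne_of_gt hρ')
  have hne : ∀ c ∈ rootsJ N, (ρ * e : ℂ) + p * c ≠ 0 := fun c hc =>
    (norm_inv_add_mul_le h0 hc hp (re_mul_ray_nonneg h0 hE (le_of_lt hρ') hφ)).1
  have key := sum_vandermondeCoeff_mul_div h0 hE (mul_ne_zero hρ0 he0) hne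
  have hpow : (ρ : ℝ) ^ (N - 1) = ρ ^ (N / 2) * ρ ^ ((rootsJ N).card - 1) := by
    rw [← pow_add, hcard]
    congr 1
    obtain ⟨M, rfl⟩ := hE
    omega
  rw [resolventProd, hpow]
  have hsum : ∑ c ∈ rootsJ N, (e ^ ((rootsJ N).card - 1))⁻¹ * (vandermondeCoeff (rootsJ N) c * c) *
      (((ρ ^ (N / 2) * Real.exp (-(s * ρ ^ N)) : ℝ) : ℂ) * (c * e * ρ + p)⁻¹) =
      (e ^ ((rootsJ N).card - 1))⁻¹ * ((ρ ^ (N / 2) * Real.exp (-(s * ρ ^ N)) : ℝ) : ℂ) *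
        ∑ c ∈ rootsJ N, vandermondeCoeff (rootsJ N) c * c / (c * (ρ * e) + p) := by
    rw [Finset.mul_sum]
    refine Finset.sum_congr rfl fun c _ => ?_
    rw [div_eq_mul_inv, show c * e * ρ = c * (ρ * e) by ring]
    ring
  rw [hsum, key, mul_pow]
  push_cast
  field_simp

/-- After exchanging the order of integration, the `s`-integral of `e^{-(ρ^N+σ)s}` gives the Cauchy
kernel `1/(ρ^N+σ)`. -/
theorem integral_quadrant_sectorSum {N : ℕ} (hN : 2 ≤ N) (hE : Even N) {σ : ℝ} (hσ : 0 < σ)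
    {φ : ℝ} (hφ : |φ| ≤ Real.pi / N) {p : ℂ} (hp : 0 < p.re) :
    ∫ q, (Real.exp (-(σ * q.1)) : ℂ) * (Complex.exp (-p * q.2) * sectorSum N φ q.1 q.2)
      ∂quadrantMeasure = ∫ ρ in Ioi (0 : ℝ), ((ρ ^ (N - 1) / (ρ ^ N + σ) : ℝ) : ℂ) *
        resolventProd N p (ρ * Complex.exp (φ * Complex.I)) := by
  have h0 : 0 < N := by omega
  obtain ⟨C, hC, hb⟩ := exists_norm_sectorSum_le hN hE hφ
  rw [integral_prod _ (integrable_exp_mul_of_le_scaledBound hN hE hσ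
    (continuousOn_sectorSum hN hE hφ) hb hp.le)]
  have h1 : ∀ s ∈ Ioi (0 : ℝ), ∫ x in Ioi (0 : ℝ), (Real.exp (-(σ * s)) : ℂ) *
      (Complex.exp (-p * x) * sectorSum N φ s x) =
      ∫ ρ in Ioi (0 : ℝ), (Real.exp (-((ρ ^ N + σ) * s)) : ℂ) * ((ρ ^ (N - 1) : ℝ) *
        resolventProd N p (ρ * Complex.exp (φ * Complex.I))) := by
    intro s hs
    rw [integral_const_mul, integral_exp_mul_sectorSum hN hE hs hφ hp, ← integral_const_mul]
    congr 1
    funext ρ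
    rw [add_mul, neg_add, Real.exp_add, mul_comm (ρ ^ N) s]
    push_cast
    ring
  rw [setIntegral_congr_fun measurableSet_Ioi h1, integral_integral_swap]
  · refine setIntegral_congr_fun measurableSet_Ioi fun ρ hρ => ?_
    have hpos : 0 < ρ ^ N + σ := by have := pow_pos (mem_Ioi.1 hρ) N; positivity
    have h2 : ∫ s in Ioi (0 : ℝ), (Real.exp (-((ρ ^ N + σ) * s)) : ℂ) =
        ((1 / (ρ ^ N + σ) : ℝ) : ℂ) := by
      rw [integral_complex_ofReal]
      simp only [← neg_mul]
      rw [integral_exp_mul_Ioi (by linarith), mul_zero, Real.exp_zero, neg_div_neg_eq]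
    rw [integral_mul_const, h2, ← mul_assoc, ← Complex.ofReal_mul]
    congr 2
    ring
  · have hm : AEStronglyMeasurable (Function.uncurry fun s ρ : ℝ =>
        (Real.exp (-((ρ ^ N + σ) * s)) : ℂ) * ((ρ ^ (N - 1) : ℝ) *
        resolventProd N p (ρ * Complex.exp (φ * Complex.I)))) quadrantMeasure := by
      rw [quadrantMeasure, Measure.prod_restrict]
      refine ContinuousOn.aestronglyMeasurable ?_ (measurableSet_Ioi.prod measurableSet_Ioi)
      refine (Continuous.continuousOn (by fun_prop)).mul
        ((Continuous.continuousOn (by fun_prop)).mul ?_)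
      exact (continuousOn_resolventProd_ray h0 hE hp hφ).comp continuousOn_snd
        fun q hq => Ioi_subset_Ici_self hq.2
    refine (integrable_prod_iff' hm).2 ⟨?_, ?_⟩
    · refine (ae_restrict_iff' measurableSet_Ioi).2 (Eventually.of_forall fun ρ hρ => ?_)
      have hpos : 0 < ρ ^ N + σ := by have := pow_pos (mem_Ioi.1 hρ) N; positivity
      have h3 : Integrable (fun s : ℝ => (Real.exp (-((ρ ^ N + σ) * s)) : ℂ))
        (volume.restrict (Ioi 0)) := Integrable.ofReal (integrableOn_exp_neg_mul hpos)
      exact h3.mul_const ((ρ ^ (N - 1) : ℝ) *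
        resolventProd N p (ρ * Complex.exp (φ * Complex.I)))
    · refine IntegrableOn.congr_fun (Integrable.norm
        (integrableOn_resolventProd_ray hN hE hp hφ hσ)) (fun ρ hρ => ?_) measurableSet_Ioi
      have hρ0 : 0 < ρ := hρ
      have hpos : 0 < ρ ^ N + σ := by positivity
      simp only [Function.uncurry, norm_mul, Complex.norm_real,
        Real.norm_of_nonneg (Real.exp_pos _).le]
      rw [integral_mul_const]
      simp only [← neg_mul]
      rw [integral_exp_mul_Ioi (by linarith), mul_zero, Real.exp_zero, neg_div_neg_eq,
        Real.norm_of_nonneg (by positivity), Real.norm_of_nonneg (by positivity), ← mul_assoc]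
      congr 1
      ring

theorem integrable_exp_mul_halfDensity {N : ℕ} (hN : 2 ≤ N) (hE : Even N) {σ : ℝ} (hσ : 0 < σ)
    {p : ℂ} (hp : 0 ≤ p.re) : Integrable (fun q : ℝ × ℝ => (Real.exp (-(σ * q.1)) : ℂ) *
      (Complex.exp (-p * q.2) * halfDensity N q.1 q.2)) quadrantMeasure := by
  obtain ⟨C, hC, hb⟩ := exists_abs_halfDensity_le hN hE
  exact integrable_exp_mul_of_le_scaledBound hN hE hσ
    (g := fun s x => halfDensity N s x)
    (Complex.continuous_ofReal.comp_continuousOn (continuousOn_halfDensity hN hE))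
    (fun s x hs hx => by rw [Complex.norm_real]; exact hb s x hs hx) hp

theorem integral_quadrant_halfDensity_of_pos {N : ℕ} (hN : 2 ≤ N) (hE : Even N) {σ : ℝ}
    (hσ : 0 < σ) {p : ℂ} (hp : 0 < p.re) :
    ∫ q, (Real.exp (-(σ * q.1)) : ℂ) * (Complex.exp (-p * q.2) * halfDensity N q.1 q.2)
      ∂quadrantMeasure = resolventProd N p ((σ ^ (1 / (N : ℝ)) : ℝ)) := by
  have h0 : 0 < N := by omega
  have hπ : |Real.pi / N| ≤ Real.pi / N := by rw [abs_of_nonneg (by positivity)]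
  have hi : ∀ {φ : ℝ}, |φ| ≤ Real.pi / N → Integrable (fun q : ℝ × ℝ =>
      (Real.exp (-(σ * q.1)) : ℂ) * (Complex.exp (-p * q.2) * sectorSum N φ q.1 q.2))
      quadrantMeasure := fun hφ => by
    obtain ⟨C, hC, hb⟩ := exists_norm_sectorSum_le hN hE hφ
    exact integrable_exp_mul_of_le_scaledBound hN hE hσ (continuousOn_sectorSum hN hE hφ) hb hp.le
  have h1 : ∀ q : ℝ × ℝ, (Real.exp (-(σ * q.1)) : ℂ) *
      (Complex.exp (-p * q.2) * halfDensity N q.1 q.2) = N / (2 * Real.pi * Complex.I) *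
      ((Real.exp (-(σ * q.1)) : ℂ) * (Complex.exp (-p * q.2) * sectorSum N (-(Real.pi / N)) q.1 q.2) -
      (Real.exp (-(σ * q.1)) : ℂ) * (Complex.exp (-p * q.2) * sectorSum N (Real.pi / N) q.1 q.2)) := by
    intro q
    rw [ofReal_halfDensity h0]
    ring
  simp only [h1]
  rw [integral_const_mul, integral_sub (hi (abs_neg_pi_div_le N)) (hi hπ),
    integral_quadrant_sectorSum hN hE hσ (abs_neg_pi_div_le N) hp,
    integral_quadrant_sectorSum hN hE hσ hπ hp,
    ← integral_sub (integrableOn_resolventProd_ray hN hE hp (abs_neg_pi_div_le N) hσ)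
      (integrableOn_resolventProd_ray hN hE hp hπ hσ)]
  simp only [← mul_sub]
  rw [integral_resolventProd_sector hN hE hp hσ]
  have hπC : (Real.pi : ℂ) ≠ 0 := by exact_mod_cast Real.pi_ne_zero
  have hNC : (N : ℂ) ≠ 0 := by exact_mod_cast h0.ne'
  have := Complex.I_ne_zero
  field_simp

theorem add_mul_root_ne_zero {N : ℕ} (hN : 0 < N) {y : ℝ} (hy : 0 < y) {p c : ℂ}
    (hp : 0 ≤ p.re) (hc : c ∈ rootsJ N) : (y + p * c : ℂ) ≠ 0 := by
  have hc0 := ne_zero_of_mem_rootsJ hN hc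
  intro h
  have h1 : y * c⁻¹ + p = 0 := by
    field_simp
    linear_combination h
  have h2 := congrArg Complex.re h1
  rw [Complex.add_re, Complex.re_ofReal_mul, inv_eq_conj_of_mem_rootsJ hN hc, Complex.conj_re,
    Complex.zero_re] at h2
  have := mul_pos hy ((mem_rootsJ hN).1 hc).2
  linarith

/-- The double Laplace transform of `halfDensity`. -/
theorem integral_quadrant_halfDensity {N : ℕ} (hN : 2 ≤ N) (hE : Even N) {σ : ℝ}
    (hσ : 0 < σ) {p : ℂ} (hp : 0 ≤ p.re) :
    ∫ q, (Real.exp (-(σ * q.1)) : ℂ) * (Complex.exp (-p * q.2) * halfDensity N q.1 q.2)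
      ∂quadrantMeasure = resolventProd N p ((σ ^ (1 / (N : ℝ)) : ℝ)) := by
  have h0 : 0 < N := by omega
  have hy : 0 < σ ^ (1 / (N : ℝ)) := Real.rpow_pos_of_pos hσ _
  -- The contour argument needs `Re p > 0`, while the Fourier transform needs imaginary `p`. The
  -- latter is reached from the right, dominated by the integrand at `p = 0`.
  have hε : Tendsto (fun n : ℕ => p + ((1 / ((n : ℝ) + 1) : ℝ) : ℂ)) atTop (𝓝 p) := by
    have := (Complex.continuous_ofReal.tendsto 0).comp
      (tendsto_one_div_add_atTop_nhds_zero_nat (𝕜 := ℝ))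
    simpa using this.const_add p
  have hre : ∀ n : ℕ, 0 < (p + ((1 / ((n : ℝ) + 1) : ℝ) : ℂ)).re := fun n => by
    rw [Complex.add_re, Complex.ofReal_re]
    positivity
  have hlim : Tendsto (fun n : ℕ => resolventProd N (p + ((1 / ((n : ℝ) + 1) : ℝ) : ℂ))
      ((σ ^ (1 / (N : ℝ)) : ℝ))) atTop (𝓝 (resolventProd N p ((σ ^ (1 / (N : ℝ)) : ℝ)))) := by
    unfold resolventProd
    refine tendsto_finsetProd _ fun c hc => Tendsto.inv₀ ?_ (add_mul_root_ne_zero h0 hy hp hc)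
    exact (hε.mul_const c).const_add _
  simp only [← integral_quadrant_halfDensity_of_pos hN hE hσ (hre _)] at hlim
  refine tendsto_nhds_unique ?_ hlim
  refine tendsto_integral_of_dominated_convergence
    (fun q : ℝ × ℝ => ‖(Real.exp (-(σ * q.1)) : ℂ) * (Complex.exp (-(0 : ℂ) * q.2) *
      halfDensity N q.1 q.2)‖)
    (fun n => (integrable_exp_mul_halfDensity hN hE hσ (hre n).le).1)
    (integrable_exp_mul_halfDensity hN hE hσ le_rfl).norm (fun n => ae_quadrant fun s x hs hx => ?_)
    (Eventually.of_forall fun q => ?_)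
  · rw [norm_mul, norm_mul, norm_mul, norm_mul]
    refine mul_le_mul_of_nonneg_left (mul_le_mul_of_nonneg_right ?_ (norm_nonneg _)) (norm_nonneg _)
    rw [neg_zero, zero_mul, Complex.exp_zero, norm_one]
    exact norm_exp_neg_mul_le (hre n).le hx.le
  · exact (((hε.neg.mul_const _).cexp).mul_const _).const_mul _

/-! ### The Laplace transform in time -/

theorem integral_exp_mul_rootSum {N : ℕ} (hN : 0 < N) {y p : ℝ} (hy : 0 < y) (hp : 0 < p) :
    IntegrableOn (fun x : ℝ => Complex.exp (-(p : ℂ) * x) *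
      ∑ c ∈ rootsJ N, vandermondeCoeff (rootsJ N) c * c * Complex.exp (-c * (y * x))) (Ioi 0) ∧
    ∫ x in Ioi (0 : ℝ), Complex.exp (-(p : ℂ) * x) *
      ∑ c ∈ rootsJ N, vandermondeCoeff (rootsJ N) c * c * Complex.exp (-c * (y * x)) =
      ∑ c ∈ rootsJ N, vandermondeCoeff (rootsJ N) c * c / (c * y + p) := by
  have hre : ∀ c ∈ rootsJ N, (-(c * y + p)).re < 0 := fun c hc => by
    have := mul_pos ((mem_rootsJ hN).1 hc).2 hy
    simp only [Complex.neg_re, Complex.add_re, Complex.re_mul_ofReal, Complex.ofReal_re]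
    linarith
  have h : ∀ x : ℝ, Complex.exp (-(p : ℂ) * x) *
      ∑ c ∈ rootsJ N, vandermondeCoeff (rootsJ N) c * c * Complex.exp (-c * (y * x)) =
      ∑ c ∈ rootsJ N, vandermondeCoeff (rootsJ N) c * c * Complex.exp (-(c * y + p) * x) := by
    intro x
    rw [Finset.mul_sum]
    refine Finset.sum_congr rfl fun c _ => ?_
    rw [mul_left_comm, ← Complex.exp_add]
    congr 2
    ring
  have hi : ∀ c ∈ rootsJ N, IntegrableOn (fun x : ℝ => vandermondeCoeff (rootsJ N) c * c *
      Complex.exp (-(c * y + p) * x)) (Ioi 0) := fun c hc =>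
    (integrableOn_exp_mul_complex_Ioi (hre c hc) 0).const_mul _
  simp only [h]
  refine ⟨integrable_finsetSum _ hi, ?_⟩
  rw [integral_finsetSum _ hi]
  refine Finset.sum_congr rfl fun c hc => ?_
  rw [integral_const_mul, integral_exp_mul_complex_Ioi (hre c hc), Complex.ofReal_zero, mul_zero,
    Complex.exp_zero, neg_div_neg_eq, mul_one_div]

/-- Both sides have the same Laplace transform in `x`, by the partial fractions of `∏ (y+pc)⁻¹`.
Injectivity gives the equality for almost every `x`, enough under a later integral. -/
theorem laplace_halfDensity {N : ℕ} (hN : 2 ≤ N) (hE : Even N) {σ : ℝ} (hσ : 0 < σ) :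
    ∀ᵐ x ∂(volume.restrict (Ioi (0 : ℝ))),
      ∫ s in Ioi (0 : ℝ), (Real.exp (-(σ * s)) : ℂ) * halfDensity N s x =
        (((σ ^ (1 / (N : ℝ)) : ℝ) : ℂ) ^ ((rootsJ N).card - 1))⁻¹ *
          ∑ c ∈ rootsJ N, vandermondeCoeff (rootsJ N) c * c *
            Complex.exp (-c * (((σ ^ (1 / (N : ℝ)) : ℝ) : ℂ) * x)) := by
  have h0 : 0 < N := by omega
  set y := σ ^ (1 / (N : ℝ)) with hy
  have hy0 : 0 < y := Real.rpow_pos_of_pos hσ _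
  have hyC : (y : ℂ) ≠ 0 := by exact_mod_cast hy0.ne'
  set R : ℝ → ℂ := fun x => ∑ c ∈ rootsJ N, vandermondeCoeff (rootsJ N) c * c *
            Complex.exp (-c * ((y : ℂ) * x)) with hR
  set L : ℝ → ℂ := fun x => ∫ s in Ioi (0 : ℝ), (Real.exp (-(σ * s)) : ℂ) * halfDensity N s x
  have hexp : ∀ p x : ℝ, Complex.exp (-(p * x : ℝ)) = Complex.exp (-(p : ℂ) * x) := fun p x => by
    push_cast; ring_nf
  have hL : ∀ p x : ℝ, Complex.exp (-(p : ℂ) * x) * L x =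
      ∫ s in Ioi (0 : ℝ), (Real.exp (-(σ * s)) : ℂ) *
        (Complex.exp (-(p : ℂ) * x) * halfDensity N s x) := by
    intro p x
    rw [← integral_const_mul]
    congr 1
    funext s
    ring
  have hLi : ∀ p : ℝ, 0 < p → IntegrableOn (fun x : ℝ => Complex.exp (-(p : ℂ) * x) * L x) (Ioi 0) ∧
      ∫ x in Ioi (0 : ℝ), Complex.exp (-(p : ℂ) * x) * L x = resolventProd N p y := by
    intro p hp
    have hint := integrable_exp_mul_halfDensity hN hE hσ (p := p) (by simpa using hp.le)
    simp only [hL]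
    exact ⟨hint.integral_prod_right, by
      rw [← integral_quadrant_halfDensity hN hE hσ (p := p) (by simpa using hp.le),
        integral_prod_symm _ hint]⟩
  have key := ae_eq_zero_of_laplace (g := fun x => L x - ((y : ℂ) ^ ((rootsJ N).card - 1))⁻¹ * R x)
    (σ := 1) ?_ ?_
  · filter_upwards [key] with x hx
    exact sub_eq_zero.1 hx
  · simp only [hexp, mul_sub, mul_left_comm _ ((y : ℂ) ^ ((rootsJ N).card - 1))⁻¹]
    exact (hLi 1 one_pos).1.sub ((integral_exp_mul_rootSum h0 hy0 one_pos).1.const_mul _)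
  · intro p hp
    have hp0 : 0 < p := by linarith
    simp only [hexp, mul_sub, mul_left_comm _ ((y : ℂ) ^ ((rootsJ N).card - 1))⁻¹]
    rw [integral_sub (hLi p hp0).1 ((integral_exp_mul_rootSum h0 hy0 hp0).1.const_mul _),
      integral_const_mul, (hLi p hp0).2, (integral_exp_mul_rootSum h0 hy0 hp0).2,
      sum_vandermondeCoeff_mul_div h0 hE hyC
        fun c hc => add_mul_root_ne_zero h0 hy0 (by simpa using hp0.le) hc, resolventProd]
    field_simp
    ring

/-! ### Mittag-Leffler functions -/

/-- The Mittag-Leffler function `E_{1,b}` on the real line. -/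
noncomputable def mittagLefflerOne (b z : ℝ) : ℝ := ∑' r : ℕ, z ^ r / Real.Gamma (r + b)

theorem mittagLeffler_one_ofReal (b z : ℝ) : mittagLeffler 1 b z = mittagLefflerOne b z := by
  rw [mittagLeffler, mittagLefflerOne, Complex.ofReal_tsum]
  simp

/-- `Γ(r+b)` arises from `Γ(b)` by factors `b+j ≥ (j+1)/2`, as `b ≥ 1/2`. The indices `(m+N/2)/N`
used later satisfy this. -/
theorem Gamma_mul_factorial_le {b : ℝ} (hb : 1 / 2 ≤ b) (r : ℕ) :
    Real.Gamma b * r.factorial ≤ 2 ^ r * Real.Gamma (r + b) := by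
  induction r with
  | zero => simp
  | succ r ih =>
    have hr : 0 < (r : ℝ) + b := by positivity
    have h1 : ((r + 1 : ℕ) : ℝ) + b = (r + b) + 1 := by push_cast; ring
    rw [h1, Real.Gamma_add_one hr.ne', Nat.factorial_succ, pow_succ]
    have h2 : 0 < Real.Gamma (r + b) := Real.Gamma_pos_of_pos hr
    have h3 : (0 : ℝ) < 2 ^ r * Real.Gamma (r + b) := by positivity
    have h4 : (r : ℝ) + 1 ≤ 2 * (r + b) := by linarith [Nat.cast_nonneg (α := ℝ) r]
    push_cast
    calc Real.Gamma b * ((r + 1) * r.factorial) = (r + 1) * (Real.Gamma b * r.factorial) := by ring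
      _ ≤ (2 * (r + b)) * (2 ^ r * Real.Gamma (r + b)) := by gcongr
      _ = _ := by ring

theorem norm_mittagLeffler_term_le {b : ℝ} (hb : 1 / 2 ≤ b) {z R : ℝ} (hz : |z| ≤ R) (r : ℕ) :
    ‖z ^ r / Real.Gamma (r + b)‖ ≤ (Real.Gamma b)⁻¹ * ((2 * R) ^ r / r.factorial) := by
  have hb0 : 0 < b := by linarith
  have hr : 0 < (r : ℝ) + b := by positivity
  have h1 := Real.Gamma_pos_of_pos hr
  have h2 := Real.Gamma_pos_of_pos hb0
  have hR : 0 ≤ R := (abs_nonneg z).trans hz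
  rw [norm_div, norm_pow, Real.norm_eq_abs, Real.norm_of_nonneg h1.le, inv_mul_eq_div,
    div_div, div_le_div_iff₀ h1 (by positivity), mul_pow]
  have h3 := Gamma_mul_factorial_le hb r
  calc |z| ^ r * (r.factorial * Real.Gamma b) ≤ R ^ r * (2 ^ r * Real.Gamma (r + b)) := by
        rw [mul_comm (r.factorial : ℝ)]
        gcongr
    _ = _ := by ring

theorem summable_mittagLeffler_bound (b R : ℝ) :
    Summable fun r : ℕ => (Real.Gamma b)⁻¹ * ((2 * R) ^ r / r.factorial) :=
  (Real.summable_pow_div_factorial _).mul_left _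

theorem abs_mittagLefflerOne_le {b : ℝ} (hb : 1 / 2 ≤ b) {z : ℝ} (hz : 0 ≤ z) :
    |mittagLefflerOne b z| ≤ (Real.Gamma b)⁻¹ * Real.exp (2 * z) := by
  rw [← Real.norm_eq_abs]
  have h := tsum_of_norm_bounded (summable_mittagLeffler_bound b z).hasSum
    (norm_mittagLeffler_term_le hb (abs_of_nonneg hz).le)
  rw [tsum_mul_left, ← congrFun NormedSpace.exp_eq_tsum_div (2 * z), ← Real.exp_eq_exp_ℝ] at h
  exact h

theorem continuous_mittagLefflerOne {b : ℝ} (hb : 1 / 2 ≤ b) : Continuous (mittagLefflerOne b) := by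
  refine continuous_iff_continuousAt.2 fun z => ?_
  have h : ContinuousOn (mittagLefflerOne b) (Metric.ball 0 (|z| + 1)) := by
    unfold mittagLefflerOne
    refine continuousOn_tsum (fun r => by fun_prop) (summable_mittagLeffler_bound b (|z| + 1))
      fun r x hx => norm_mittagLeffler_term_le hb ?_ r
    rw [mem_ball_zero_iff, Real.norm_eq_abs] at hx
    exact hx.le
  exact h.continuousAt (Metric.isOpen_ball.mem_nhds (by simp))

/-- Termwise Gamma integrals sum to a geometric series in `λ/σ`. The margin `σ ≥ 3λ` accommodates
the crude bound `e^{2λs}` and is harmless: Laplace injectivity needs only large `σ`. -/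
theorem laplace_mittagLefflerOne {b lam σ : ℝ} (hb : 1 / 2 ≤ b) (hl : 0 < lam)
    (hσ : 3 * lam ≤ σ) :
    IntegrableOn (fun s => Real.exp (-(σ * s)) * (s ^ (b - 1) * mittagLefflerOne b (lam * s)))
      (Ioi 0) ∧
    ∫ s in Ioi (0 : ℝ), Real.exp (-(σ * s)) * (s ^ (b - 1) * mittagLefflerOne b (lam * s)) =
      σ ^ (1 - b) / (σ - lam) := by
  have hb0 : 0 < b := by linarith
  have hσ0 : 0 < σ := by linarith
  have hΓ := Real.Gamma_pos_of_pos hb0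
  constructor
  · have h1 : IntegrableOn (fun s : ℝ => (Real.Gamma b)⁻¹ *
        (s ^ (b - 1) * Real.exp (-(σ - 2 * lam) * s ^ (1 : ℝ)))) (Ioi 0) :=
      (integrableOn_rpow_mul_exp_neg_mul_rpow (by linarith) one_pos (by linarith)).const_mul _
    refine h1.mono' (ContinuousOn.aestronglyMeasurable ?_ measurableSet_Ioi)
      ((ae_restrict_iff' measurableSet_Ioi).2 (Eventually.of_forall fun s hs => ?_))
    · refine (Continuous.continuousOn (by fun_prop)).mul (ContinuousOn.mul ?_ ?_)
      · exact continuousOn_id.rpow_const fun s hs => Or.inl (ne_of_gt hs)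
      · exact ((continuous_mittagLefflerOne hb).comp (continuous_const_mul lam)).continuousOn
    · have hs0 : 0 < s := hs
      rw [norm_mul, norm_mul, Real.norm_of_nonneg (Real.exp_pos _).le,
        Real.norm_of_nonneg (Real.rpow_nonneg hs0.le _), Real.norm_eq_abs, Real.rpow_one]
      have h2 := abs_mittagLefflerOne_le hb (mul_pos hl hs0).le
      have h3 : Real.exp (-(σ - 2 * lam) * s) = Real.exp (-(σ * s)) * Real.exp (2 * (lam * s)) := by
        rw [← Real.exp_add]; ring_nf
      rw [h3]
      have h4 : 0 ≤ Real.exp (-(σ * s)) * s ^ (b - 1) := by positivity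
      nlinarith [mul_le_mul_of_nonneg_left h2 h4]
  · set F : ℕ → ℝ → ℝ := fun r s =>
      Real.exp (-(σ * s)) * (s ^ (b - 1) * ((lam * s) ^ r / Real.Gamma (r + b))) with hF
    have hval : ∀ r, ∫ s in Ioi (0 : ℝ), F r s = (1 / σ) ^ b * (lam / σ) ^ r := by
      intro r
      have hr : 0 < (r : ℝ) + b := by positivity
      have hΓr := Real.Gamma_pos_of_pos hr
      have h1 : ∀ s ∈ Ioi (0 : ℝ), F r s = lam ^ r / Real.Gamma (r + b) *
          (s ^ ((r + b) - 1) * Real.exp (-(σ * s))) := by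
        intro s hs
        have : s ^ ((r : ℝ) + b - 1) = s ^ (b - 1) * s ^ r := by
          rw [← Real.rpow_natCast, ← Real.rpow_add hs]; ring_nf
        simp only [this, hF, mul_pow]
        ring
      rw [setIntegral_congr_fun measurableSet_Ioi h1, integral_const_mul,
        Real.integral_rpow_mul_exp_neg_mul_Ioi hr hσ0, Real.rpow_add (by positivity),
        Real.rpow_natCast, div_pow, div_pow, one_pow]
      field_simp
    have hpos : ∀ r, ∀ s ∈ Ioi (0 : ℝ), 0 ≤ F r s := by
      intro r s hs
      have hs0 : 0 < s := hs
      have hr : 0 < (r : ℝ) + b := by positivity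
      have hΓr := Real.Gamma_pos_of_pos hr
      positivity
    have hval0 : ∀ r, 0 < (1 / σ) ^ b * (lam / σ) ^ r := fun r => by positivity
    have hgeo : lam / σ < 1 := by rw [div_lt_one hσ0]; linarith
    have hsum : HasSum (fun r : ℕ => (1 / σ) ^ b * (lam / σ) ^ r)
        ((1 / σ) ^ b * (1 - lam / σ)⁻¹) :=
      (hasSum_geometric_of_lt_one (by positivity) hgeo).mul_left _
    have h := hasSum_integral_of_summable_integral_norm (μ := volume.restrict (Ioi 0)) (F := F)
      (fun r => .of_integral_ne_zero (by rw [hval]; exact (hval0 r).ne')) (by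
        refine hsum.summable.congr fun r => ?_
        rw [← hval]
        exact setIntegral_congr_fun measurableSet_Ioi fun s hs =>
          (Real.norm_of_nonneg (hpos r s hs)).symm)
    simp only [hval] at h
    have h2 := h.unique hsum
    have h3 : ∀ s : ℝ, ∑' r, F r s =
        Real.exp (-(σ * s)) * (s ^ (b - 1) * mittagLefflerOne b (lam * s)) := by
      intro s
      rw [mittagLefflerOne, ← tsum_mul_left, ← tsum_mul_left]
    simp only [h3] at h2
    rw [h2, one_div, Real.inv_rpow hσ0.le, Real.rpow_sub hσ0, Real.rpow_one]
    have h4 : σ - lam ≠ 0 := by intro h; linarith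
    have h5 : 1 - lam / σ ≠ 0 := by linarith
    field_simp

/-! ### The Laplace transform in space -/

/-- For `s` in a compact subset of `(0,∞)` the powers of `s` are bounded above and away from zero,
leaving one integrable majorant for dominated convergence. -/
theorem exists_scaledBound_le (N : ℕ) {u v : ℝ} (hu : 0 < u) :
    ∃ C : ℝ, 0 ≤ C ∧ ∀ s ∈ Icc u v, ∀ x, scaledBound N s x ≤ C * (1 + x ^ 2)⁻¹ := by
  set γ : ℝ := -(1 / (N : ℝ)) with hγ
  have hγ0 : γ ≤ 0 := by rw [hγ, neg_nonpos]; positivity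
  rcases lt_or_ge v u with huv | huv
  · exact ⟨0, le_rfl, fun s hs => absurd (hs.1.trans hs.2) (not_le.2 huv)⟩
  have hv : 0 < v := hu.trans_le huv
  set k := min 1 ((v ^ γ) ^ 2) with hk
  have hk0 : 0 < k := lt_min one_pos (by positivity)
  refine ⟨(u ^ γ) ^ (N / 2 + 1) / k, by positivity, fun s hs x => ?_⟩
  have hs0 : 0 < s := hu.trans_le hs.1
  have h1 : s ^ γ ≤ u ^ γ := Real.rpow_le_rpow_of_nonpos hu hs.1 hγ0
  have h2 : v ^ γ ≤ s ^ γ := Real.rpow_le_rpow_of_nonpos hs0 hs.2 hγ0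
  have hsγ : 0 < s ^ γ := Real.rpow_pos_of_pos hs0 _
  have hvγ : 0 < v ^ γ := Real.rpow_pos_of_pos hv _
  rw [scaledBound, ← hγ, ← div_eq_mul_inv, div_div]
  refine div_le_div₀ (by positivity) (by gcongr) (by positivity) ?_
  have h3 : k ≤ 1 := min_le_left _ _
  have h4 : k ≤ (s ^ γ) ^ 2 := (min_le_right _ _).trans (by gcongr)
  rw [mul_pow]
  nlinarith [sq_nonneg x]

theorem continuousOn_integral_exp_mul_halfDensity {N : ℕ} (hN : 2 ≤ N) (hE : Even N) {p : ℂ}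
    (hp : 0 ≤ p.re) : ContinuousOn
      (fun s : ℝ => ∫ x in Ioi (0 : ℝ), Complex.exp (-p * x) * halfDensity N s x) (Ioi 0) := by
  obtain ⟨C, hC, hb⟩ := exists_abs_halfDensity_le hN hE
  refine continuousOn_of_forall_continuousAt fun s hs => ?_
  have hs0 : 0 < s := hs
  obtain ⟨K, hK, hbK⟩ := exists_scaledBound_le N (u := s / 2) (v := 2 * s) (by positivity)
  have hnhds : ∀ᶠ s' in 𝓝 s, s' ∈ Icc (s / 2) (2 * s) :=
    Icc_mem_nhds (by linarith) (by linarith)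
  refine continuousAt_of_dominated (bound := fun x => C * (K * (1 + x ^ 2)⁻¹)) ?_ ?_
    ((integrable_inv_one_add_sq.const_mul K).const_mul C).integrableOn ?_
  · filter_upwards [hnhds] with s' hs'
    refine ContinuousOn.aestronglyMeasurable ?_ measurableSet_Ioi
    refine (Continuous.continuousOn (by fun_prop)).mul
      (Complex.continuous_ofReal.comp_continuousOn ?_)
    exact (continuousOn_halfDensity hN hE).comp (f := fun x : ℝ => (s', x)) (by fun_prop)
      fun x hx => ⟨(half_pos hs0).trans_le hs'.1, Ioi_subset_Ici_self hx⟩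
  · filter_upwards [hnhds] with s' hs'
    refine (ae_restrict_iff' measurableSet_Ioi).2 (Eventually.of_forall fun x hx => ?_)
    rw [norm_mul, Complex.norm_real]
    refine (mul_le_of_le_one_left (norm_nonneg _) (norm_exp_neg_mul_le hp (le_of_lt hx))).trans ?_
    exact (hb s' x ((half_pos hs0).trans_le hs'.1) (le_of_lt hx)).trans
      (mul_le_mul_of_nonneg_left (hbK s' hs' x) hC)
  · refine (ae_restrict_iff' measurableSet_Ioi).2 (Eventually.of_forall fun x hx => ?_)
    refine continuousAt_const.mul (Complex.continuous_ofReal.continuousAt.comp ?_)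
    have h := (continuousOn_halfDensity hN hE).continuousAt (x := (s, x))
      (prod_mem_nhds (Ioi_mem_nhds hs0) (Ici_mem_nhds hx))
    exact h.comp (f := fun s : ℝ => (s, x)) (by fun_prop)

/-- Multiplying and dividing by the complementary product `∏_J (y - clθ)` gives the denominator `y^N
- κ(cl)^N = y^N - l^N`, because `c^N = κ` and `κ² = 1`. The numerator is `y^{#K} ∏_K (1 - θq)` with
`q = -cl/y`, expanded by `prod_rootsK_eq_sum_alpha`. -/
theorem resolventProd_eq_sum_alpha {N : ℕ} (hN : 0 < N) (hE : Even N) {y l : ℝ} (hy : 0 < y)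
    (hne : (y : ℂ) ^ N - (l : ℂ) ^ N ≠ 0) {c : ℂ} (hc : c ∈ rootsJ N) :
    resolventProd N (c * l) y = ∑ m ∈ Finset.range ((rootsK N).card + 1),
      alpha N (-(m : ℤ)) * (-c) ^ m * ((l : ℂ) ^ m * ((y : ℂ) ^ ((rootsK N).card - m) /
        ((y : ℂ) ^ N - (l : ℂ) ^ N))) := by
  have hyC : (y : ℂ) ≠ 0 := by exact_mod_cast hy.ne'
  have hκ : kappa N * (c * l) ^ N = (l : ℂ) ^ N := by
    rw [mul_pow, ((mem_rootsJ hN).1 hc).1, ← mul_assoc, kappa_mul_self, one_mul]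
  have h1 := prod_sub_mul_roots hN hE (y : ℂ) (c * l)
  rw [hκ] at h1
  have h2 : ∏ θ ∈ rootsK N, ((y : ℂ) - c * l * θ) = (resolventProd N (c * l) y)⁻¹ := by
    rw [prod_rootsK hN hE, resolventProd, Finset.prod_inv_distrib, inv_inv]
    exact Finset.prod_congr rfl fun θ _ => by ring
  have h3 : ∏ θ ∈ rootsJ N, ((y : ℂ) - c * l * θ) = (y : ℂ) ^ (rootsK N).card *
      ∏ θ ∈ rootsK N, (1 - θ * (-c * l / y)) := by
    rw [prod_rootsK hN hE, card_rootsK hN hE, ← Finset.prod_const, ← Finset.prod_mul_distrib]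
    refine Finset.prod_congr rfl fun θ _ => ?_
    field_simp
  rw [h2, h3, prod_rootsK_eq_sum_alpha hN hE] at h1
  have hR : resolventProd N (c * l) y ≠ 0 := fun h => hne (by rw [← h1, h]; simp)
  have h4 : resolventProd N (c * l) y = ((y : ℂ) ^ (rootsK N).card *
      ∑ m ∈ Finset.range ((rootsK N).card + 1), alpha N (-(m : ℤ)) * (-c * l / y) ^ m) /
        ((y : ℂ) ^ N - (l : ℂ) ^ N) := by
    rw [eq_div_iff hne, ← h1]
    field_simp
  rw [h4, Finset.mul_sum, Finset.sum_div]
  refine Finset.sum_congr rfl fun m hm => ?_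
  have hm' : m ≤ (rootsK N).card := by rw [Finset.mem_range] at hm; omega
  have h5 : (y : ℂ) ^ (rootsK N).card = (y : ℂ) ^ ((rootsK N).card - m) * (y : ℂ) ^ m := by
    rw [← pow_add]; congr 1; omega
  rw [h5]
  simp only [div_pow, mul_pow]
  field_simp

/-- The Laplace transforms in `s` of both sides agree for `σ ≥ 3λ`: each `σ^{(#K-m)/N}/(σ-λ)` is
that of `s^{b-1} E_{1,b}(λs)` with `b = (m+#J)/N`. -/
theorem integral_exp_mul_halfDensity {N : ℕ} (hN : 2 ≤ N) (hE : Even N) {lam s : ℝ} (hl : 0 < lam)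
    (hs : 0 < s) {c : ℂ} (hc : c ∈ rootsJ N) :
    ∫ x in Ioi (0 : ℝ), Complex.exp (-(c * ((lam ^ (1 / (N : ℝ)) : ℝ) : ℂ)) * x) *
      halfDensity N s x = ((s ^ (-((rootsK N).card : ℝ) / N) : ℝ) : ℂ) *
      ∑ m ∈ Finset.range ((rootsK N).card + 1), alpha N (-(m : ℤ)) * (-c) ^ m *
        ((((lam * s) ^ ((m : ℝ) / N) : ℝ) : ℂ) *
          mittagLeffler 1 (((m : ℝ) + (rootsJ N).card) / N) ((lam * s : ℝ) : ℂ)) := by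
  have h0 : 0 < N := by omega
  have hN0 : (N : ℝ) ≠ 0 := by positivity
  set l := lam ^ (1 / (N : ℝ)) with hldef
  have hl0 : 0 < l := Real.rpow_pos_of_pos hl _
  have hlN : l ^ N = lam := rpow_one_div_natCast_pow hN hl
  have hM : ((rootsJ N).card : ℝ) = N / 2 := by
    rw [card_rootsJ h0 hE, Nat.cast_div hE.two_dvd (by norm_num)]; norm_num
  have hK : (rootsK N).card = (rootsJ N).card := card_rootsK h0 hE
  set b : ℕ → ℝ := fun m => ((m : ℝ) + (rootsJ N).card) / N with hb
  have hb2 : ∀ m, 1 / 2 ≤ b m := fun m => by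
    rw [hb]; simp only
    rw [hM, le_div_iff₀ (by positivity)]
    linarith [Nat.cast_nonneg (α := ℝ) m]
  set G : ℝ → ℂ := fun s => ∑ m ∈ Finset.range ((rootsK N).card + 1),
    alpha N (-(m : ℤ)) * (-c) ^ m * ((l : ℂ) ^ m *
      ((s ^ (b m - 1) * mittagLefflerOne (b m) (lam * s) : ℝ) : ℂ)) with hG
  have hGs : ∀ s, 0 < s → ((s ^ (-((rootsK N).card : ℝ) / N) : ℝ) : ℂ) *
      ∑ m ∈ Finset.range ((rootsK N).card + 1), alpha N (-(m : ℤ)) * (-c) ^ m *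
        ((((lam * s) ^ ((m : ℝ) / N) : ℝ) : ℂ) *
          mittagLeffler 1 (((m : ℝ) + (rootsJ N).card) / N) ((lam * s : ℝ) : ℂ)) = G s := by
    intro s hs
    rw [hG, Finset.mul_sum]
    refine Finset.sum_congr rfl fun m _ => ?_
    rw [mittagLeffler_one_ofReal, Real.mul_rpow hl.le hs.le]
    have h1 : lam ^ ((m : ℝ) / N) = l ^ m := by
      rw [hldef, ← Real.rpow_natCast, ← Real.rpow_mul hl.le]; ring_nf
    have h2 : s ^ (b m - 1) = s ^ (-((rootsK N).card : ℝ) / N) * s ^ ((m : ℝ) / N) := by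
      rw [← Real.rpow_add hs, hK, hb]
      simp only [hM]
      congr 1
      field_simp
      ring
    rw [h1, h2]
    push_cast
    ring
  rw [hGs s hs]
  have hpre : 0 ≤ (c * (l : ℂ)).re := by
    rw [Complex.re_mul_ofReal]
    exact mul_nonneg ((mem_rootsJ h0).1 hc).2.le hl0.le
  have hGc : ContinuousOn G (Ioi 0) := by
    refine continuousOn_finsetSum _ fun m _ => continuousOn_const.mul (continuousOn_const.mul
      (Complex.continuous_ofReal.comp_continuousOn (ContinuousOn.mul ?_ ?_)))
    · exact continuousOn_id.rpow_const fun s hs => Or.inl (ne_of_gt hs)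
    · exact ((continuous_mittagLefflerOne (hb2 m)).comp (continuous_const_mul lam)).continuousOn
  -- Laplace injectivity gives almost every `s`; continuity of both sides upgrades this to every `s
  -- > 0`.
  refine Measure.eqOn_open_of_ae_eq (μ := volume) ?_ isOpen_Ioi
    (continuousOn_integral_exp_mul_halfDensity hN hE hpre) hGc (mem_Ioi.2 hs)
  have hexp : ∀ σ s : ℝ, Complex.exp (-(σ * s : ℝ)) = (Real.exp (-(σ * s)) : ℂ) := fun σ s => by
    rw [Complex.ofReal_exp, Complex.ofReal_neg]
  set A : ℝ → ℂ := fun s => ∫ x in Ioi (0 : ℝ), Complex.exp (-(c * (l : ℂ)) * x) * halfDensity N s x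
  have hA : ∀ σ, 0 < σ → IntegrableOn (fun s => (Real.exp (-(σ * s)) : ℂ) * A s) (Ioi 0) ∧
      ∫ s in Ioi (0 : ℝ), (Real.exp (-(σ * s)) : ℂ) * A s =
        resolventProd N (c * l) ((σ ^ (1 / (N : ℝ)) : ℝ)) := by
    intro σ hσ
    have hint := integrable_exp_mul_halfDensity hN hE hσ hpre
    rw [← integral_quadrant_halfDensity hN hE hσ hpre, integral_prod _ hint]
    simp only [A, ← integral_const_mul]
    exact ⟨hint.integral_prod_left, trivial⟩
  have hGi : ∀ σ, 3 * lam ≤ σ → ∀ m : ℕ, IntegrableOn (fun s : ℝ => alpha N (-(m : ℤ)) * (-c) ^ m *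
      ((l : ℂ) ^ m * ((Real.exp (-(σ * s)) * (s ^ (b m - 1) *
        mittagLefflerOne (b m) (lam * s)) : ℝ) : ℂ))) (Ioi 0) := by
    intro σ hσ m
    have h1 : Integrable (fun s : ℝ => ((Real.exp (-(σ * s)) * (s ^ (b m - 1) *
        mittagLefflerOne (b m) (lam * s)) : ℝ) : ℂ)) (volume.restrict (Ioi 0)) :=
      Integrable.ofReal (laplace_mittagLefflerOne (hb2 m) hl hσ).1
    exact (h1.const_mul _).const_mul _
  have hGmul : ∀ σ s : ℝ, (Real.exp (-(σ * s)) : ℂ) * G s =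
      ∑ m ∈ Finset.range ((rootsK N).card + 1), alpha N (-(m : ℤ)) * (-c) ^ m *
      ((l : ℂ) ^ m * ((Real.exp (-(σ * s)) * (s ^ (b m - 1) *
        mittagLefflerOne (b m) (lam * s)) : ℝ) : ℂ)) := by
    intro σ s
    rw [hG, Finset.mul_sum]
    refine Finset.sum_congr rfl fun m _ => ?_
    push_cast
    ring
  have key := ae_eq_zero_of_laplace (g := fun s => A s - G s) (σ := 3 * lam) ?_ ?_
  · filter_upwards [key] with s hs
    exact sub_eq_zero.1 hs
  · simp only [hexp, mul_sub, hGmul]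
    exact (hA _ (by positivity)).1.sub (integrable_finsetSum _ fun m _ => hGi _ le_rfl m)
  · intro σ hσ
    have hσ0 : 0 < σ := by linarith
    set y := σ ^ (1 / (N : ℝ)) with hy
    have hy0 : 0 < y := Real.rpow_pos_of_pos hσ0 _
    have hyN : y ^ N = σ := rpow_one_div_natCast_pow hN hσ0
    have hne : σ - lam ≠ 0 := by intro h; linarith
    have hneC : (y : ℂ) ^ N - (l : ℂ) ^ N ≠ 0 := by
      rw [← Complex.ofReal_pow, ← Complex.ofReal_pow, hyN, hlN]
      exact_mod_cast hne
    simp only [hexp, mul_sub, hGmul]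
    rw [integral_sub (hA σ hσ0).1 (integrable_finsetSum _ fun m _ => hGi σ hσ m), (hA σ hσ0).2,
      integral_finsetSum _ fun m _ => hGi σ hσ m,
      resolventProd_eq_sum_alpha h0 hE hy0 hneC hc, sub_eq_zero]
    refine Finset.sum_congr rfl fun m hm => ?_
    have hm' : m ≤ (rootsK N).card := by rw [Finset.mem_range] at hm; omega
    rw [integral_const_mul, integral_const_mul, integral_complex_ofReal,
      (laplace_mittagLefflerOne (hb2 m) hl hσ).2]
    have h1 : σ ^ (1 - b m) = y ^ ((rootsK N).card - m) := by
      rw [hy, ← Real.rpow_natCast, ← Real.rpow_mul hσ0.le, Nat.cast_sub hm', hK, hb]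
      simp only [hM]
      congr 1
      field_simp
      ring
    rw [h1, ← Complex.ofReal_pow y N, ← Complex.ofReal_pow l N, hyN, hlN]
    push_cast
    ring

/-! ### The joint density of sojourn time and position -/

/-- `halfDensity`, extended by `0` to the plane. -/
noncomputable def planeDensity (N : ℕ) : ℝ × ℝ → ℝ :=
  (Ioi (0 : ℝ) ×ˢ Ioi (0 : ℝ)).indicator fun q => halfDensity N q.1 q.2

theorem planeDensity_of_pos (N : ℕ) {s x : ℝ} (hs : 0 < s) (hx : 0 < x) :
    planeDensity N (s, x) = halfDensity N s x := by
  have h : ((s, x) : ℝ × ℝ) ∈ Ioi (0 : ℝ) ×ˢ Ioi (0 : ℝ) := ⟨hs, hx⟩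
  rw [planeDensity, indicator_of_mem h]

theorem planeDensity_of_fst_nonpos (N : ℕ) {s : ℝ} (hs : s ≤ 0) (x : ℝ) :
    planeDensity N (s, x) = 0 :=
  indicator_of_notMem (fun h => not_lt.2 hs h.1) _

theorem planeDensity_of_snd_nonpos (N : ℕ) (s : ℝ) {x : ℝ} (hx : x ≤ 0) :
    planeDensity N (s, x) = 0 :=
  indicator_of_notMem (fun h => not_lt.2 hx h.2) _

theorem measurable_planeDensity {N : ℕ} (hN : 2 ≤ N) (hE : Even N) :
    Measurable (planeDensity N) := by
  classical
  rw [planeDensity, ← piecewise_eq_indicator]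
  exact ContinuousOn.measurable_piecewise
    ((continuousOn_halfDensity hN hE).mono (prod_mono_right Ioi_subset_Ici_self))
    continuousOn_const (measurableSet_Ioi.prod measurableSet_Ioi)

theorem continuousAt_planeDensity {N : ℕ} (hN : 2 ≤ N) (hE : Even N) {s x : ℝ} (hs : 0 < s)
    (hx : 0 < x) : ContinuousAt (planeDensity N) (s, x) := by
  have hnhds : Ioi (0 : ℝ) ×ˢ Ioi (0 : ℝ) ∈ 𝓝 (s, x) :=
    prod_mem_nhds (Ioi_mem_nhds hs) (Ioi_mem_nhds hx)
  refine (((continuousOn_halfDensity hN hE).mono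
    (prod_mono_right Ioi_subset_Ici_self)).continuousAt hnhds).congr ?_
  filter_upwards [hnhds] with q hq
  exact (planeDensity_of_pos N hq.1 hq.2).symm

theorem exists_abs_planeDensity_le {N : ℕ} (hN : 2 ≤ N) (hE : Even N) {u v : ℝ} (hu : 0 < u) :
    ∃ C : ℝ, 0 ≤ C ∧ ∀ s ∈ Icc u v, ∀ x, |planeDensity N (s, x)| ≤ C * (1 + x ^ 2)⁻¹ := by
  obtain ⟨C, hC, hb⟩ := exists_abs_halfDensity_le hN hE
  obtain ⟨K, hK, hbK⟩ := exists_scaledBound_le N (v := v) hu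
  refine ⟨C * K, by positivity, fun s hs x => ?_⟩
  rcases le_or_gt x 0 with hx | hx
  · rw [planeDensity_of_snd_nonpos N s hx, abs_zero]
    positivity
  · rw [planeDensity_of_pos N (hu.trans_le hs.1) hx, mul_assoc]
    exact (hb s x (hu.trans_le hs.1) hx.le).trans (mul_le_mul_of_nonneg_left (hbK s hs x) hC)

theorem integrable_exp_mul_planeDensity {N : ℕ} (hN : 2 ≤ N) (hE : Even N) {σ : ℝ} (hσ : 0 < σ)
    {p : ℂ} (hp : 0 ≤ p.re) :
    Integrable (fun q : ℝ × ℝ => (Real.exp (-(σ * q.1)) : ℂ) *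
      (Complex.exp (-p * q.2) * planeDensity N q)) ∧
    ∫ q : ℝ × ℝ, (Real.exp (-(σ * q.1)) : ℂ) * (Complex.exp (-p * q.2) * planeDensity N q) =
      resolventProd N p ((σ ^ (1 / (N : ℝ)) : ℝ)) := by
  have hm : MeasurableSet (Ioi (0 : ℝ) ×ˢ Ioi (0 : ℝ)) := measurableSet_Ioi.prod measurableSet_Ioi
  have h1 : (fun q : ℝ × ℝ => (Real.exp (-(σ * q.1)) : ℂ) *
      (Complex.exp (-p * q.2) * planeDensity N q)) = (Ioi (0 : ℝ) ×ˢ Ioi (0 : ℝ)).indicator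
        fun q => (Real.exp (-(σ * q.1)) : ℂ) * (Complex.exp (-p * q.2) * halfDensity N q.1 q.2) := by
    funext q
    by_cases hq : q ∈ Ioi (0 : ℝ) ×ˢ Ioi (0 : ℝ)
    · rw [indicator_of_mem hq, planeDensity, indicator_of_mem hq]
    · rw [indicator_of_notMem hq, planeDensity, indicator_of_notMem hq]
      simp
  have hμ : quadrantMeasure = (volume : Measure (ℝ × ℝ)).restrict (Ioi 0 ×ˢ Ioi 0) :=
    Measure.prod_restrict _ _
  rw [h1, integrable_indicator_iff hm, integral_indicator hm, IntegrableOn, ← hμ]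
  exact ⟨integrable_exp_mul_halfDensity hN hE hσ hp, integral_quadrant_halfDensity hN hE hσ hp⟩

/-- The joint density `P{T(t) ∈ ds, X(t) ∈ dx} / (ds dx)`. -/
noncomputable def jointDensity (N : ℕ) (t s x : ℝ) : ℝ :=
  ∫ y, planeDensity N (s, y) * planeDensity N (t - s, y - x)

theorem ofReal_jointDensity (N : ℕ) (t s x : ℝ) : (jointDensity N t s x : ℂ) =
    ∫ y, (planeDensity N (s, y) : ℂ) * planeDensity N (t - s, y - x) := by
  rw [jointDensity, ← integral_complex_ofReal]
  simp only [Complex.ofReal_mul]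

theorem jointDensity_of_le (N : ℕ) {t s : ℝ} (h : t ≤ s) (x : ℝ) : jointDensity N t s x = 0 := by
  simp [jointDensity, planeDensity_of_fst_nonpos N (sub_nonpos.2 h)]

theorem jointDensity_of_nonpos (N : ℕ) (t : ℝ) {s : ℝ} (h : s ≤ 0) (x : ℝ) :
    jointDensity N t s x = 0 := by
  simp [jointDensity, planeDensity_of_fst_nonpos N h]

/-- For `x ≤ 0` and `y > 0` both arguments of the second factor are positive, so the integrand never
meets the edge of the quadrant, where the extension by zero may jump. -/
theorem continuousOn_jointDensity {N : ℕ} (hN : 2 ≤ N) (hE : Even N) :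
    ContinuousOn (fun q : ℝ × ℝ × ℝ => jointDensity N q.1 q.2.1 q.2.2)
      {q : ℝ × ℝ × ℝ | 0 < q.2.1 ∧ q.2.1 < q.1 ∧ q.2.2 ≤ 0} := by
  refine continuousOn_of_forall_continuousAt fun q hq => ?_
  obtain ⟨t, s, x⟩ := q
  obtain ⟨hs, hst, hx⟩ := hq
  simp only at hs hst hx
  have hr : 0 < t - s := sub_pos.2 hst
  obtain ⟨C, hC, hbC⟩ := exists_abs_planeDensity_le hN hE (u := s / 2) (v := 2 * s) (by positivity)
  obtain ⟨K, hK, hbK⟩ := exists_abs_planeDensity_le hN hE (u := (t - s) / 2) (v := 2 * (t - s))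
    (by positivity)
  have h1 : ∀ᶠ q : ℝ × ℝ × ℝ in 𝓝 (t, s, x), q.2.1 ∈ Icc (s / 2) (2 * s) :=
    (continuous_fst.comp continuous_snd).continuousAt.eventually
      (Icc_mem_nhds (by simp; linarith) (by simp; linarith))
  have h2 : ∀ᶠ q : ℝ × ℝ × ℝ in 𝓝 (t, s, x), q.1 - q.2.1 ∈ Icc ((t - s) / 2) (2 * (t - s)) :=
    (continuous_fst.sub (continuous_fst.comp continuous_snd)).continuousAt.eventually
      (Icc_mem_nhds (by simp; linarith) (by simp; linarith))
  unfold jointDensity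
  have hm := measurable_planeDensity hN hE
  refine continuousAt_of_dominated (bound := fun y => C * (1 + y ^ 2)⁻¹ * K) ?_ ?_
    ((integrable_inv_one_add_sq.const_mul C).mul_const K) ?_
  · exact Eventually.of_forall fun q => ((hm.comp (by fun_prop)).mul
      (hm.comp (by fun_prop))).aestronglyMeasurable
  · filter_upwards [h1, h2] with q hq1 hq2
    refine Eventually.of_forall fun y => ?_
    rw [Real.norm_eq_abs, abs_mul]
    refine mul_le_mul (hbC _ hq1 y) ((hbK _ hq2 _).trans ?_) (abs_nonneg _) (by positivity)
    exact mul_le_of_le_one_right hK (inv_le_one_of_one_le₀ (by nlinarith [sq_nonneg (y - q.2.2)]))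
  · refine Eventually.of_forall fun y => ?_
    rcases le_or_gt y 0 with hy | hy
    · simp only [planeDensity_of_snd_nonpos N _ hy, zero_mul]
      exact continuousAt_const
    · refine ContinuousAt.mul ?_ ?_
      · exact ContinuousAt.comp (g := planeDensity N) (f := fun q : ℝ × ℝ × ℝ => (q.2.1, y))
          (continuousAt_planeDensity hN hE hs hy) (by fun_prop)
      · exact ContinuousAt.comp (g := planeDensity N)
          (f := fun q : ℝ × ℝ × ℝ => (q.1 - q.2.1, y - q.2.2))
          (continuousAt_planeDensity hN hE hr (by linarith)) (by fun_prop)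

/-! ### The transform of the joint density -/

/-- Regroups `((t,s,x),y)` as `((t,x),(s,y))`, so that the transform of the density becomes the
total integral of a planar convolution. -/
theorem measurePreserving_regroup : MeasurePreserving
    (fun q : (ℝ × ℝ × ℝ) × ℝ => ((q.1.1, q.1.2.2), (q.1.2.1, q.2))) := by
  have h1 : MeasurePreserving (fun q : (ℝ × ℝ) × ℝ => (q.1.2, (q.1.1, q.2))) :=
    (volume_preserving_prodAssoc (α₁ := ℝ) (β₁ := ℝ) (γ₁ := ℝ)).comp
      ((Measure.measurePreserving_swap (μ := (volume : Measure ℝ)) (ν := (volume : Measure ℝ))).prod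
        (MeasurePreserving.id (volume : Measure ℝ)))
  exact ((volume_preserving_prodAssoc (α₁ := ℝ) (β₁ := ℝ) (γ₁ := ℝ × ℝ)).symm).comp
    (((MeasurePreserving.id (volume : Measure ℝ)).prod h1).comp
      (volume_preserving_prodAssoc (α₁ := ℝ) (β₁ := ℝ × ℝ) (γ₁ := ℝ)))

/-- The exponential splits into `e^{-(λ+ν)s+iμy}` and `e^{-λ(t-s)+iμ(x-y)}`. Integration over `t, s,
x, y` is then that of a convolution on `ℝ²` of a tilted density with a reflected one, hence a
product of two double transforms. -/
theorem integral_exp_mul_jointDensity {N : ℕ} (hN : 2 ≤ N) (hE : Even N) {lam ν : ℝ}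
    (hl : 0 < lam) (hν : 0 < ν) (μ : ℝ) :
    Integrable (fun q : ℝ × ℝ × ℝ => Complex.exp (-(lam * q.1 : ℝ) + Complex.I * (μ * q.2.2 : ℝ) -
      (ν * q.2.1 : ℝ)) * (jointDensity N q.1 q.2.1 q.2.2 : ℂ)) ∧
    ∫ q : ℝ × ℝ × ℝ, Complex.exp (-(lam * q.1 : ℝ) + Complex.I * (μ * q.2.2 : ℝ) -
      (ν * q.2.1 : ℝ)) * (jointDensity N q.1 q.2.1 q.2.2 : ℂ) =
      resolventProd N (-(Complex.I * μ)) (((lam + ν) ^ (1 / (N : ℝ)) : ℝ)) *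
        resolventProd N (Complex.I * μ) ((lam ^ (1 / (N : ℝ)) : ℝ)) := by
  have hσ : 0 < lam + ν := by positivity
  obtain ⟨hi1, hv1⟩ := integrable_exp_mul_planeDensity hN hE hσ (p := -(Complex.I * μ)) (by simp)
  obtain ⟨hi2, hv2⟩ := integrable_exp_mul_planeDensity hN hE hl (p := Complex.I * μ) (by simp)
  have hneg : MeasurePreserving (fun q : ℝ × ℝ => (q.1, -q.2)) :=
    (MeasurePreserving.id (volume : Measure ℝ)).prod (Measure.measurePreserving_neg volume)
  set h1 : ℝ × ℝ → ℂ := fun q => (Real.exp (-((lam + ν) * q.1)) : ℂ) *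
    (Complex.exp (-(-(Complex.I * μ)) * q.2) * planeDensity N q) with hh1
  set k2 : ℝ × ℝ → ℂ := fun q => (Real.exp (-(lam * q.1)) : ℂ) *
    (Complex.exp (-(Complex.I * μ) * q.2) * planeDensity N q) with hk2
  set h2 : ℝ × ℝ → ℂ := fun q => k2 (q.1, -q.2) with hh2
  have hi2' : Integrable h2 := hneg.integrable_comp_of_integrable hi2
  have hv2' : ∫ q, h2 q = ∫ q, k2 q := by
    have h := integral_map (f := k2) hneg.measurable.aemeasurable
      (by rw [hneg.map_eq]; exact hi2.aestronglyMeasurable)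
    rw [hneg.map_eq] at h
    exact h.symm
  have hG := hi1.convolution_integrand (ContinuousLinearMap.mul ℂ ℂ) hi2'
  have hGv : ∫ p : (ℝ × ℝ) × (ℝ × ℝ), ContinuousLinearMap.mul ℂ ℂ (h1 p.2) (h2 (p.1 - p.2)) =
      (∫ q, h1 q) * ∫ q, k2 q := by
    rw [← hv2']
    exact (integral_prod _ hG).trans (integral_convolution (ContinuousLinearMap.mul ℂ ℂ) hi1 hi2')
  have hR := measurePreserving_regroup
  have hRi := hR.integrable_comp_of_integrable hG
  have hRv : ∫ q : (ℝ × ℝ × ℝ) × ℝ, ContinuousLinearMap.mul ℂ ℂ (h1 (q.1.2.1, q.2))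
      (h2 ((q.1.1, q.1.2.2) - (q.1.2.1, q.2))) = (∫ q, h1 q) * ∫ q, k2 q := by
    rw [← hGv, ← hR.map_eq, integral_map hR.measurable.aemeasurable]
    rw [hR.map_eq]
    exact hG.aestronglyMeasurable
  have hF : ∀ q : (ℝ × ℝ × ℝ) × ℝ, ContinuousLinearMap.mul ℂ ℂ (h1 (q.1.2.1, q.2))
      (h2 ((q.1.1, q.1.2.2) - (q.1.2.1, q.2))) =
      Complex.exp (-(lam * q.1.1 : ℝ) + Complex.I * (μ * q.1.2.2 : ℝ) - (ν * q.1.2.1 : ℝ)) *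
        (planeDensity N (q.1.2.1, q.2) * planeDensity N (q.1.1 - q.1.2.1, q.2 - q.1.2.2)) := by
    intro q
    simp only [ContinuousLinearMap.mul_apply', hh1, hh2, hk2, Prod.mk_sub_mk, neg_sub,
      Complex.ofReal_exp]
    have e : ∀ a b c d u v : ℂ, Complex.exp a * (Complex.exp b * u) *
        (Complex.exp c * (Complex.exp d * v)) = Complex.exp (a + b + c + d) * (u * v) := by
      intro a b c d u v
      rw [Complex.exp_add, Complex.exp_add, Complex.exp_add]
      ring
    rw [e]
    congr 2
    push_cast
    ring
  have hRi' : Integrable (fun q : (ℝ × ℝ × ℝ) × ℝ =>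
      Complex.exp (-(lam * q.1.1 : ℝ) + Complex.I * (μ * q.1.2.2 : ℝ) - (ν * q.1.2.1 : ℝ)) *
        ((planeDensity N (q.1.2.1, q.2) : ℂ) * planeDensity N (q.1.1 - q.1.2.1, q.2 - q.1.2.2)))
      ((volume : Measure (ℝ × ℝ × ℝ)).prod (volume : Measure ℝ)) :=
    hRi.congr (Eventually.of_forall hF)
  simp only [hF] at hRv
  simp only [ofReal_jointDensity, ← integral_const_mul]
  refine ⟨hRi'.integral_prod_left, ?_⟩
  rw [← hv1, ← hv2, ← hRv]
  exact (integral_prod _ hRi').symm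

theorem resolventProd_neg_I_mul {N : ℕ} (μ : ℝ) (y : ℂ) :
    resolventProd N (-(Complex.I * μ)) y = (∏ θ ∈ rootsJ N, (y - Complex.I * μ * θ))⁻¹ := by
  rw [resolventProd, Finset.prod_inv_distrib]
  congr 1
  exact Finset.prod_congr rfl fun θ _ => by ring

theorem resolventProd_I_mul {N : ℕ} (hN : 0 < N) (hE : Even N) (μ : ℝ) (y : ℂ) :
    resolventProd N (Complex.I * μ) y = (∏ θ ∈ rootsK N, (y - Complex.I * μ * θ))⁻¹ := by
  rw [resolventProd, Finset.prod_inv_distrib, prod_rootsK hN hE]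
  congr 1
  exact Finset.prod_congr rfl fun θ _ => by ring

theorem isJointDensity_jointDensity {N : ℕ} (hN : 2 ≤ N) (hE : Even N) :
    IsJointDensity N (jointDensity N) := by
  intro lam ν μ hl hν
  have h0 : 0 < N := by omega
  constructor
  · have h := (integral_exp_mul_jointDensity hN hE hl hν 0).1.re
    refine Integrable.integrableOn (h.congr (Eventually.of_forall fun q => ?_))
    have e : Complex.exp (-(lam * q.1 : ℝ) + Complex.I * ((0 : ℝ) * q.2.2 : ℝ) - (ν * q.2.1 : ℝ)) *
        (jointDensity N q.1 q.2.1 q.2.2 : ℂ) =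
        ((Real.exp (-lam * q.1 - ν * q.2.1) * jointDensity N q.1 q.2.1 q.2.2 : ℝ) : ℂ) := by
      push_cast
      congr 2
      ring
    simp only [e]
    exact Complex.ofReal_re _
  · rw [setIntegral_eq_integral_of_forall_compl_eq_zero, (integral_exp_mul_jointDensity hN hE hl hν μ).2,
      resolventProd_neg_I_mul, resolventProd_I_mul h0 hE, ← mul_inv]
    · exact hasTransform hN hE hl hν μ
    · intro q hq
      have : jointDensity N q.1 q.2.1 q.2.2 = 0 := by
        rcases le_or_gt q.2.1 0 with h | h
        · exact jointDensity_of_nonpos N _ h _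
        · refine jointDensity_of_le N ?_ _
          by_contra! h'
          exact hq ⟨h.trans h', h, mem_univ _⟩
      rw [this, Complex.ofReal_zero, mul_zero]

/-! ### The Laplace transform in time of the joint density -/

/-- The substitution `θ = -c` and an exchange of sums; the leading minus sign is absorbed in
`-(-c)^{m+1} = c(-c)^m`. -/
theorem laplaceFormula_eq {N : ℕ} (hN : 0 < N) (hE : Even N) (lam s x : ℝ) :
    laplaceFormula N lam s x = ((Real.exp (-lam * s) * lam ^ (-(((rootsK N).card : ℝ) - 1) / N) : ℝ) : ℂ) *
      ∑ c ∈ rootsJ N, vandermondeCoeff (rootsJ N) c * c *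
        Complex.exp (c * ((lam ^ (1 / (N : ℝ)) : ℝ) : ℂ) * x) *
        (((s ^ (-((rootsK N).card : ℝ) / N) : ℝ) : ℂ) *
          ∑ m ∈ Finset.range ((rootsK N).card + 1), alpha N (-(m : ℤ)) * (-c) ^ m *
            ((((lam * s) ^ ((m : ℝ) / N) : ℝ) : ℂ) *
              mittagLeffler 1 (((m : ℝ) + (rootsJ N).card) / N) ((lam * s : ℝ) : ℂ))) := by
  rw [laplaceFormula]
  simp only [sum_rootsK hN hE, vandermondeCoeff_rootsK hN hE, Finset.mul_sum]
  rw [Finset.sum_comm]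
  refine Finset.sum_congr rfl fun c _ => Finset.sum_congr rfl fun m _ => ?_
  rw [neg_neg]
  push_cast
  ring

/-- Fubini in `(t,y)`: the `t`-integral turns the second factor into exponentials in `y - x`, which
is positive since `x ≤ 0 < y`. The remaining `y`-integrals are Laplace transforms of `h(s,·)` at
`cλ^{1/N}`. -/
theorem laplace_jointDensity {N : ℕ} (hN : 2 ≤ N) (hE : Even N) {lam s x : ℝ} (hl : 0 < lam)
    (hs : 0 < s) (hx : x ≤ 0) :
    IntegrableOn (fun t : ℝ => Real.exp (-lam * t) * jointDensity N t s x) (Ioi 0) ∧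
    ((∫ t in Ioi (0 : ℝ), Real.exp (-lam * t) * jointDensity N t s x : ℝ) : ℂ) =
      laplaceFormula N lam s x := by
  have h0 : 0 < N := by omega
  set l := lam ^ (1 / (N : ℝ)) with hldef
  have hl0 : 0 < l := Real.rpow_pos_of_pos hl _
  have hm := measurable_planeDensity hN hE
  set W : ℝ × ℝ → ℂ := fun q => (Real.exp (-(lam * q.1)) : ℂ) * planeDensity N q with hW
  have hWi : Integrable W := by
    have := (integrable_exp_mul_planeDensity hN hE hl (p := 0) le_rfl).1
    simpa [hW] using this
  obtain ⟨C, hC, hb⟩ := exists_abs_planeDensity_le hN hE (v := s) hs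
  have hbs : ∀ y, |planeDensity N (s, y)| ≤ C := fun y =>
    (hb s (right_mem_Icc.2 le_rfl) y).trans
      (mul_le_of_le_one_right hC (inv_le_one_of_one_le₀ (by nlinarith [sq_nonneg y])))
  set k : ℝ × ℝ → ℂ := fun q => ((Real.exp (-(lam * s)) : ℂ) * planeDensity N (s, q.2)) *
    W (q.1 - s, q.2 - x) with hk
  -- A translate of the integrable `W` times a bounded factor: for fixed `s` the density is bounded
  -- in `y`.
  have hki : Integrable k ((volume : Measure ℝ).prod volume) := by
    have h1 : Integrable (fun q : ℝ × ℝ => W (q - (s, x))) := hWi.comp_sub_right (s, x)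
    refine h1.bdd_mul (f := fun q : ℝ × ℝ => (Real.exp (-(lam * s)) : ℂ) * planeDensity N (s, q.2))
      (c := Real.exp (-(lam * s)) * C) ?_ (Eventually.of_forall fun q => ?_)
    · exact (Measurable.const_mul (Complex.measurable_ofReal.comp
        (hm.comp (by fun_prop))) _).aestronglyMeasurable
    · rw [norm_mul, Complex.norm_real, Complex.norm_real, Real.norm_of_nonneg (Real.exp_pos _).le]
      exact mul_le_mul_of_nonneg_left (hbs _) (Real.exp_pos _).le
  have hkf : ∀ t, ∫ y, k (t, y) = ((Real.exp (-lam * t) * jointDensity N t s x : ℝ) : ℂ) := by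
    intro t
    rw [Complex.ofReal_mul, ofReal_jointDensity, ← integral_const_mul]
    congr 1
    funext y
    have : Real.exp (-lam * t) = Real.exp (-(lam * s)) * Real.exp (-(lam * (t - s))) := by
      rw [← Real.exp_add]; ring_nf
    simp only [hk, hW, this]
    push_cast
    ring
  have hint := hki.integral_prod_left
  simp only [hkf] at hint
  have hre : Integrable fun t : ℝ => Real.exp (-lam * t) * jointDensity N t s x := by
    simpa only [RCLike.re_to_complex, Complex.ofReal_re] using hint.re
  refine ⟨hre.integrableOn, ?_⟩
  rw [setIntegral_eq_integral_of_forall_compl_eq_zero fun t ht => by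
    rw [jointDensity_of_le N ((not_lt.1 ht).trans hs.le), mul_zero], ← integral_complex_ofReal]
  simp only [← hkf]
  rw [integral_integral_swap hki]
  set M := (rootsJ N).card - 1 with hM
  have hL : ∀ᵐ y : ℝ, 0 < y → ∫ t, W (t - s, y - x) =
      ((l : ℂ) ^ M)⁻¹ * ∑ c ∈ rootsJ N, vandermondeCoeff (rootsJ N) c * c *
        Complex.exp (-c * ((l : ℂ) * (y - x : ℝ))) := by
    have h1 := (ae_restrict_iff' measurableSet_Ioi).1 (laplace_halfDensity hN hE hl)
    have h2 := (measurePreserving_sub_right (volume : Measure ℝ) x).quasiMeasurePreserving.ae h1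
    filter_upwards [h2] with y hy hy0
    have hyx : 0 < y - x := by linarith
    rw [integral_sub_right_eq_self (fun r => W (r, y - x)), ← hy hyx,
      ← setIntegral_eq_integral_of_forall_compl_eq_zero (s := Ioi 0) fun r hr => by
        simp only [hW]
        rw [planeDensity_of_fst_nonpos N (not_lt.1 hr), Complex.ofReal_zero, mul_zero]]
    refine setIntegral_congr_fun measurableSet_Ioi fun r hr => ?_
    simp only [hW]
    rw [planeDensity_of_pos N hr hyx]
  have hinner : ∀ᵐ y : ℝ, ∫ t, k (t, y) = (Ioi (0 : ℝ)).indicator (fun y : ℝ =>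
      ∑ c ∈ rootsJ N, (Real.exp (-(lam * s)) : ℂ) * ((l : ℂ) ^ M)⁻¹ *
        (vandermondeCoeff (rootsJ N) c * c * Complex.exp (c * l * x)) *
        (Complex.exp (-(c * (l : ℂ)) * y) * halfDensity N s y)) y := by
    filter_upwards [hL] with y hy
    simp only [hk]
    rw [integral_const_mul]
    rcases le_or_gt y 0 with hy0 | hy0
    · rw [planeDensity_of_snd_nonpos N s hy0, indicator_of_notMem (by simpa using hy0)]
      simp
    · rw [hy hy0, planeDensity_of_pos N hs hy0, indicator_of_mem (mem_Ioi.2 hy0), Finset.mul_sum,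
        Finset.mul_sum]
      refine Finset.sum_congr rfl fun c _ => ?_
      have e : Complex.exp (-c * ((l : ℂ) * (y - x : ℝ))) =
          Complex.exp (c * l * x) * Complex.exp (-(c * (l : ℂ)) * y) := by
        rw [← Complex.exp_add]
        push_cast
        ring_nf
      rw [e]
      ring
  have hci : ∀ c ∈ rootsJ N, IntegrableOn (fun y : ℝ =>
      (Real.exp (-(lam * s)) : ℂ) * ((l : ℂ) ^ M)⁻¹ *
        (vandermondeCoeff (rootsJ N) c * c * Complex.exp (c * l * x)) *
        (Complex.exp (-(c * (l : ℂ)) * y) * halfDensity N s y)) (Ioi 0) := by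
    intro c hc
    have hpre : 0 ≤ (c * (l : ℂ)).re := by
      rw [Complex.re_mul_ofReal]
      exact mul_nonneg ((mem_rootsJ h0).1 hc).2.le hl0.le
    refine Integrable.const_mul ?_ _
    obtain ⟨C', hC', hb'⟩ := exists_abs_halfDensity_le hN hE
    refine ((integrableOn_scaledBound N hs).1.const_mul C').mono' ?_
      ((ae_restrict_iff' measurableSet_Ioi).2 (Eventually.of_forall fun y hy => ?_))
    · refine ContinuousOn.aestronglyMeasurable ?_ measurableSet_Ioi
      refine (Continuous.continuousOn (by fun_prop)).mul
        (Complex.continuous_ofReal.comp_continuousOn ?_)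
      exact (continuousOn_halfDensity hN hE).comp (f := fun y : ℝ => (s, y)) (by fun_prop)
        fun y hy => ⟨hs, Ioi_subset_Ici_self hy⟩
    · rw [norm_mul, Complex.norm_real]
      exact (mul_le_of_le_one_left (norm_nonneg _) (norm_exp_neg_mul_le hpre (le_of_lt hy))).trans
        (hb' s y hs (le_of_lt hy))
  have hlM : lam ^ (-(((rootsK N).card : ℝ) - 1) / N) = (l ^ M)⁻¹ := by
    have hpos : 1 ≤ (rootsJ N).card := by rw [card_rootsJ h0 hE]; omega
    rw [hldef, ← Real.rpow_natCast, ← Real.rpow_mul hl.le, ← Real.rpow_neg hl.le,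
      card_rootsK h0 hE, hM, Nat.cast_sub hpos]
    congr 1
    push_cast
    ring
  rw [integral_congr_ae hinner, integral_indicator measurableSet_Ioi, integral_finsetSum _ hci,
    laplaceFormula_eq h0 hE, hlM, Finset.mul_sum]
  refine Finset.sum_congr rfl fun c hc => ?_
  rw [integral_const_mul, integral_exp_mul_halfDensity hN hE hl hs hc, neg_mul]
  push_cast
  ring

/-! ### Uniqueness of the joint density -/

theorem ae_eq_of_isJointDensity {N : ℕ} {f g : ℝ → ℝ → ℝ → ℝ} (hf : IsJointDensity N f)
    (hg : IsJointDensity N g) :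
    ∀ᵐ q : ℝ × ℝ × ℝ ∂(volume.restrict (Ioi (0 : ℝ) ×ˢ Ioi (0 : ℝ) ×ˢ (univ : Set ℝ))),
      f q.1 q.2.1 q.2.2 = g q.1 q.2.1 q.2.2 := by
  have hint : ∀ {f : ℝ → ℝ → ℝ → ℝ}, IsJointDensity N f → ∀ lam ν μ : ℝ, 0 < lam → 0 < ν →
      IntegrableOn (fun q : ℝ × ℝ × ℝ => Complex.exp (-(lam * q.1 : ℝ) +
        Complex.I * (μ * q.2.2 : ℝ) - (ν * q.2.1 : ℝ)) * (f q.1 q.2.1 q.2.2 : ℂ))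
        (Ioi 0 ×ˢ Ioi 0 ×ˢ univ) := by
    intro f hf lam ν μ hl hν
    have h1 : Integrable (fun q : ℝ × ℝ × ℝ =>
        ((Real.exp (-lam * q.1 - ν * q.2.1) * f q.1 q.2.1 q.2.2 : ℝ) : ℂ))
        (volume.restrict (Ioi 0 ×ˢ Ioi 0 ×ˢ univ)) := Integrable.ofReal (hf lam ν μ hl hν).1
    refine (h1.bdd_mul (f := fun q : ℝ × ℝ × ℝ => Complex.exp (Complex.I * (μ * q.2.2 : ℝ)))
      (c := 1) (by fun_prop) (Eventually.of_forall fun q => (norm_exp_I_mul _).le)).congr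
      (Eventually.of_forall fun q => ?_)
    simp only [Complex.ofReal_mul, Complex.ofReal_exp, ← mul_assoc, ← Complex.exp_add]
    congr 2
    push_cast
    ring
  have h := ae_eq_zero_of_laplace_laplace_fourier
    (g := fun q => f q.1 q.2.1 q.2.2 - g q.1 q.2.1 q.2.2) ?_ ?_
  · filter_upwards [h] with q hq
    exact sub_eq_zero.1 hq
  · refine ((hf 1 1 0 one_pos one_pos).1.sub (hg 1 1 0 one_pos one_pos).1).congr
      (Eventually.of_forall fun q => ?_)
    simp only [Pi.sub_apply, neg_mul, one_mul, mul_sub]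
  · intro lam ν μ hl hν
    -- Both transforms are limits of the same sequence `E_n`.
    have e := tendsto_nhds_unique (hf lam ν μ hl hν).2.2 (hg lam ν μ hl hν).2.2
    simp only [Complex.ofReal_sub, mul_sub]
    rw [integral_sub (hint hf lam ν μ hl hν) (hint hg lam ν μ hl hν), e, sub_self]

/-- Any version agrees with `jointDensity` for almost every `(t,s,x)`. Fubini with the time variable
inside gives, for almost every `(s,x)`, agreement for almost every `t`, hence equal Laplace
transforms. -/
theorem laplace_of_isJointDensity {N : ℕ} (hN : 2 ≤ N) (hE : Even N) {f : ℝ → ℝ → ℝ → ℝ}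
    (hf : IsJointDensity N f) {lam : ℝ} (hl : 0 < lam) :
    ∀ᵐ q : ℝ × ℝ ∂(volume.restrict (Ioi (0 : ℝ) ×ˢ Iic (0 : ℝ))),
      IntegrableOn (fun t : ℝ => Real.exp (-lam * t) * f t q.1 q.2) (Ioi 0) ∧
      ((∫ t in Ioi (0 : ℝ), Real.exp (-lam * t) * f t q.1 q.2 : ℝ) : ℂ) =
        laplaceFormula N lam q.1 q.2 := by
  have h := ae_eq_of_isJointDensity hf (isJointDensity_jointDensity hN hE)
  have hprod : (volume : Measure (ℝ × ℝ × ℝ)).restrict (Ioi 0 ×ˢ Ioi 0 ×ˢ univ) =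
      ((volume : Measure ℝ).restrict (Ioi 0)).prod
        ((volume : Measure (ℝ × ℝ)).restrict (Ioi 0 ×ˢ univ)) := (Measure.prod_restrict _ _).symm
  rw [hprod] at h
  have h2 := Measure.ae_ae_of_ae_prod
    ((Measure.measurePreserving_swap).quasiMeasurePreserving.ae h)
  have h3 := ae_restrict_of_ae_restrict_of_subset
    (prod_mono_right (subset_univ (Iic (0 : ℝ)))) h2
  have hmem := ae_restrict_mem (μ := (volume : Measure (ℝ × ℝ)))
    ((measurableSet_Ioi (a := (0 : ℝ))).prod (measurableSet_Iic (a := (0 : ℝ))))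
  filter_upwards [h3, hmem] with q hq hqm
  obtain ⟨hi, hv⟩ := laplace_jointDensity hN hE hl (mem_Ioi.1 hqm.1) (mem_Iic.1 hqm.2)
  have hae : (fun t : ℝ => Real.exp (-lam * t) * f t q.1 q.2) =ᵐ[volume.restrict (Ioi 0)]
      fun t => Real.exp (-lam * t) * jointDensity N t q.1 q.2 := by
    filter_upwards [hq] with t ht
    exact congrArg (Real.exp (-lam * t) * ·) ht
  exact ⟨Integrable.congr hi hae.symm, by rw [integral_congr_ae hae, hv]⟩

end PseudoProcess

/-! ### Existence of the density and the formula for all versions -/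

theorem mainTheorem4 (N : ℕ) (hN : 2 ≤ N) (hEven : Even N) :
    -- the density exists, in a version for which the formula holds at every point
    (∃ f : ℝ → ℝ → ℝ → ℝ,
      PseudoProcess.IsJointDensity N f ∧
      (∀ t s x : ℝ, t ≤ s → f t s x = 0) ∧
      ContinuousOn (fun q : ℝ × ℝ × ℝ => f q.1 q.2.1 q.2.2)
        {q : ℝ × ℝ × ℝ | 0 < q.2.1 ∧ q.2.1 < q.1 ∧ q.2.2 ≤ 0} ∧
      ∀ lam s x : ℝ, 0 < lam → 0 < s → x ≤ 0 →
        IntegrableOn (fun t : ℝ => Real.exp (-lam * t) * f t s x) (Ioi 0) ∧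
        ((∫ t in Ioi (0 : ℝ), Real.exp (-lam * t) * f t s x : ℝ) : ℂ) =
          PseudoProcess.laplaceFormula N lam s x) ∧
    -- and the formula holds almost everywhere for every version of the density
    (∀ f : ℝ → ℝ → ℝ → ℝ, PseudoProcess.IsJointDensity N f →
      ∀ lam : ℝ, 0 < lam →
        ∀ᵐ q : ℝ × ℝ ∂(volume.restrict (Ioi (0 : ℝ) ×ˢ Iic (0 : ℝ))),
          IntegrableOn (fun t : ℝ => Real.exp (-lam * t) * f t q.1 q.2) (Ioi 0) ∧
          ((∫ t in Ioi (0 : ℝ), Real.exp (-lam * t) * f t q.1 q.2 : ℝ) : ℂ) =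
            PseudoProcess.laplaceFormula N lam q.1 q.2) :=
  ⟨⟨PseudoProcess.jointDensity N, PseudoProcess.isJointDensity_jointDensity hN hEven,
    fun _ _ x h => PseudoProcess.jointDensity_of_le N h x,
    PseudoProcess.continuousOn_jointDensity hN hEven,
    fun _ _ _ hl hs hx => PseudoProcess.laplace_jointDensity hN hEven hl hs hx⟩,
    fun _ hf _ hl => PseudoProcess.laplace_of_isJointDensity hN hEven hf hl⟩
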